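/- Setting. Let $\mathbb G=\bigsqcup_{n\in\mathbb Z}S_n$ with finite non-empty $S_n$ (the shells). A one-channel operator on $\ell^2(\mathbb G)=\bigoplus_n\ell^2(S_n)$ is given by Hermitian matrices $V_n$ on $\ell^2(S_n)$, real numbers $a_n\neq0$ and unit vectors $\Phi_n,\Upsilon_n\in\ell^2(S_n)$ through $$(\mathcal H\Psi)_n=-a_{n+1}\Phi_n\,\Upsilon_{n+1}^*\Psi_{n+1}-a_n\Upsilon_n\,\Phi_{n-1}^*\Psi_{n-1}+V_n\Psi_n ,$$ and $\mathcal H^+$ is its restriction to $\bigoplus_{n\ge1}\ell^2(S_n)$ (with $\Psi_0=0$). The operator is called uniquely self-adjoint if it is essentially self-adjoint on the vectors with only finitely many non-zero components $\Psi_n$; if $\mathcal H$ is uniquely self-adjoint, so is $\mathcal H^+$, and $\mathcal H$, $\mathcal H^+$ then also denote the self-adjoint closures. Let $\mathbb W_n$ and $\tilde{\mathbb W}_n$ be the smallest $V_n$-invariant subspaces of $\ell^2(S_n)$ containing $\Upsilon_n$ and $\Phi_n$, respectively, $\mathbb V_n=\mathbb W_n+\tilde{\mathbb W}_n$, $\mathbb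 V=\bigoplus_{n\in\mathbb Z}\mathbb V_n$ and $\mathbb V^+=\tilde{\mathbb W}_1\oplus\bigoplus_{n\ge2}\mathbb V_n$; these spaces reduce $\mathcal H$ and $\mathcal H^+$, respectively. With $$\alpha_{z,n}=\Upsilon_n^*(V_n-z)^{-1}\Upsilon_n,\quad \beta_{z,n}=\Upsilon_n^*(V_n-z)^{-1}\Phi_n,\quad \gamma_{z,n}=\Phi_n^*(V_n-z)^{-1}\Upsilon_n,\quad \delta_{z,n}=\Phi_n^*(V_n-z)^{-1}\Phi_n$$ the transfer matrices are $$T_{z,n}=\begin{pmatrix}a_n^{-1}\beta_{z,n}^{-1}&-a_n\beta_{z,n}^{-1}\alpha_{z,n}\\ a_n^{-1}\delta_{z,n}\beta_{z,n}^{-1}&a_n(\gamma_{z,n}-\delta_{z,n}\beta_{z,n}^{-1}\alpha_{z,n})\end{pmatrix},$$ extended holomorphically in $z$ wherever this is possible (and nowhere defined if $\beta_{z,n}$ vanishes identically in $z$). Let $A_n$ be the set of all $z\in\mathbb C$ for which $T_{z,n}$ or $T_{z,n}^{-1}$ is not defined, $B_\infty=\bigcup_{n\in\mathbb Z}A_n$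 and $B_{1,\infty}=\bigcup_{n\ge1}A_n$. For positive $t_n\to0$, a family of complex random variables $X_n(\lambda)$, $n\ge1$, $\lambda\in\Lambda$, is uniformly well-balanced $\mathcal O(t_n)$-close to $X(\lambda)\in\mathbb C$ up to $K$ moments if there are constants $C_0,\dots,C_K$ such that $\mathbb E|X_n(\lambda)-X(\lambda)|^k\le C_kt_n^k$ and $|\mathbb E X_n(\lambda)-X(\lambda)|<C_0t_n^2$ for all $n\ge1$, $1\le k\le K$ and $\lambda\in\Lambda$. For matrices this is required of each entry. The spectrum of a self-adjoint operator in a Borel set $B\subset\mathbb R$ is purely absolutely continuous if all its spectral measures, restricted to $B$, are absolutely continuous with respect to Lebesgue measure. Theorem. Let the data $(V_n,a_n,\Phi_n,\Upsilon_n)=(V_n(\omega),a_n(\omega),\Phi_n(\omega),\Upsilon_n(\omega))$ be random variables on a probability space (with fixed shells $S_n$), such that the resulting random one-channel operator $\mathcal H_\omega$ is almost surely uniquely self-adjoint. Let $I\subset\mathbb R$ be open, and suppose that for each $\lambda\in I$ the transfer matrices $T_{\lambda,n}$, $n\ge1$, are almost surely defined and are stochastically independent in $n$. Let $T:I\to\{e^{ir}M: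 r\in\mathbb R,\ M\in \mathrm{SL}(2,\mathbb R)\}$ be continuous with $|\operatorname{Tr}T(\lambda)|<2$ for all $\lambda\in I$, and let $t_n>0$ satisfy $\sum_{n\ge1}t_n^2<\infty$. Assume that for every compact interval $[a,b]\subset I$ the transfer matrices $T_{\lambda,n}$ are uniformly well-balanced $\mathcal O(t_n)$-close to $T(\lambda)$ up to $4$ moments for $\lambda\in[a,b]$. Then, almost surely, the spectrum of $\mathcal H_\omega|\mathbb V_\omega$ in $I\setminus B_\infty(\omega)$ and the spectrum of $\mathcal H^+_\omega|\mathbb V^+_\omega$ in $I\setminus B_{1,\infty}(\omega)$ are purely absolutely continuous. -/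

import Mathlib

open MeasureTheory ProbabilityTheory Filter Topology
open scoped ENNReal

noncomputable section

namespace OneChannel

/-! ### Operators on a Hilbert space -/

section Operators

/-- The part `A|K` of a (possibly unbounded) operator `A` in a subspace `K`: its graph consists of
the pairs `(x, y)` in `K × K` with `x` in the domain of `A` and `A x = y`. -/
def part {E : Type*} [NormedAddCommGroup E] [InnerProductSpace ℂ E]
    (A : E →ₗ.[ℂ] E) (K : Submodule ℂ E) : K →ₗ.[ℂ] K :=
  (A.graph.comap (K.subtype.prodMap K.subtype)).toLinearPMap

/-- `μ` is the spectral measure of `A` at `ψ`, i.e. `⟪ψ, f(A) ψ⟫ = ∫ f dμ`. As usual this is expressed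
by the resolvent functions `f(x) = (x - z)⁻¹` with non-real `z`, which determine the finite
measure `μ`: the vector `φ` is `(A - z)⁻¹ ψ`. -/
def IsSpectralMeasure {E : Type*} [NormedAddCommGroup E] [InnerProductSpace ℂ E]
    (A : E →ₗ.[ℂ] E) (ψ : E) (μ : Measure ℝ) : Prop :=
  IsFiniteMeasure μ ∧ ∀ z : ℂ, z.im ≠ 0 → ∃ φ : A.domain,
    A φ - z • (φ : E) = ψ ∧ inner ℂ ψ (φ : E) = ∫ x : ℝ, ((x : ℂ) - z)⁻¹ ∂μ

/-- The spectrum of `A` in the set `B` is purely absolutely continuous: all spectral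
measures of `A` are absolutely continuous on `B` with respect to Lebesgue measure. -/
def PurelyACOn {E : Type*} [NormedAddCommGroup E] [InnerProductSpace ℂ E]
    (A : E →ₗ.[ℂ] E) (B : Set ℝ) : Prop :=
  ∀ ψ : E, ∃ μ : Measure ℝ, IsSpectralMeasure A ψ μ ∧ μ.restrict B ≪ volume

end Operators

/-! ### One-channel operators -/

/-- The data of a one-channel operator over `𝔾 = ⨆ₙ Sₙ`, `n ∈ ℤ`, with finite shells `Sₙ`: the
Hermitian diagonal blocks `Vₙ`, and the rank one off-diagonal blocks
`Dₙ = -aₙ Υₙ Φₙ₋₁^*` from shell `n-1` to shell `n`, with unit vectors `Υₙ`, `Φₙ` in `ℓ²(Sₙ)` and real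
`aₙ ≠ 0`. Every block of rank one can be written in this form. -/
structure Data (S : ℤ → Type*) [∀ n, Fintype (S n)] where
  V : ∀ n, Matrix (S n) (S n) ℂ
  a : ℤ → ℝ
  Φ : ∀ n, EuclideanSpace ℂ (S n)
  Υ : ∀ n, EuclideanSpace ℂ (S n)
  isHermitian : ∀ n, (V n).IsHermitian
  a_ne_zero : ∀ n, a n ≠ 0
  norm_Φ : ∀ n, ‖Φ n‖ = 1
  norm_Υ : ∀ n, ‖Υ n‖ = 1

/-- `ℓ²(⨆_{n ∈ J} Sₙ) = ⨁_{n ∈ J} ℓ²(Sₙ)`. The full space is `J = univ`, the half space `𝔾⁺` is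
`J = {n ≥ 1}`. -/
abbrev L2 (S : ℤ → Type*) [∀ n, Fintype (S n)] (J : Set ℤ) : Type _ :=
  lp (fun n : J => EuclideanSpace ℂ (S n)) 2

/-- Extension by `0` to all shells. -/
def zeroExt {S : ℤ → Type*} [∀ n, Fintype (S n)] (J : Set ℤ)
    (Ψ : ∀ n : J, EuclideanSpace ℂ (S n)) (n : ℤ) : EuclideanSpace ℂ (S n) :=
  open Classical in if h : n ∈ J then Ψ ⟨n, h⟩ else 0

theorem zeroExt_add {S : ℤ → Type*} [∀ n, Fintype (S n)] (J : Set ℤ)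
    (x y : ∀ n : J, EuclideanSpace ℂ (S n)) (n : ℤ) :
    zeroExt J (x + y) n = zeroExt J x n + zeroExt J y n := by
  unfold zeroExt; split <;> simp

theorem zeroExt_smul {S : ℤ → Type*} [∀ n, Fintype (S n)] (J : Set ℤ) (c : ℂ)
    (x : ∀ n : J, EuclideanSpace ℂ (S n)) (n : ℤ) :
    zeroExt J (c • x) n = c • zeroExt J x n := by
  unfold zeroExt; split <;> simp

/-- The space of all `Ψ` with `Ψₙ ∈ Kₙ` for all `n ∈ J`. -/
def blockSubmodule {S : ℤ → Type*} [∀ n, Fintype (S n)] (J : Set ℤ)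
    (K : ∀ n, Submodule ℂ (EuclideanSpace ℂ (S n))) : Submodule ℂ (L2 S J) where
  carrier := {Ψ | ∀ n : J, Ψ n ∈ K n}
  add_mem' hx hy n := (K n).add_mem (hx n) (hy n)
  zero_mem' n := (K n).zero_mem
  smul_mem' c _ hx n := (K n).smul_mem c (hx n)

namespace Data

variable {S : ℤ → Type*} [∀ n, Fintype (S n)] [∀ n, DecidableEq (S n)]

/-- `(HΨ)ₙ = -aₙ₊₁ Φₙ Υₙ₊₁^* Ψₙ₊₁ - aₙ Υₙ Φₙ₋₁^* Ψₙ₋₁ + Vₙ Ψₙ` -/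
def formal (D : Data S) (Ψ : ∀ n, EuclideanSpace ℂ (S n)) (n : ℤ) : EuclideanSpace ℂ (S n) :=
  -((D.a (n + 1) : ℂ) * inner ℂ (D.Υ (n + 1)) (Ψ (n + 1))) • D.Φ n
    - ((D.a n : ℂ) * inner ℂ (D.Φ (n - 1)) (Ψ (n - 1))) • D.Υ n
    + (D.V n).toEuclideanLin (Ψ n)

theorem formal_add (D : Data S) (x y : ∀ n, EuclideanSpace ℂ (S n)) (n : ℤ) :
    D.formal (fun k => x k + y k) n = D.formal x n + D.formal y n := by
  simp only [formal, inner_add_right, map_add, mul_add, add_smul, neg_add]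
  abel

theorem formal_smul (D : Data S) (c : ℂ) (x : ∀ n, EuclideanSpace ℂ (S n)) (n : ℤ) :
    D.formal (fun k => c • x k) n = c • D.formal x n := by
  simp only [formal, inner_smul_right, map_smul, smul_add, smul_sub, smul_smul, smul_neg, neg_smul]
  congr 3
  · ring_nf
  · ring

theorem finite_formal (D : Data S) (J : Set ℤ) (x : ∀ n : J, EuclideanSpace ℂ (S n))
    (hx : {n : J | x n ≠ 0}.Finite) : {n : J | D.formal (zeroExt J x) n ≠ 0}.Finite := by
  have hF : {n : ℤ | zeroExt J x n ≠ 0}.Finite := by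
    refine (hx.image Subtype.val).subset fun n hn => ?_
    by_cases h : n ∈ J
    · exact ⟨⟨n, h⟩, by simpa [zeroExt, h] using hn, rfl⟩
    · simp [zeroExt, h] at hn
  have hG : {n : ℤ | D.formal (zeroExt J x) n ≠ 0}.Finite := by
    refine (hF.union ((hF.image (· - 1)).union (hF.image (· + 1)))).subset fun n hn => ?_
    by_contra hc
    simp only [Set.mem_union, Set.mem_ofPred_eq, Set.mem_image, not_or, not_exists, not_and,
      not_not] at hc
    obtain ⟨h0, h1, h2⟩ := hc
    have e1 : zeroExt J x (n + 1) = 0 := by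
      by_contra h; exact h1 _ h (by ring)
    have e2 : zeroExt J x (n - 1) = 0 := by
      by_contra h; exact h2 _ h (by ring)
    exact hn (by simp [formal, h0, e1, e2])
  exact hG.preimage Subtype.val_injective.injOn

/-- The restriction of `H` to the shells in `J` (Dirichlet boundary conditions), on the minimal
domain of all `Ψ` with `Ψₙ = 0` for all but finitely many `n`. -/
def Hmin (D : Data S) (J : Set ℤ) : L2 S J →ₗ.[ℂ] L2 S J where
  domain :=
    { carrier := {Ψ | {n : J | Ψ n ≠ 0}.Finite}
      add_mem' := fun {x y} hx hy => (hx.union hy).subset fun n hn => by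
        by_contra hc
        simp only [Set.mem_union, Set.mem_ofPred_eq, not_or, not_not] at hc
        exact hn (by simp [hc.1, hc.2])
      zero_mem' := by simp
      smul_mem' := fun c x hx => hx.subset fun n hn hc => hn (by simp [hc]) }
  toFun :=
    { toFun := fun Ψ => ⟨fun n : J => D.formal (zeroExt J (fun k => (Ψ : L2 S J) k)) n,
        (memℓp_zero (D.finite_formal J _ Ψ.2)).of_exponent_ge zero_le⟩
      map_add' := fun x y => by
        ext1; funext n
        refine Eq.trans ?_ (D.formal_add _ _ n)
        exact congrArg (fun f => D.formal f n) (funext fun k => zeroExt_add J _ _ k)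
      map_smul' := fun c x => by
        ext1; funext n
        refine Eq.trans ?_ (D.formal_smul c _ n)
        exact congrArg (fun f => D.formal f n) (funext fun k => zeroExt_smul J c _ k) }

/-- `H` (on the shells in `J`) is uniquely self-adjoint: `Hmin` is essentially self-adjoint. -/
def UniquelySelfAdjoint (D : Data S) (J : Set ℤ) : Prop :=
  IsSelfAdjoint (D.Hmin J).closure

/-- The operator `H` (for `J = univ`), or `H⁺` (for `J = {n ≥ 1}`): the closure of `Hmin`. -/
def H (D : Data S) (J : Set ℤ) : L2 S J →ₗ.[ℂ] L2 S J :=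
  (D.Hmin J).closure

/-- The smallest `Vₙ`-invariant subspace of `ℓ²(Sₙ)` that contains `x`. -/
def cyclic (D : Data S) (n : ℤ) (x : EuclideanSpace ℂ (S n)) :
    Submodule ℂ (EuclideanSpace ℂ (S n)) :=
  sInf {p | x ∈ p ∧ ∀ y ∈ p, (D.V n).toEuclideanLin y ∈ p}

/-- `𝕍ₙ = 𝕎ₙ + 𝕎̃ₙ`, where `𝕎ₙ` is generated by `Υₙ` and `𝕎̃ₙ` by `Φₙ`. -/
def VV (D : Data S) (n : ℤ) : Submodule ℂ (EuclideanSpace ℂ (S n)) :=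
  D.cyclic n (D.Υ n) ⊔ D.cyclic n (D.Φ n)

/-- `𝕍 = ⨁ₙ 𝕍ₙ` in `ℓ²(𝔾)` -/
def fullSpace (D : Data S) : Submodule ℂ (L2 S Set.univ) :=
  blockSubmodule Set.univ D.VV

/-- `𝕍⁺ = 𝕎̃₁ ⊕ ⨁_{n ≥ 2} 𝕍ₙ` in `ℓ²(𝔾⁺)` -/
def halfSpace (D : Data S) : Submodule ℂ (L2 S (Set.Ici 1)) :=
  blockSubmodule (Set.Ici 1) fun n => if n = 1 then D.cyclic n (D.Φ n) else D.VV n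

/-- `x^* (Vₙ - z)⁻¹ y`, for `z` outside the spectrum of `Vₙ` -/
def green (D : Data S) (n : ℤ) (z : ℂ) (x y : EuclideanSpace ℂ (S n)) : ℂ :=
  inner ℂ x ((D.V n - z • (1 : Matrix (S n) (S n) ℂ))⁻¹.toEuclideanLin y)

def alpha (D : Data S) (n : ℤ) (z : ℂ) : ℂ := D.green n z (D.Υ n) (D.Υ n)

def beta (D : Data S) (n : ℤ) (z : ℂ) : ℂ := D.green n z (D.Υ n) (D.Φ n)

def gamma (D : Data S) (n : ℤ) (z : ℂ) : ℂ := D.green n z (D.Φ n) (D.Υ n)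

def delta (D : Data S) (n : ℤ) (z : ℂ) : ℂ := D.green n z (D.Φ n) (D.Φ n)

/-- The formula for the transfer matrix, valid for `z` outside the spectrum of `Vₙ` with
`beta n z ≠ 0`. -/
def rawTransfer (D : Data S) (n : ℤ) (z : ℂ) : Matrix (Fin 2) (Fin 2) ℂ :=
  !![(D.a n : ℂ)⁻¹ * (D.beta n z)⁻¹, -(D.a n : ℂ) * (D.beta n z)⁻¹ * D.alpha n z;
    (D.a n : ℂ)⁻¹ * D.delta n z * (D.beta n z)⁻¹,
    (D.a n : ℂ) * (D.gamma n z - D.delta n z * (D.beta n z)⁻¹ * D.alpha n z)]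

/-- The transfer matrix `T_{z,n}` is defined at `z`, possibly by holomorphic extension: its entries
are rational functions (if the channel is not broken at `Sₙ`, i.e. if `beta n` is not identically
zero), and they extend holomorphically to `z` if and only if they have limits there. -/
def TransferDefined (D : Data S) (n : ℤ) (z : ℂ) : Prop :=
  (∀ᶠ w in 𝓝[≠] z, D.beta n w ≠ 0) ∧
    ∃ M : Matrix (Fin 2) (Fin 2) ℂ, Tendsto (D.rawTransfer n) (𝓝[≠] z) (𝓝 M)

/-- The transfer matrix `T_{z,n}`, including the values by holomorphic extension; the value `0` is
arbitrary and only taken where `T_{z,n}` is not defined. -/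
def transfer (D : Data S) (n : ℤ) (z : ℂ) : Matrix (Fin 2) (Fin 2) ℂ :=
  open Classical in if D.TransferDefined n z then limUnder (𝓝[≠] z) (D.rawTransfer n) else 0

/-- `Aₙ`: the set of all `z` such that `T_{z,n}` or its inverse is not defined -/
def A (D : Data S) (n : ℤ) : Set ℂ :=
  {z | ¬ (D.TransferDefined n z ∧ IsUnit (D.transfer n z))}

/-- `⋃_{n ∈ J} Aₙ`; this is `B_∞` for `J = univ` and `B_{1,∞}` for `J = {n ≥ 1}`. -/
def B (D : Data S) (J : Set ℤ) : Set ℂ :=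
  ⋃ n ∈ J, D.A n

end Data

/-- The family `X λ n`, `n ≥ 1`, of complex random variables is well-balanced `O(tₙ)`-close to `x λ`
up to `K` moments, uniformly for `λ` in `Λ`. -/
def UniformlyWellBalanced {Ω : Type*} [MeasurableSpace Ω] (P : Measure Ω) (t : ℕ → ℝ) (K : ℕ)
    (X : ℝ → ℕ → Ω → ℂ) (x : ℝ → ℂ) (Λ : Set ℝ) : Prop :=
  (∀ n, 1 ≤ n → 0 < t n) ∧ Tendsto t atTop (𝓝 0) ∧
    ∃ C : ℕ → ℝ, ∀ l ∈ Λ, ∀ n, 1 ≤ n →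
      AEMeasurable (X l n) P ∧
      (∀ k, 1 ≤ k → k ≤ K →
        ∫⁻ ω, ‖X l n ω - x l‖ₑ ^ k ∂P ≤ ENNReal.ofReal (C k * t n ^ k)) ∧
      ‖∫ ω, X l n ω ∂P - x l‖ < C 0 * t n ^ 2

/-- `exp(iℝ) SL(2,ℝ)` -/
def expSL2 : Set (Matrix (Fin 2) (Fin 2) ℂ) :=
  {T | ∃ (r : ℝ) (M : Matrix (Fin 2) (Fin 2) ℝ), M.det = 1 ∧
    T = Complex.exp (r * Complex.I) • M.map (fun x : ℝ => (x : ℂ))}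

/-- A random one-channel operator: the data are random variables. -/
def IsRandom {S : ℤ → Type*} [∀ n, Fintype (S n)] {Ω : Type*} [MeasurableSpace Ω]
    (D : Ω → Data S) : Prop :=
  (∀ n i j, Measurable fun ω => (D ω).V n i j) ∧ (∀ n, Measurable fun ω => (D ω).a n) ∧
    (∀ n i, Measurable fun ω => (D ω).Φ n i) ∧ (∀ n i, Measurable fun ω => (D ω).Υ n i)

end OneChannel

end

/-!
# Absolutely continuous spectrum of random one-channel operators

Absolute continuity is read off from Green's functions. A vector `ψ` has a spectral measure, whose
Stieltjes transform is `⟪ψ, (H - z)⁻¹ ψ⟫` (`IsResolvent.exists_measure`), and this measure charges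
no null set of an interval if the transform is a limit of functions holomorphic in the upper half
plane whose boundary values on the interval stay bounded in `L²` along a subsequence
(`measure_eq_zero_of_bound`). The
approximations are the Green's functions of finite boxes `|n| ≤ N` with the dissipative boundary
term `-i Φ_N Φ_N^*`; strong resolvent convergence holds because the vectors with finitely many
non-zero components form a core (`tendsto_boundedRes`).

The boundary term makes the transfer matrices effective. If `u` solves the box equation with source
`ψ`, then `|Φ_N^* u_N|²` is at most the imaginary part of the box Green's function `G`. The product
`T_N ⋯ T_1` maps the channel values at the origin, which bound `G`, to a multiple of
`Φ_N^* u_N` times a fixed vector, and its determinant has modulus one. Hence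
`|G| ≤ C (1 + √|G| ‖T_N ⋯ T_1‖)`, and so `|G| ≤ C' (1 + ‖T_N ⋯ T_1‖²)` with another constant
(`Data.norm_green_le`). Thus it suffices that the `L⁴` norms of the products over compact energy
intervals do not tend to infinity, the condition `Data.Regular`.

This bound covers `Φ₀`, `Υ₁`, and every vector in a single shell, except at the finitely many
exceptional energies of the shells between it and the origin. There a singular part could
only be an atom. Its eigenvector has vanishing channel values at the origin, as `Φ₀` and `Υ₁`
have no atoms. Outside `B` the transfer matrices and their inverses are defined, which forces
the channel values to vanish in all shells even at eigenvalues of `Vₙ` (`Data.forward_zero`,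
`Data.backward_zero`). An eigenvector without channel values is orthogonal to the spaces `𝕍ₙ`, so
there is none in the reducing subspace (`Data.eq_zero_of_formal`, `Data.nullFor_singleton_sgl`).

It remains to see that a random operator is almost surely regular. An elliptic matrix `T` preserves
a definite quadratic form (`exists_isInvariantForm`). Multiplying by an independent perturbation of
`T` whose mean is `O(t²)` and whose second and fourth moments are `O(t²)` and `O(t⁴)` increases the
second moment of this form by at most a factor `1 + O(t²)`
(`IsInvariantForm.integral_step_le`). Since `∑ tₙ²` converges, the fourth moments of the products
are bounded uniformly on compact intervals (`exists_lintegral_sumNorm_le`), and Tonelli's theorem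
and Fatou's lemma give the `L⁴` bounds for almost every realisation (`IsRandom.ae_regular`).
Integrability of the entries also rules out poles of `Tₙ` in `I`, so that for almost every
realisation the transfer matrices with `n ≥ 1` are defined at all energies of `I`
simultaneously (`Data.transferDefined_of_integrableOn`).
-/

noncomputable section

namespace OneChannel

/-! ### Resolvents of essentially self-adjoint operators -/

section Resolvent

variable {E : Type*} [NormedAddCommGroup E] [InnerProductSpace ℂ E]

/-- `R z = (A - z)⁻¹` for all non-real `z`, for a symmetric operator `A`. The operator is only used
through its graph. -/
structure IsResolvent (A : E →ₗ.[ℂ] E) (R : ℂ → E →L[ℂ] E) : Prop where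
  mem_graph : ∀ z : ℂ, z.im ≠ 0 → ∀ ψ, (R z ψ, ψ + z • R z ψ) ∈ A.graph
  apply_sub : ∀ z : ℂ, z.im ≠ 0 → ∀ x y, (x, y) ∈ A.graph → R z (y - z • x) = x
  symm : ∀ p ∈ A.graph, ∀ q ∈ A.graph, inner ℂ p.2 q.1 = inner ℂ p.1 q.2

theorem im_mul_norm_sq_eq {x y : E} (h : inner ℂ y x = inner ℂ x y) (z : ℂ) :
    (inner ℂ x (y - z • x)).im = -z.im * ‖x‖ ^ 2 := by
  have h1 : (inner ℂ x y).im = 0 := by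
    rw [← Complex.conj_eq_iff_im, inner_conj_symm, h]
  rw [inner_sub_right, inner_smul_right, Complex.sub_im, h1, inner_self_eq_norm_sq_to_K]
  simp [← Complex.ofReal_pow]

/-- The bound `‖(A - z)⁻¹‖ ≤ 1 / |Im z|` for a symmetric operator `A` with `A x = y`, stated for a
single pair of the graph. -/
theorem abs_im_mul_norm_le {x y : E} (h : inner ℂ y x = inner ℂ x y) (z : ℂ) :
    |z.im| * ‖x‖ ≤ ‖y - z • x‖ := by
  rcases eq_or_ne x 0 with rfl | hx
  · simp
  have h1 := im_mul_norm_sq_eq h z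
  have h2 : |z.im| * ‖x‖ ^ 2 ≤ ‖x‖ * ‖y - z • x‖ := by
    calc |z.im| * ‖x‖ ^ 2 = |(inner ℂ x (y - z • x)).im| := by
          rw [h1, abs_mul, abs_neg, abs_of_nonneg (sq_nonneg ‖x‖)]
      _ ≤ ‖inner ℂ x (y - z • x)‖ := Complex.abs_im_le_norm _
      _ ≤ _ := norm_inner_le_norm _ _
  have h3 : 0 < ‖x‖ := norm_pos_iff.2 hx
  nlinarith

theorem isClosable_of_symm [CompleteSpace E] {A : E →ₗ.[ℂ] E} (hd : Dense (A.domain : Set E))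
    (hs : ∀ x y : A.domain, inner ℂ (A x) (y : E) = inner ℂ (x : E) (A y)) : A.IsClosable := by
  have h : A.IsFormalAdjoint A := fun x y => hs x y
  exact LinearPMap.isClosable_iff_exists_closed_extension.2
    ⟨_, LinearPMap.adjoint_isClosed hd, h.le_adjoint hd⟩

/-- Symmetry passes to the closure, one argument at a time. -/
theorem closure_graph_symm [CompleteSpace E] {A : E →ₗ.[ℂ] E} (hd : Dense (A.domain : Set E))
    (hs : ∀ x y : A.domain, inner ℂ (A x) (y : E) = inner ℂ (x : E) (A y)) :
    ∀ p ∈ A.closure.graph, ∀ q ∈ A.closure.graph, inner ℂ p.2 q.1 = inner ℂ p.1 q.2 := by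
  rw [← (isClosable_of_symm hd hs).graph_closure_eq_closure_graph]
  have key : ∀ p ∈ A.graph, ∀ q ∈ A.graph, inner ℂ p.2 q.1 = inner ℂ p.1 q.2 := by
    rintro ⟨_, _⟩ hp ⟨_, _⟩ hq
    rw [LinearPMap.mem_graph_iff] at hp hq
    obtain ⟨x, rfl, rfl⟩ := hp
    obtain ⟨y, rfl, rfl⟩ := hq
    exact hs x y
  intro p hp q hq
  have h1 : ∀ p ∈ A.graph, ∀ q ∈ A.graph.topologicalClosure,
      inner ℂ p.2 q.1 = inner ℂ p.1 q.2 := by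
    intro p hp q hq
    have : IsClosed {q : E × E | inner ℂ p.2 q.1 = inner ℂ p.1 q.2} :=
      isClosed_eq (by fun_prop) (by fun_prop)
    exact (closure_minimal (fun q hq => key p hp q hq) this) hq
  have : IsClosed {p : E × E | inner ℂ p.2 q.1 = inner ℂ p.1 q.2} :=
      isClosed_eq (by fun_prop) (by fun_prop)
  exact (closure_minimal (fun p hp => h1 p hp q hq) this) hp

/-- A symmetric operator all of whose ranges `(A - z) dom A`, `z` non-real, are dense, has a closure
with resolvents: approximating `ψ` by `(A - z) xₙ`, the `xₙ` converge. -/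
theorem exists_isResolvent [CompleteSpace E] {A : E →ₗ.[ℂ] E} (hd : Dense (A.domain : Set E))
    (hs : ∀ x y : A.domain, inner ℂ (A x) (y : E) = inner ℂ (x : E) (A y))
    (hr : ∀ z : ℂ, z.im ≠ 0 → Dense (Set.range fun x : A.domain => A x - z • (x : E))) :
    ∃ R, IsResolvent A.closure R := by
  have hsym := closure_graph_symm hd hs
  have hcl := (isClosable_of_symm hd hs).graph_closure_eq_closure_graph
  have ex : ∀ z : ℂ, z.im ≠ 0 → ∀ ψ : E, ∃ x, (x, ψ + z • x) ∈ A.closure.graph := by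
    intro z hz ψ
    obtain ⟨u, hu, hlim⟩ := mem_closure_iff_seq_limit.1 (hr z hz ψ)
    choose x hx using hu
    have hb : ∀ n m, |z.im| * ‖(x n : E) - x m‖ ≤ ‖u n - u m‖ := by
      intro n m
      have := abs_im_mul_norm_le (hs (x n - x m) (x n - x m)) z
      rw [LinearPMap.map_sub] at this
      simp only [Submodule.coe_sub, smul_sub] at this
      refine this.trans_eq ?_
      rw [← hx n, ← hx m]
      exact congrArg norm (sub_sub_sub_comm _ _ _ _)
    have hc : CauchySeq fun n => (x n : E) := by
      rw [Metric.cauchySeq_iff']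
      intro ε hε
      have hz' : 0 < |z.im| := abs_pos.2 hz
      obtain ⟨N, hN⟩ := Metric.cauchySeq_iff'.1 hlim.cauchySeq (|z.im| * ε) (by positivity)
      refine ⟨N, fun n hn => ?_⟩
      have h1 := hN n hn
      rw [dist_eq_norm] at h1 ⊢
      have h2 := hb n N
      exact lt_of_mul_lt_mul_left (h2.trans_lt h1) hz'.le
    obtain ⟨y, hy⟩ := cauchySeq_tendsto_of_complete hc
    refine ⟨y, ?_⟩
    rw [← hcl]
    refine mem_closure_of_tendsto (f := fun n => ((x n : E), u n + z • (x n : E))) (b := atTop)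
      (hy.prodMk_nhds (hlim.add (hy.const_smul z))) (Eventually.of_forall fun n => ?_)
    refine (LinearPMap.mem_graph_iff _).2 ⟨x n, rfl, ?_⟩
    simp [← hx n]
  have bd : ∀ z : ℂ, ∀ x y, (x, y) ∈ A.closure.graph → |z.im| * ‖x‖ ≤ ‖y - z • x‖ :=
    fun z x y h => abs_im_mul_norm_le (hsym _ h _ h) z
  have uniq : ∀ z : ℂ, z.im ≠ 0 → ∀ x y x' y', (x, y) ∈ A.closure.graph →
      (x', y') ∈ A.closure.graph → y - z • x = y' - z • x' → x = x' := by
    intro z hz x y x' y' h h' he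
    have := bd z _ _ (A.closure.graph.sub_mem h h')
    have h0 : y - y' - z • (x - x') = 0 := by
      rw [smul_sub, ← sub_eq_zero.2 he]; abel
    rw [h0, norm_zero] at this
    have hz' : 0 < |z.im| := abs_pos.2 hz
    have : ‖x - x'‖ = 0 := by nlinarith [norm_nonneg (x - x')]
    exact sub_eq_zero.1 (norm_eq_zero.1 this)
  -- no condition is imposed for real `z`, where the value `0` is used
  have exR : ∀ z : ℂ, ∃ T : E →L[ℂ] E, z.im ≠ 0 → ∀ ψ, (T ψ, ψ + z • T ψ) ∈ A.closure.graph := by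
    intro z
    by_cases hz : z.im = 0
    · exact ⟨0, fun h => absurd hz h⟩
    choose f hf using ex z hz
    let L : E →ₗ[ℂ] E :=
      { toFun := f
        map_add' := fun ψ φ => by
          refine uniq z hz _ _ _ _ (hf (ψ + φ)) (A.closure.graph.add_mem (hf ψ) (hf φ)) ?_
          simp only [smul_add]; abel
        map_smul' := fun c ψ => by
          refine uniq z hz _ _ _ _ (hf (c • ψ)) (A.closure.graph.smul_mem c (hf ψ)) ?_
          simp only [RingHom.id_apply, smul_add, smul_comm z c (f ψ)]; abel }
    refine ⟨L.mkContinuous |z.im|⁻¹ fun ψ => ?_, fun _ ψ => hf ψ⟩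
    have := bd z _ _ (hf ψ)
    rw [add_sub_cancel_right] at this
    rw [inv_mul_eq_div, le_div_iff₀' (abs_pos.2 hz)]
    exact this
  choose R hR using exR
  refine ⟨R, hR, fun z hz x y h => ?_, hsym⟩
  exact uniq z hz _ _ _ _ (hR z hz (y - z • x)) h (by abel)

namespace IsResolvent

variable {A : E →ₗ.[ℂ] E} {R : ℂ → E →L[ℂ] E}

theorem norm_apply_le (h : IsResolvent A R) {z : ℂ} (hz : z.im ≠ 0) (ψ : E) :
    ‖R z ψ‖ ≤ |z.im|⁻¹ * ‖ψ‖ := by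
  have h1 := h.mem_graph z hz ψ
  have := abs_im_mul_norm_le (h.symm _ h1 _ h1) z
  rw [add_sub_cancel_right] at this
  rwa [inv_mul_eq_div, le_div_iff₀' (abs_pos.2 hz)]

theorem inner_apply (h : IsResolvent A R) {z : ℂ} (hz : z.im ≠ 0) (ψ φ : E) :
    inner ℂ (R z ψ) φ = inner ℂ ψ (R (starRingEnd ℂ z) φ) := by
  have hz' : (starRingEnd ℂ z).im ≠ 0 := by simpa using hz
  have := h.symm _ (h.mem_graph z hz ψ) _ (h.mem_graph _ hz' φ)
  simp only [inner_add_left, inner_add_right, inner_smul_left, inner_smul_right] at this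
  linear_combination -this

/-- The resolvent identity. -/
theorem apply_sub_apply (h : IsResolvent A R) {z w : ℂ} (hz : z.im ≠ 0) (hw : w.im ≠ 0) (ψ : E) :
    R z ψ - R w ψ = (z - w) • R z (R w ψ) := by
  have h1 := h.apply_sub z hz _ _ (h.mem_graph w hw ψ)
  have h2 : ψ + w • R w ψ - z • R w ψ = ψ - (z - w) • R w ψ := by
    rw [sub_smul]; abel
  rw [h2, map_sub, map_smul] at h1
  rw [sub_eq_iff_eq_add] at h1 ⊢
  rw [h1, add_comm]

theorem im_inner (h : IsResolvent A R) {z : ℂ} (hz : z.im ≠ 0) (ψ : E) :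
    (inner ℂ ψ (R z ψ)).im = z.im * ‖R z ψ‖ ^ 2 := by
  have h1 := h.mem_graph z hz ψ
  have := im_mul_norm_sq_eq (h.symm _ h1 _ h1) z
  rw [add_sub_cancel_right, ← inner_conj_symm, Complex.conj_im] at this
  linarith

end IsResolvent

end Resolvent


/-! ### The spectral theorem -/

section Spectral

variable {E : Type*} [NormedAddCommGroup E] [InnerProductSpace ℂ E] [CompleteSpace E]

/-- The positive functional `f ↦ ⟪ψ, f(U) ψ⟫` of a normal operator is integration against a measure,
by the Riesz-Markov-Kakutani theorem. -/
theorem exists_measure_of_isStarNormal (U : E →L[ℂ] E) (hU : IsStarNormal U) (ψ : E) :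
    ∃ ν : Measure (spectrum ℂ U), IsFiniteMeasure ν ∧ ν Set.univ ≤ ENNReal.ofReal (‖ψ‖ ^ 2) ∧
      ∀ f : C(spectrum ℂ U, ℂ), ∫ x, f x ∂ν = inner ℂ ψ (cfcHom hU f ψ) := by
  let T := cfcHom (R := ℂ) hU
  let ofR : C(spectrum ℂ U, ℝ) → C(spectrum ℂ U, ℂ) := fun f => ⟨fun x => (f x : ℂ), by fun_prop⟩
  have hT_sa : ∀ f : C(spectrum ℂ U, ℝ), star (T (ofR f)) = T (ofR f) := by
    intro f
    rw [← map_star]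
    congr 1
    ext x
    simp [ofR]
  have hT_real : ∀ f : C(spectrum ℂ U, ℝ),
      ((inner ℂ ψ (T (ofR f) ψ)).re : ℂ) = inner ℂ ψ (T (ofR f) ψ) := by
    intro f
    rw [← Complex.conj_eq_iff_re, inner_conj_symm]
    nth_rw 1 [← hT_sa f]
    rw [ContinuousLinearMap.star_eq_adjoint, ContinuousLinearMap.adjoint_inner_left]
  let Λ : CompactlySupportedContinuousMap (spectrum ℂ U) ℝ →ₚ[ℝ] ℝ := PositiveLinearMap.mk₀
    { toFun := fun f => (inner ℂ ψ (T (ofR f.toContinuousMap) ψ)).re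
      map_add' := fun f g => by
        have : ofR (f + g).toContinuousMap = ofR f.toContinuousMap + ofR g.toContinuousMap := by
          ext x; simp [ofR]
        rw [this, map_add, add_apply, inner_add_right, Complex.add_re]
      map_smul' := fun c f => by
        have : ofR (c • f).toContinuousMap = (c : ℂ) • ofR f.toContinuousMap := by
          ext x; simp [ofR]
        rw [this, map_smul, smul_apply, inner_smul_right]
        simp }
    (fun f hf => by
      let g : C(spectrum ℂ U, ℝ) := ⟨fun x => √(f x), by fun_prop⟩
      have : ofR f.toContinuousMap = star (ofR g) * ofR g := by
        ext x
        have := Real.mul_self_sqrt (hf x)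
        simp only [ofR, ContinuousMap.coe_mk, ContinuousMap.mul_apply, ContinuousMap.star_apply,
          g, Complex.star_def, Complex.conj_ofReal]
        exact_mod_cast this.symm
      show 0 ≤ (inner ℂ ψ (T (ofR f.toContinuousMap) ψ)).re
      rw [this, map_mul, map_star, mul_apply_eq_comp,
        ContinuousLinearMap.star_eq_adjoint, ContinuousLinearMap.adjoint_inner_right,
        inner_self_eq_norm_sq_to_K]
      simp only [Complex.coe_algebraMap, ← Complex.ofReal_pow, Complex.ofReal_re]
      positivity)
  have hΛ : ∀ f, Λ f = (inner ℂ ψ (T (ofR f.toContinuousMap) ψ)).re := fun f => rfl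
  have hreal : ∀ f : C(spectrum ℂ U, ℝ),
      ∫ x, f x ∂(RealRMK.rieszMeasure Λ) = (inner ℂ ψ (T (ofR f) ψ)).re := by
    intro f
    exact RealRMK.integral_rieszMeasure Λ ⟨f, HasCompactSupport.of_compactSpace f⟩
  refine ⟨RealRMK.rieszMeasure Λ, inferInstance, ?_, fun f => ?_⟩
  · refine (RealRMK.rieszMeasure_le_of_eq_one (f := ⟨1, HasCompactSupport.of_compactSpace 1⟩) Λ
      (fun x => zero_le_one) isCompact_univ (fun x _ => rfl)).trans_eq ?_
    congr 1
    rw [hΛ]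
    have : ofR 1 = 1 := by ext x; simp [ofR]
    rw [show (CompactlySupportedContinuousMap.mk (1 : C(spectrum ℂ U, ℝ))
      (HasCompactSupport.of_compactSpace 1)).toContinuousMap = 1 from rfl, this, map_one,
      one_apply_eq_self, inner_self_eq_norm_sq_to_K]
    simp [← Complex.ofReal_pow]
  -- complex-valued functions are reduced to their real and imaginary parts
  · let fr : C(spectrum ℂ U, ℝ) := ⟨fun x => (f x).re, by fun_prop⟩
    let fi : C(spectrum ℂ U, ℝ) := ⟨fun x => (f x).im, by fun_prop⟩
    have hf : f = ofR fr + Complex.I • ofR fi := by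
      ext x
      simp only [ofR, fr, fi, ContinuousMap.add_apply, ContinuousMap.smul_apply, smul_eq_mul,
        ContinuousMap.coe_mk]
      rw [mul_comm, Complex.re_add_im]
    have hint : Integrable (fun x => f x) (RealRMK.rieszMeasure Λ) :=
      (map_continuous f).integrable_of_hasCompactSupport (HasCompactSupport.of_compactSpace f)
    have h1 := integral_re_add_im hint
    rw [← h1]
    have h2 : ∫ x, RCLike.re (f x) ∂(RealRMK.rieszMeasure Λ) = (inner ℂ ψ (T (ofR fr) ψ)).re :=
      hreal fr
    have h3 : ∫ x, RCLike.im (f x) ∂(RealRMK.rieszMeasure Λ) = (inner ℂ ψ (T (ofR fi) ψ)).re :=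
      hreal fi
    rw [h2, h3, hf]
    simp only [T] at *
    rw [map_add, map_smul, add_apply, smul_apply,
      inner_add_right, inner_smul_right, ← hT_real fr, ← hT_real fi]
    simp only [Complex.coe_algebraMap, RCLike.I_to_complex, Complex.ofReal_re, mul_comm]

theorem cayley_den_ne_zero {z ζ : ℂ} (hz : z.im ≠ 0) (hζ : ‖ζ‖ = 1) :
    (Complex.I - z) + (Complex.I + z) * ζ ≠ 0 := by
  intro h
  have h1 : (z - Complex.I) = (Complex.I + z) * ζ := by linear_combination -h
  have h2 := congrArg (fun w => ‖w‖ ^ 2) h1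
  simp only [norm_mul, hζ, mul_one, ← Complex.normSq_eq_norm_sq, Complex.normSq_apply] at h2
  simp at h2
  apply hz
  nlinarith

/-- The function `x ↦ (x - z)⁻¹` in terms of `ζ = (x - i) / (x + i)`. -/
theorem cayley_inv {z ζ : ℂ} (hz : z.im ≠ 0) (hζ : ‖ζ‖ = 1) (h1 : ζ ≠ 1) :
    ((((Complex.I * (1 + ζ) / (1 - ζ)).re : ℝ) : ℂ) - z)⁻¹ =
      (1 - ζ) * ((Complex.I - z) + (Complex.I + z) * ζ)⁻¹ := by
  have h0 : 1 - ζ ≠ 0 := sub_ne_zero.2 h1.symm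
  have hζ0 : ζ ≠ 0 := by rintro rfl; simp at hζ
  have hc : starRingEnd ℂ ζ = ζ⁻¹ := by
    rw [Complex.inv_def, Complex.normSq_eq_norm_sq, hζ]; simp
  have hreal : (((Complex.I * (1 + ζ) / (1 - ζ)).re : ℝ) : ℂ) = Complex.I * (1 + ζ) / (1 - ζ) := by
    rw [← Complex.conj_eq_iff_re]
    have h0' : 1 - ζ⁻¹ ≠ 0 := by
      intro h
      apply h1
      have : ζ⁻¹ = 1 := by linear_combination -h
      simpa using this
    simp only [map_div₀, map_mul, map_add, map_sub, map_one, hc, Complex.conj_I]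
    rw [div_eq_div_iff h0' h0]
    field_simp
    ring
  rw [hreal]
  have h3 := cayley_den_ne_zero hz hζ
  have h4 : Complex.I * (1 + ζ) / (1 - ζ) - z =
      ((Complex.I - z) + (Complex.I + z) * ζ) / (1 - ζ) := by
    field_simp
    ring
  rw [h4, inv_div, div_eq_mul_inv]

/-- The spectral theorem, in the form needed: the Cayley transform `U = (A - i)(A + i)⁻¹` is
unitary, and the spectral measure of `A` at `ψ` is the image of that of `U` under the inverse Cayley
map. The point `1`, which corresponds to `∞`, does not contribute to resolvents. -/
theorem IsResolvent.exists_measure {A : E →ₗ.[ℂ] E} {R : ℂ → E →L[ℂ] E} (h : IsResolvent A R)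
    (ψ : E) : ∃ μ : Measure ℝ, IsFiniteMeasure μ ∧ μ Set.univ ≤ ENNReal.ofReal (‖ψ‖ ^ 2) ∧
      ∀ z : ℂ, z.im ≠ 0 → inner ℂ ψ (R z ψ) = ∫ x : ℝ, ((x : ℂ) - z)⁻¹ ∂μ := by
  have hI : (Complex.I).im ≠ 0 := by simp
  have hnI : (-Complex.I).im ≠ 0 := by simp
  have hadj : ∀ z : ℂ, z.im ≠ 0 → star (R z) = R (starRingEnd ℂ z) := by
    intro z hz
    rw [ContinuousLinearMap.star_eq_adjoint]
    symm
    rw [ContinuousLinearMap.eq_adjoint_iff]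
    intro x y
    have := h.inner_apply (z := starRingEnd ℂ z) (by simpa using hz) x y
    simpa using this
  have hres : ∀ z w : ℂ, z.im ≠ 0 → w.im ≠ 0 → R z - R w = (z - w) • (R z * R w) := by
    intro z w hz hw
    ext x
    exact h.apply_sub_apply hz hw x
  let U : E →L[ℂ] E := 1 - (2 * Complex.I) • R (-Complex.I)
  have hstar : star U = 1 + (2 * Complex.I) • R Complex.I := by
    simp only [U, star_sub, star_one, star_smul, hadj _ hnI]
    simp
  have e1 := hres _ _ hI hnI
  have e2 := hres _ _ hnI hI
  have hII : Complex.I * Complex.I = -1 := Complex.I_mul_I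
  have hU : U ∈ unitary (E →L[ℂ] E) := by
    rw [Unitary.mem_iff, hstar]
    constructor
    · simp only [U, add_mul, mul_sub, one_mul, mul_one, smul_mul_smul_comm]
      have : (2 * Complex.I) * (2 * Complex.I) = (2 * Complex.I) * (Complex.I - -Complex.I) := by
        ring
      rw [this, mul_smul (2 * Complex.I) (Complex.I - -Complex.I), ← e1, smul_sub]
      abel
    · simp only [U, sub_mul, mul_add, one_mul, mul_one, smul_mul_smul_comm]
      have : (2 * Complex.I) * (2 * Complex.I) = -((2 * Complex.I) * (-Complex.I - Complex.I)) := by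
        ring
      rw [this, neg_smul, mul_smul (2 * Complex.I) (-Complex.I - Complex.I), ← e2, smul_sub]
      abel
  have hUn : IsStarNormal U := by
    rw [Unitary.mem_iff] at hU
    exact ⟨hU.1.trans hU.2.symm⟩
  have hsp : ∀ ζ : spectrum ℂ U, ‖(ζ : ℂ)‖ = 1 := fun ζ => by
    simpa using spectrum.subset_circle_of_unitary hU ζ.2
  obtain ⟨ν, hν, hν1, hν2⟩ := exists_measure_of_isStarNormal U hUn ψ
  let c : spectrum ℂ U → ℝ := fun ζ => (Complex.I * (1 + (ζ : ℂ)) / (1 - (ζ : ℂ))).re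
  have hc : Measurable c := by
    have h1 : Measurable fun ζ : spectrum ℂ U => (ζ : ℂ) := measurable_subtype_coe
    exact Complex.measurable_re.comp
      (((measurable_const.add h1).const_mul _).div (measurable_const.sub h1))
  let s : Set (spectrum ℂ U) := {ζ | (ζ : ℂ) ≠ 1}
  have hs : MeasurableSet s :=
    (measurableSet_singleton (1 : ℂ)).compl.preimage measurable_subtype_coe
  refine ⟨(ν.restrict s).map c, ?_, ?_, fun z hz => ?_⟩
  · infer_instance
  · rw [Measure.map_apply hc MeasurableSet.univ, Set.preimage_univ, Measure.restrict_apply_univ]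
    exact (measure_mono (Set.subset_univ _)).trans hν1
  · let den : C(spectrum ℂ U, ℂ) := ⟨fun ζ => (Complex.I - z) + (Complex.I + z) * ζ, by fun_prop⟩
    let deninv : C(spectrum ℂ U, ℂ) :=
      ⟨fun ζ => ((Complex.I - z) + (Complex.I + z) * ζ)⁻¹, by
        refine Continuous.inv₀ (by fun_prop) fun ζ => cayley_den_ne_zero hz (hsp ζ)⟩
    let num : C(spectrum ℂ U, ℂ) := ⟨fun ζ => 1 - ζ, by fun_prop⟩
    let idm : C(spectrum ℂ U, ℂ) := (ContinuousMap.id ℂ).restrict (spectrum ℂ U)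
    have hid : cfcHom hUn idm = U := cfcHom_id hUn
    have hnum : cfcHom hUn num = 1 - U := by
      have : num = 1 - idm := by ext ζ; simp [num, idm]
      rw [this, map_sub, map_one, hid]
    have hden : cfcHom hUn den = (Complex.I - z) • 1 + (Complex.I + z) • U := by
      have : den = (Complex.I - z) • 1 + (Complex.I + z) • idm := by ext ζ; simp [den, idm]
      rw [this, map_add, map_smul, map_smul, map_one, hid]
    have hdd : den * deninv = 1 := by
      ext ζ
      simpa [den, deninv] using mul_inv_cancel₀ (cayley_den_ne_zero hz (hsp ζ))
    -- `(A - z)⁻¹ = (1 - U) ((i - z) + (i + z) U)⁻¹`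
    have hRz : R z * cfcHom hUn den = cfcHom hUn num := by
      rw [hden, hnum]
      have := hres _ _ hz hnI
      simp only [U, smul_sub, mul_add, mul_sub, mul_smul_comm, mul_one]
      rw [smul_comm (Complex.I + z) (2 * Complex.I),
        show (Complex.I + z) = z - -Complex.I by ring, ← this]
      module
    have hRz' : R z = cfcHom hUn (num * deninv) := by
      rw [map_mul, ← hRz, mul_assoc, ← map_mul, hdd, map_one, mul_one]
    rw [hRz', ← hν2, integral_map hc.aemeasurable, ← setIntegral_eq_integral_of_forall_compl_eq_zero
      (s := s)]
    · refine setIntegral_congr_fun hs fun ζ hζ => ?_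
      exact (cayley_inv hz (hsp ζ) hζ).symm
    · intro ζ hζ
      have : (ζ : ℂ) = 1 := by simpa [s] using hζ
      simp [num, this]
    · refine Measurable.aestronglyMeasurable ?_
      exact ((Complex.measurable_ofReal).sub_const z).inv

end Spectral


/-! ### Borel transforms of measures near a compact set -/

section Stieltjes

/-- The function `t ↦ ε / (t² + ε²)`, which is `π` times the Poisson kernel of the half-plane. -/
def poisson (ε t : ℝ) : ℝ := ε / (t ^ 2 + ε ^ 2)

theorem measurable_poisson (ε : ℝ) : Measurable (poisson ε) := by
  unfold poisson; fun_prop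

theorem poisson_nonneg {ε : ℝ} (hε : 0 ≤ ε) (t : ℝ) : 0 ≤ poisson ε t := by
  unfold poisson; positivity

theorem poisson_le_inv {ε : ℝ} (hε : 0 < ε) (t : ℝ) : poisson ε t ≤ ε⁻¹ := by
  unfold poisson
  rw [div_le_iff₀ (by positivity), inv_mul_eq_div, le_div_iff₀ hε]
  nlinarith [sq_nonneg t]

theorem lintegral_poisson {ε : ℝ} (hε : 0 < ε) (x : ℝ) :
    ∫⁻ c, ENNReal.ofReal (poisson ε (x - c)) = ENNReal.ofReal Real.pi := by
  have h0 : ε.toNNReal ≠ 0 := (Real.toNNReal_pos.2 hε).ne'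
  have h1 : ∀ c, ENNReal.ofReal (poisson ε (x - c)) =
      ENNReal.ofReal Real.pi * cauchyPDF x ε.toNNReal c := by
    intro c
    rw [cauchyPDF_def, cauchyPDFReal_def, ← ENNReal.ofReal_mul Real.pi_pos.le]
    congr 1
    have hπ := Real.pi_ne_zero
    simp only [poisson, Real.coe_toNNReal _ hε.le]
    field_simp
    ring
  simp_rw [h1]
  rw [lintegral_const_mul' _ _ ENNReal.ofReal_ne_top, lintegral_cauchyPDF_eq_one x h0, mul_one]

theorem im_inv_sub (x c ε : ℝ) :
    (((x : ℂ) - (c + ε * Complex.I))⁻¹).im = poisson ε (x - c) := by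
  rw [Complex.inv_im, Complex.normSq_apply]
  simp [poisson]
  ring_nf

theorem norm_inv_sub_le {z : ℂ} (hz : 0 < z.im) (x : ℝ) : ‖((x : ℂ) - z)⁻¹‖ ≤ z.im⁻¹ := by
  rw [norm_inv]
  refine inv_anti₀ hz ?_
  have := Complex.abs_im_le_norm ((x : ℂ) - z)
  simp only [Complex.sub_im, Complex.ofReal_im, zero_sub, abs_neg] at this
  rwa [abs_of_pos hz] at this

variable {μ : Measure ℝ} [IsFiniteMeasure μ] {G : ℂ → ℂ}

theorem integrable_inv_sub {z : ℂ} (hz : 0 < z.im) :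
    Integrable (fun x : ℝ => ((x : ℂ) - z)⁻¹) μ := by
  refine Integrable.of_bound (C := z.im⁻¹) ?_ (Eventually.of_forall fun x => norm_inv_sub_le hz x)
  exact ((Complex.measurable_ofReal.sub_const z).inv).aestronglyMeasurable

theorem ofReal_im_eq_lintegral (hG : ∀ z : ℂ, 0 < z.im → G z = ∫ x : ℝ, ((x : ℂ) - z)⁻¹ ∂μ)
    {ε : ℝ} (hε : 0 < ε) (c : ℝ) :
    ENNReal.ofReal (G (c + ε * Complex.I)).im = ∫⁻ x, ENNReal.ofReal (poisson ε (x - c)) ∂μ := by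
  have hz : 0 < ((c : ℂ) + ε * Complex.I).im := by simpa using hε
  rw [hG _ hz]
  have h1 : (∫ x : ℝ, ((x : ℂ) - (c + ε * Complex.I))⁻¹ ∂μ).im =
      ∫ x : ℝ, poisson ε (x - c) ∂μ := by
    have := integral_im (integrable_inv_sub (μ := μ) hz)
    rw [show (∫ x : ℝ, ((x : ℂ) - (c + ε * Complex.I))⁻¹ ∂μ).im =
      RCLike.im (∫ x : ℝ, ((x : ℂ) - (c + ε * Complex.I))⁻¹ ∂μ) from rfl, ← this]
    exact integral_congr_ae (Eventually.of_forall fun x => im_inv_sub x c ε)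
  rw [h1, ofReal_integral_eq_lintegral_ofReal]
  · exact (integrable_inv_sub (μ := μ) hz).im.congr
      (Eventually.of_forall fun x => im_inv_sub x c ε)
  · exact Eventually.of_forall fun x => poisson_nonneg hε.le _

theorem lintegral_im_eq (hG : ∀ z : ℂ, 0 < z.im → G z = ∫ x : ℝ, ((x : ℂ) - z)⁻¹ ∂μ)
    {ε : ℝ} (hε : 0 < ε) (K : Set ℝ) :
    ∫⁻ c in K, ENNReal.ofReal (G (c + ε * Complex.I)).im =
      ∫⁻ x, (∫⁻ c in K, ENNReal.ofReal (poisson ε (x - c))) ∂μ := by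
  simp_rw [ofReal_im_eq_lintegral hG hε]
  rw [lintegral_lintegral_swap]
  have := measurable_poisson ε
  refine Measurable.aemeasurable ?_
  unfold Function.uncurry
  fun_prop

/-- The Poisson kernel is at least `1 / (2ε)` on an interval of length `2ε`, and these intervals
around the points of `S` are contained in the `ε`-neighbourhood of `S`. -/
theorem measure_le_lintegral_im (hG : ∀ z : ℂ, 0 < z.im → G z = ∫ x : ℝ, ((x : ℂ) - z)⁻¹ ∂μ)
    {ε : ℝ} (hε : 0 < ε) {S : Set ℝ} (hS : MeasurableSet S) :
    μ S ≤ ∫⁻ c in Metric.cthickening ε S, ENNReal.ofReal (G (c + ε * Complex.I)).im := by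
  rw [lintegral_im_eq hG hε]
  have h1 : μ S = ∫⁻ _ in S, 1 ∂μ := by simp
  rw [h1]
  refine (setLIntegral_mono' hS fun x hx => ?_).trans (setLIntegral_le_lintegral S _)
  have h2 : Set.Icc (x - ε) (x + ε) ⊆ Metric.cthickening ε S := by
    rw [← Real.closedBall_eq_Icc]
    exact Metric.closedBall_subset_cthickening hx ε
  refine le_trans ?_ (lintegral_mono_set h2)
  have h3 : (1 : ℝ≥0∞) = ∫⁻ _ in Set.Icc (x - ε) (x + ε), ENNReal.ofReal (2 * ε)⁻¹ := by
    rw [setLIntegral_const, Real.volume_Icc, ← ENNReal.ofReal_mul (by positivity)]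
    rw [show (2 * ε)⁻¹ * (x + ε - (x - ε)) = 1 by field_simp; ring, ENNReal.ofReal_one]
  rw [h3]
  refine setLIntegral_mono' measurableSet_Icc fun c hc => ENNReal.ofReal_le_ofReal ?_
  have : (x - c) ^ 2 ≤ ε ^ 2 := sq_le_sq' (by linarith [hc.2]) (by linarith [hc.1])
  unfold poisson
  rw [inv_eq_one_div, div_le_div_iff₀ (by positivity) (by positivity)]
  nlinarith

/-- The mass of `μ` outside `S` does not contribute to the integral of `Im G` over the
`ε`-neighbourhood of `S` in the limit `ε → 0`. -/
theorem tendsto_lintegral_compl {S : Set ℝ} (hS : IsCompact S) :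
    Tendsto (fun ε => ∫⁻ x in Sᶜ, (∫⁻ c in Metric.cthickening ε S,
      ENNReal.ofReal (poisson ε (x - c))) ∂μ) (𝓝[>] 0) (𝓝 0) := by
  have h0 : (0 : ℝ≥0∞) = ∫⁻ x in Sᶜ, 0 ∂μ := by simp
  rw [h0]
  refine tendsto_lintegral_filter_of_dominated_convergence (fun _ => ENNReal.ofReal Real.pi)
    ?_ ?_ ?_ ?_
  · refine Eventually.of_forall fun ε => ?_
    refine Measurable.lintegral_prod_right' (f := fun p : ℝ × ℝ =>
      ENNReal.ofReal (poisson ε (p.1 - p.2))) ?_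
    have := measurable_poisson ε
    fun_prop
  · filter_upwards [self_mem_nhdsWithin] with ε hε
    refine Eventually.of_forall fun x => ?_
    rw [← lintegral_poisson hε x]
    exact setLIntegral_le_lintegral _ _
  · simp only [lintegral_const]
    exact ENNReal.mul_ne_top ENNReal.ofReal_ne_top (measure_ne_top _ _)
  · rw [ae_restrict_iff' hS.measurableSet.compl]
    refine Eventually.of_forall fun x hx => ?_
    have hx' : Sᶜ ∈ 𝓝 x := hS.isClosed.isOpen_compl.mem_nhds hx
    obtain ⟨d, hd, hball⟩ := Metric.mem_nhds_iff.1 hx'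
    -- the kernel is at most `ε / (d / 2)²` on the neighbourhood, as `x` has distance `d` from `S`
    have hfar : ∀ y ∈ S, d ≤ |x - y| := by
      intro y hy
      by_contra hlt
      exact hball (show y ∈ Metric.ball x d by
        rw [Metric.mem_ball, dist_comm, Real.dist_eq]; exact not_le.1 hlt) hy
    have hfin : volume (Metric.cthickening (d / 2) S) ≠ ∞ := hS.cthickening.measure_lt_top.ne
    have hlim : Tendsto (fun ε : ℝ => ENNReal.ofReal (ε / (d / 2) ^ 2) *
        volume (Metric.cthickening (d / 2) S)) (𝓝[>] 0) (𝓝 0) := by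
      have h1 : Tendsto (fun ε : ℝ => ENNReal.ofReal (ε / (d / 2) ^ 2)) (𝓝[>] 0)
          (𝓝 (ENNReal.ofReal (0 / (d / 2) ^ 2))) :=
        (ENNReal.tendsto_ofReal (tendsto_id.div_const _)).mono_left nhdsWithin_le_nhds
      have := ENNReal.Tendsto.mul_const (b := volume (Metric.cthickening (d / 2) S)) h1
        (Or.inr hfin)
      simpa using this
    refine tendsto_of_tendsto_of_tendsto_of_le_of_le' tendsto_const_nhds hlim
      (Eventually.of_forall fun _ => zero_le) ?_
    have hd2 : 0 < d / 2 := half_pos hd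
    filter_upwards [Ioo_mem_nhdsGT hd2] with ε hε
    calc ∫⁻ c in Metric.cthickening ε S, ENNReal.ofReal (poisson ε (x - c))
        ≤ ∫⁻ c in Metric.cthickening ε S, ENNReal.ofReal (ε / (d / 2) ^ 2) := by
          refine setLIntegral_mono' Metric.isClosed_cthickening.measurableSet fun c hc =>
            ENNReal.ofReal_le_ofReal ?_
          rw [hS.cthickening_eq_biUnion_closedBall hε.1.le, Set.mem_iUnion₂] at hc
          obtain ⟨y, hy, hcy⟩ := hc
          rw [Metric.mem_closedBall, Real.dist_eq] at hcy
          have h1 := hfar y hy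
          have h2 : d / 2 ≤ |x - c| := by
            have := abs_sub_le x c y
            linarith [hε.2]
          unfold poisson
          have hε0 := hε.1
          refine div_le_div_of_nonneg_left hε0.le (by positivity) ?_
          rw [← sq_abs (x - c)]
          nlinarith [sq_nonneg ε]
      _ = ENNReal.ofReal (ε / (d / 2) ^ 2) * volume (Metric.cthickening ε S) :=
          setLIntegral_const _ _
      _ ≤ _ := by
          gcongr
          exact Metric.cthickening_mono hε.2.le S

theorem lintegral_im_le (hG : ∀ z : ℂ, 0 < z.im → G z = ∫ x : ℝ, ((x : ℂ) - z)⁻¹ ∂μ)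
    {ε : ℝ} (hε : 0 < ε) {S : Set ℝ} (hS : MeasurableSet S) :
    ∫⁻ c in Metric.cthickening ε S, ENNReal.ofReal (G (c + ε * Complex.I)).im ≤
      ENNReal.ofReal Real.pi * μ S + ∫⁻ x in Sᶜ, (∫⁻ c in Metric.cthickening ε S,
        ENNReal.ofReal (poisson ε (x - c))) ∂μ := by
  rw [lintegral_im_eq hG hε, ← lintegral_add_compl _ hS]
  gcongr
  calc ∫⁻ x in S, (∫⁻ c in Metric.cthickening ε S, ENNReal.ofReal (poisson ε (x - c))) ∂μ
      ≤ ∫⁻ x in S, ENNReal.ofReal Real.pi ∂μ := by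
        refine lintegral_mono fun x => ?_
        rw [← lintegral_poisson hε x]
        exact setLIntegral_le_lintegral _ _
    _ = _ := setLIntegral_const _ _

/-- Comparison of two measures by comparison of the imaginary parts of their Borel transforms. -/
theorem measure_le_of_im_le {μ₁ μ₂ : Measure ℝ} [IsFiniteMeasure μ₁] [IsFiniteMeasure μ₂]
    {G₁ G₂ : ℂ → ℂ} (hG : ∀ z : ℂ, 0 < z.im → G z = ∫ x : ℝ, ((x : ℂ) - z)⁻¹ ∂μ)
    (hG₁ : ∀ z : ℂ, 0 < z.im → G₁ z = ∫ x : ℝ, ((x : ℂ) - z)⁻¹ ∂μ₁)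
    (hG₂ : ∀ z : ℂ, 0 < z.im → G₂ z = ∫ x : ℝ, ((x : ℂ) - z)⁻¹ ∂μ₂)
    (hle : ∀ z : ℂ, 0 < z.im → (G z).im ≤ 2 * (G₁ z).im + 2 * (G₂ z).im)
    {S : Set ℝ} (hS : IsCompact S) :
    μ S ≤ 2 * (ENNReal.ofReal Real.pi * μ₁ S) + 2 * (ENNReal.ofReal Real.pi * μ₂ S) := by
  have hlim := (ENNReal.Tendsto.const_mul (a := 2) ((tendsto_lintegral_compl (μ := μ₁) hS).const_add
      (ENNReal.ofReal Real.pi * μ₁ S)) (Or.inr (by simp))).add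
    (ENNReal.Tendsto.const_mul (a := 2) ((tendsto_lintegral_compl (μ := μ₂) hS).const_add
      (ENNReal.ofReal Real.pi * μ₂ S)) (Or.inr (by simp)))
  simp only [add_zero] at hlim
  refine ge_of_tendsto hlim ?_
  filter_upwards [self_mem_nhdsWithin] with ε hε
  have hε : 0 < ε := hε
  refine (measure_le_lintegral_im hG hε hS.measurableSet).trans ?_
  refine le_trans ?_ (add_le_add (mul_le_mul_right (lintegral_im_le hG₁ hε hS.measurableSet) 2)
    (mul_le_mul_right (lintegral_im_le hG₂ hε hS.measurableSet) 2))
  have hmeas : Measurable fun c : ℝ => ENNReal.ofReal (G₁ (c + ε * Complex.I)).im := by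
    simp_rw [ofReal_im_eq_lintegral hG₁ hε]
    refine Measurable.lintegral_prod_right' (f := fun p : ℝ × ℝ =>
      ENNReal.ofReal (poisson ε (p.2 - p.1))) ?_
    have := measurable_poisson ε
    fun_prop
  rw [← lintegral_const_mul' _ _ (by simp), ← lintegral_const_mul' _ _ (by simp),
    ← lintegral_add_left (hmeas.const_mul 2)]
  refine lintegral_mono fun c => ?_
  have h := hle (c + ε * Complex.I) (by simpa using hε)
  refine (ENNReal.ofReal_le_ofReal h).trans (ENNReal.ofReal_add_le.trans ?_)
  rw [ENNReal.ofReal_mul (by norm_num), ENNReal.ofReal_mul (by norm_num)]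
  simp

/-- An atom is seen by `ε Im G(λ + iε)`. -/
theorem measure_singleton_le (hG : ∀ z : ℂ, 0 < z.im → G z = ∫ x : ℝ, ((x : ℂ) - z)⁻¹ ∂μ)
    {ε : ℝ} (hε : 0 < ε) (l : ℝ) :
    μ {l} ≤ ENNReal.ofReal (ε * (G (l + ε * Complex.I)).im) := by
  rw [ENNReal.ofReal_mul hε.le, ofReal_im_eq_lintegral hG hε,
    ← lintegral_const_mul' _ _ ENNReal.ofReal_ne_top]
  refine le_trans ?_ (setLIntegral_le_lintegral {l} _)
  rw [lintegral_singleton]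
  have : ENNReal.ofReal ε * ENNReal.ofReal (poisson ε (l - l)) = 1 := by
    rw [← ENNReal.ofReal_mul hε.le]
    simp only [poisson, sub_self]
    rw [show ε * (ε / (0 ^ 2 + ε ^ 2)) = 1 by field_simp; ring, ENNReal.ofReal_one]
  rw [this, one_mul]

/-- Conversely, `ε Im G(λ + iε)` tends to zero where there is no atom. -/
theorem tendsto_mul_im (hG : ∀ z : ℂ, 0 < z.im → G z = ∫ x : ℝ, ((x : ℂ) - z)⁻¹ ∂μ)
    {l : ℝ} (hl : μ {l} = 0) :
    Tendsto (fun ε : ℝ => ENNReal.ofReal (ε * (G (l + ε * Complex.I)).im)) (𝓝[>] 0) (𝓝 0) := by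
  have h1 : Tendsto (fun ε : ℝ => ∫⁻ x, ENNReal.ofReal (ε * poisson ε (x - l)) ∂μ)
      (𝓝[>] 0) (𝓝 (∫⁻ x, 0 ∂μ)) := by
    refine tendsto_lintegral_filter_of_dominated_convergence (fun _ => 1) ?_ ?_ ?_ ?_
    · refine Eventually.of_forall fun ε => ?_
      have := measurable_poisson ε
      fun_prop
    · filter_upwards [self_mem_nhdsWithin] with ε hε
      have hε : 0 < ε := hε
      refine Eventually.of_forall fun x => ?_
      rw [← ENNReal.ofReal_one]
      refine ENNReal.ofReal_le_ofReal ?_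
      calc ε * poisson ε (x - l) ≤ ε * ε⁻¹ := by gcongr; exact poisson_le_inv hε _
        _ = 1 := mul_inv_cancel₀ hε.ne'
    · simp
    · have : ∀ᵐ x ∂μ, x ≠ l := by
        rw [ae_iff]; simpa using hl
      filter_upwards [this] with x hx
      have hx' : 0 < (x - l) ^ 2 := by
        have := sub_ne_zero.2 hx
        positivity
      have h2 : Tendsto (fun ε : ℝ => ε * (ε / ((x - l) ^ 2 + ε ^ 2))) (𝓝[>] 0)
          (𝓝 (0 * (0 / ((x - l) ^ 2 + 0 ^ 2)))) := by
        refine Tendsto.mono_left ?_ nhdsWithin_le_nhds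
        have hc : ContinuousAt (fun ε : ℝ => ε * (ε / ((x - l) ^ 2 + ε ^ 2))) 0 := by
          refine continuousAt_id.mul (continuousAt_id.div (by fun_prop) ?_)
          simpa using hx'.ne'
        exact hc
      simp only [zero_mul] at h2
      have := ENNReal.tendsto_ofReal h2
      simpa [poisson] using this
  simp only [lintegral_zero] at h1
  refine h1.congr' ?_
  filter_upwards [self_mem_nhdsWithin] with ε hε
  have hε : 0 < ε := hε
  rw [ENNReal.ofReal_mul hε.le, ofReal_im_eq_lintegral hG hε,
    ← lintegral_const_mul' _ _ ENNReal.ofReal_ne_top]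
  refine lintegral_congr fun x => ENNReal.ofReal_mul hε.le

end Stieltjes


/-! ### A criterion for absolute continuity -/

section Criterion

/-- A bound at a point from a bound on a real segment below it and the bound `A / Im z`: on the
upper half of the circle of radius `s` one has `|z² - s²| = 2 s Im z`, so that the factor
`z² - s²` compensates the singularity of `A / Im z` at the ends of the segment. -/
theorem norm_le_of_segment {F : ℂ → ℂ} {A B s η ε : ℝ} (hA : 0 ≤ A) (hB : 0 ≤ B) (hs : 0 < s)
    (hη : 0 < η) (hηε : η ≤ ε) (hεs : ε ≤ s)
    (hF : ∀ z : ℂ, 0 < z.im → DifferentiableAt ℂ F z)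
    (hFA : ∀ z : ℂ, 0 < z.im → ‖F z‖ ≤ A / z.im)
    (hFB : ∀ x : ℝ, |x| ≤ s → ‖F (x + η * Complex.I)‖ ≤ B) :
    ‖F (ε * Complex.I)‖ ≤ 2 * A / s + B := by
  -- the maximum principle for `h` on the half disc `U`
  let U : Set ℂ := Metric.ball 0 s ∩ {z | 0 < z.im}
  have hUo : IsOpen U := Metric.isOpen_ball.inter (isOpen_lt continuous_const Complex.continuous_im)
  have hUc : closure U ⊆ Metric.closedBall 0 s ∩ {z | 0 ≤ z.im} := by
    refine closure_minimal ?_ (Metric.isClosed_closedBall.inter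
      (isClosed_le continuous_const Complex.continuous_im))
    rintro z ⟨h1, h2⟩
    exact ⟨Metric.ball_subset_closedBall h1, le_of_lt (show 0 < z.im from h2)⟩
  let h : ℂ → ℂ := fun z => (z ^ 2 - (s : ℂ) ^ 2) * F (z + η * Complex.I)
  have hd : ∀ z : ℂ, 0 ≤ z.im → DifferentiableAt ℂ h z := by
    intro z hz
    have h1 : DifferentiableAt ℂ F (z + η * Complex.I) := hF _ (by simp; linarith)
    have h2 : DifferentiableAt ℂ (fun z : ℂ => F (z + η * Complex.I)) z :=
      DifferentiableAt.comp z h1 (by fun_prop)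
    exact (by fun_prop : DifferentiableAt ℂ (fun z : ℂ => z ^ 2 - (s : ℂ) ^ 2) z).mul h2
  have hdc : DiffContOnCl ℂ h U := by
    refine DifferentiableOn.diffContOnCl fun z hz => ?_
    exact (hd z (hUc hz).2).differentiableWithinAt
  have hfr : ∀ z ∈ frontier U, ‖h z‖ ≤ 2 * s * A + s ^ 2 * B := by
    intro z hz
    have hzc := hUc hz.1
    have hzU : z ∉ U := by rw [hUo.frontier_eq] at hz; exact hz.2
    have him : 0 ≤ z.im := hzc.2
    have hnorm : ‖z‖ ≤ s := by simpa using hzc.1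
    have hsA : 0 ≤ 2 * s * A := by positivity
    have hsB : 0 ≤ s ^ 2 * B := by positivity
    simp only [h, norm_mul]
    -- either `z` is on the segment, or on the circle
    rcases him.eq_or_lt with h0 | h0
    · have hz' : z = (z.re : ℂ) := by apply Complex.ext <;> simp [← h0]
      have habs : |z.re| ≤ s := (Complex.abs_re_le_norm z).trans hnorm
      have h1 := hFB z.re habs
      rw [← hz'] at h1
      have h2 : ‖z ^ 2 - (s : ℂ) ^ 2‖ ≤ s ^ 2 := by
        rw [hz', ← Complex.ofReal_pow, ← Complex.ofReal_pow, ← Complex.ofReal_sub,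
          Complex.norm_real, Real.norm_eq_abs, abs_le]
        have := sq_le_sq' (abs_le.1 habs).1 (abs_le.1 habs).2
        constructor <;> nlinarith [sq_nonneg z.re]
      calc _ ≤ s ^ 2 * B := by gcongr
        _ ≤ _ := by linarith
    · have hzn : ‖z‖ = s := by
        refine le_antisymm hnorm ?_
        by_contra hlt
        exact hzU ⟨by simpa using not_le.1 hlt, h0⟩
      have h2 : ‖z ^ 2 - (s : ℂ) ^ 2‖ = 2 * s * z.im := by
        have e1 : (s : ℂ) ^ 2 = z * starRingEnd ℂ z := by
          rw [Complex.mul_conj, Complex.normSq_eq_norm_sq, hzn]; push_cast; ring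
        have e2 : z ^ 2 - (s : ℂ) ^ 2 = z * (2 * z.im * Complex.I) := by
          rw [e1, pow_two, ← mul_sub, Complex.sub_conj]; push_cast; ring
        rw [e2]
        simp [hzn, abs_of_pos h0]
        ring
      have h3 := hFA (z + η * Complex.I) (by simp; linarith)
      have h4 : A / (z + η * Complex.I).im ≤ A / z.im := by
        refine div_le_div_of_nonneg_left hA h0 ?_
        simp; linarith
      rw [h2]
      calc 2 * s * z.im * ‖F (z + η * Complex.I)‖ ≤ 2 * s * z.im * (A / z.im) := by
            gcongr; exact h3.trans h4
        _ = 2 * s * A := by field_simp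
        _ ≤ _ := by linarith
  have hbd : Bornology.IsBounded U := Metric.isBounded_ball.subset Set.inter_subset_left
  have hmem : (((ε - η : ℝ) : ℂ) * Complex.I) ∈ closure U := by
    rcases hηε.eq_or_lt with he | hlt
    · have : Tendsto (fun r : ℝ => (r : ℂ) * Complex.I) (𝓝[>] 0)
          (𝓝 (((ε - η : ℝ) : ℂ) * Complex.I)) := by
        rw [he, sub_self]
        have hc : Continuous fun r : ℝ => (r : ℂ) * Complex.I := by fun_prop
        exact (hc.tendsto 0).mono_left nhdsWithin_le_nhds
      refine mem_closure_of_tendsto this ?_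
      filter_upwards [Ioo_mem_nhdsGT hs] with r hr
      refine ⟨?_, ?_⟩
      · simpa [abs_of_pos hr.1] using hr.2
      · simpa using hr.1
    · refine subset_closure ⟨?_, ?_⟩
      · have : 0 ≤ ε - η := by linarith
        rw [mem_ball_zero_iff, norm_mul, Complex.norm_I, mul_one, Complex.norm_real,
          Real.norm_eq_abs, abs_of_nonneg this]
        linarith
      · simpa using hlt
  have hmain := Complex.norm_le_of_forall_mem_frontier_norm_le hbd hdc hfr hmem
  have e : ((ε - η : ℝ) : ℂ) * Complex.I + η * Complex.I = ε * Complex.I := by push_cast; ring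
  simp only [h, norm_mul, e] at hmain
  have h5 : s ^ 2 ≤ ‖(((ε - η : ℝ) : ℂ) * Complex.I) ^ 2 - (s : ℂ) ^ 2‖ := by
    have : (((ε - η : ℝ) : ℂ) * Complex.I) ^ 2 - (s : ℂ) ^ 2 =
        ((-((ε - η) ^ 2 + s ^ 2) : ℝ) : ℂ) := by
      rw [mul_pow, Complex.I_sq]; push_cast; ring
    rw [this, Complex.norm_real, Real.norm_eq_abs, abs_neg, abs_of_nonneg (by positivity)]
    nlinarith [sq_nonneg (ε - η)]
  have h6 : s ^ 2 * ‖F (ε * Complex.I)‖ ≤ 2 * s * A + s ^ 2 * B :=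
    (mul_le_mul_of_nonneg_right h5 (norm_nonneg _)).trans hmain
  have h7 : s ^ 2 * (2 * A / s + B) = 2 * s * A + s ^ 2 * B := by field_simp
  rw [← h7] at h6
  exact le_of_mul_le_mul_left h6 (by positivity)

variable {G : ℂ → ℂ} {C : ℝ}

theorem continuous_line {ε : ℝ} (hε : 0 < ε) (hd : ∀ z : ℂ, 0 < z.im → DifferentiableAt ℂ G z) :
    Continuous fun c : ℝ => G (c + ε * Complex.I) := by
  rw [continuous_iff_continuousAt]
  intro c
  have h1 : ContinuousAt G (c + ε * Complex.I) := (hd _ (by simpa using hε)).continuousAt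
  exact ContinuousAt.comp (f := fun c : ℝ => (c : ℂ) + ε * Complex.I) h1 (by fun_prop)

theorem differentiableAt_setIntegral (hd : ∀ z : ℂ, 0 < z.im → DifferentiableAt ℂ G z)
    (hb : ∀ z : ℂ, 0 < z.im → ‖G z‖ ≤ C / z.im) {K : Set ℝ} (hK : IsCompact K) {z : ℂ}
    (hz : 0 < z.im) : DifferentiableAt ℂ (fun z => ∫ c in K, G (c + z)) z := by
  have hC : 0 ≤ C := by
    have := (norm_nonneg _).trans (hb Complex.I (by simp))
    simpa using this
  have hfin : volume K ≠ ∞ := hK.measure_lt_top.ne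
  have hfin' : IsFiniteMeasure (volume.restrict K) := ⟨by simpa using hK.measure_lt_top⟩
  have hcont : ∀ w : ℂ, 0 < w.im → Continuous fun c : ℝ => G (c + w) := by
    intro w hw
    have := continuous_line (G := G) (ε := w.im) hw hd
    refine (this.comp (continuous_add_const w.re)).congr fun c => ?_
    simp only [Function.comp]
    congr 1
    push_cast
    rw [add_assoc, Complex.re_add_im]
  have hdcont : Continuous fun c : ℝ => deriv G (c + z) := by
    have hU : IsOpen {w : ℂ | 0 < w.im} := isOpen_lt continuous_const Complex.continuous_im
    have hdd : DifferentiableOn ℂ G {w : ℂ | 0 < w.im} :=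
      fun w hw => (hd w hw).differentiableWithinAt
    have := hdd.deriv hU
    refine ContinuousOn.comp_continuous this.continuousOn (by fun_prop) fun c => ?_
    simpa using hz
  have hhalf : 0 < z.im / 4 := by positivity
  have him : ∀ w ∈ Metric.ball z (z.im / 4), z.im / 2 ≤ w.im := by
    intro w hw
    have h1 : |(w - z).im| < z.im / 4 := (Complex.abs_im_le_norm _).trans_lt (by
      rw [← dist_eq_norm]; exact hw)
    rw [Complex.sub_im, abs_lt] at h1
    linarith [h1.1]
  have key := hasDerivAt_integral_of_dominated_loc_of_deriv_le (μ := volume.restrict K)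
    (F := fun z (c : ℝ) => G (c + z)) (F' := fun z (c : ℝ) => deriv G (c + z)) (x₀ := z)
    (s := Metric.ball z (z.im / 4)) (bound := fun _ => (C / (z.im / 4)) / (z.im / 4))
    (Metric.ball_mem_nhds z hhalf) ?_ ?_ ?_ ?_ ?_ ?_
  · exact key.2.differentiableAt
  · filter_upwards [Metric.ball_mem_nhds z hhalf] with w hw
    exact (hcont w (by linarith [him w hw])).aestronglyMeasurable
  · refine Integrable.of_bound (C := C / z.im) (hcont z hz).aestronglyMeasurable
      (Eventually.of_forall fun c => ?_)
    have := hb (c + z) (by simpa using hz)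
    simpa using this
  · exact hdcont.aestronglyMeasurable
  · refine Eventually.of_forall fun c w hw => ?_
    have hw2 := him w hw
    have hball : ∀ v ∈ Metric.closedBall ((c : ℂ) + w) (z.im / 4), z.im / 4 ≤ v.im := by
      intro v hv
      have h1 : |(v - (c + w)).im| ≤ z.im / 4 := (Complex.abs_im_le_norm _).trans (by
        rw [← dist_eq_norm]; exact hv)
      rw [Complex.sub_im, abs_le] at h1
      simp at h1
      linarith [h1.1]
    refine Complex.norm_deriv_le_of_forall_mem_sphere_norm_le hhalf ?_ ?_
    · refine DifferentiableOn.diffContOnCl fun v hv => ?_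
      have := hball v (Metric.closure_ball_subset_closedBall hv)
      exact (hd v (by linarith)).differentiableWithinAt
    · intro v hv
      have h3 := hball v (Metric.sphere_subset_closedBall hv)
      refine (hb v (by linarith)).trans ?_
      exact div_le_div_of_nonneg_left hC hhalf h3
  · exact integrable_const _
  · refine Eventually.of_forall fun c w hw => ?_
    have hw2 := him w hw
    have h1 : HasDerivAt G (deriv G (c + w)) (c + w) :=
      (hd _ (by simp; linarith)).hasDerivAt
    exact h1.comp_const_add (c : ℂ) w

/-- The criterion for absolute continuity: `G` is the Borel transform of `μ`, and is the limit of
holomorphic `Gₙ` with `|Gₙ(z)| ≤ C / Im z`. If `|Gₙ|` is bounded just above `[a, b]`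
by functions `hₙ` whose norms in `L²(a, b)` do not tend to infinity, then `μ` is absolutely
continuous inside `(a, b)`. -/
theorem measure_eq_zero_of_bound {μ : Measure ℝ} [IsFiniteMeasure μ] {Gn : ℕ → ℂ → ℂ}
    (hG : ∀ z : ℂ, 0 < z.im → G z = ∫ x : ℝ, ((x : ℂ) - z)⁻¹ ∂μ)
    (hd : ∀ n, ∀ z : ℂ, 0 < z.im → DifferentiableAt ℂ (Gn n) z)
    (hb : ∀ n, ∀ z : ℂ, 0 < z.im → ‖Gn n z‖ ≤ C / z.im)
    (hlim : ∀ z : ℂ, 0 < z.im → Tendsto (fun n => Gn n z) atTop (𝓝 (G z)))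
    {a b : ℝ} {h : ℕ → ℝ → ℝ}
    (hh : ∀ᶠ n in atTop, ∀ᶠ η : ℝ in 𝓝[>] 0, ∀ x ∈ Set.Icc a b,
      ‖Gn n (x + η * Complex.I)‖ ≤ h n x)
    {M : ℝ≥0∞} (hM : M ≠ ∞)
    (hfreq : ∃ᶠ n in atTop, ∫⁻ x in Set.Icc a b, ENNReal.ofReal (h n x ^ 2) ≤ M)
    {S : Set ℝ} (hS : IsCompact S) {s : ℝ} (hs : 0 < s)
    (hSab : S ⊆ Set.Icc (a + 2 * s) (b - 2 * s)) (hS0 : volume S = 0) : μ S = 0 := by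
  have hC : 0 ≤ C := by
    have := (norm_nonneg _).trans (hb 0 Complex.I (by simp))
    simpa using this
  -- `μ S` is bounded by the integral of `G(c + iε)` over `c` in the neighbourhood `K`, a limit of
  -- the integrals `F n (iε)`, to which `norm_le_of_segment` applies
  have step : ∀ κ : ℝ, 0 < κ → ∀ ε : ℝ, 0 < ε → ε ≤ s →
      μ S ≤ ENNReal.ofReal (2 * C / s + κ) * volume (Metric.cthickening ε S) +
        ENNReal.ofReal κ⁻¹ * M := by
    intro κ hκ ε hε hεs
    set K := Metric.cthickening ε S with hKdef
    have hK : IsCompact K := hS.cthickening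
    have hKv : volume K ≠ ∞ := hK.measure_lt_top.ne
    have hKfin : IsFiniteMeasure (volume.restrict K) := ⟨by simpa using hK.measure_lt_top⟩
    have hKsub : K ⊆ Set.Icc (a + s) (b - s) := by
      intro c hc
      rw [hKdef, hS.cthickening_eq_biUnion_closedBall hε.le, Set.mem_iUnion₂] at hc
      obtain ⟨y, hy, hcy⟩ := hc
      rw [Real.closedBall_eq_Icc] at hcy
      have := hSab hy
      exact ⟨by linarith [this.1, hcy.1], by linarith [this.2, hcy.2]⟩
    let F : ℕ → ℂ → ℂ := fun n z => ∫ c in K, Gn n (c + z)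
    have hFA : ∀ n, ∀ z : ℂ, 0 < z.im → ‖F n z‖ ≤ (C * volume.real K) / z.im := by
      intro n z hz
      have := norm_setIntegral_le_of_norm_le_const (μ := volume) (s := K) (C := C / z.im)
        (f := fun c : ℝ => Gn n (c + z)) hK.measure_lt_top
        (fun c _ => by have := hb n (c + z) (by simpa using hz); simpa using this)
      refine this.trans_eq ?_
      ring
    let Bd : ℝ≥0∞ := ENNReal.ofReal κ * volume K + ENNReal.ofReal κ⁻¹ * M
    have hBd : Bd ≠ ∞ := by
      refine ENNReal.add_ne_top.2 ⟨ENNReal.mul_ne_top ENNReal.ofReal_ne_top hKv,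
        ENNReal.mul_ne_top ENNReal.ofReal_ne_top hM⟩
    have hFn : ∃ᶠ n in atTop,
        ‖F n (ε * Complex.I)‖ ≤ 2 * (C * volume.real K) / s + Bd.toReal := by
      refine (hfreq.and_eventually hh).mono ?_
      rintro n ⟨hn1, hn2⟩
      obtain ⟨η, hη1, hη2⟩ := (hn2.and (Ioo_mem_nhdsGT hε)).exists
      refine norm_le_of_segment (by positivity) ENNReal.toReal_nonneg hs hη2.1 hη2.2.le hεs
        (fun z hz => differentiableAt_setIntegral (hd n) (hb n) hK hz) (hFA n) fun x hx => ?_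
      have hx' := abs_le.1 hx
      have h1 : ‖F n (x + η * Complex.I)‖ₑ ≤ Bd := by
        calc ‖F n (x + η * Complex.I)‖ₑ
            ≤ ∫⁻ c in K, ‖Gn n (c + (x + η * Complex.I))‖ₑ := enorm_integral_le_lintegral_enorm _
          _ ≤ ∫⁻ c in K, (ENNReal.ofReal κ + ENNReal.ofReal κ⁻¹ *
                (Set.Icc a b).indicator (fun y => ENNReal.ofReal (h n y ^ 2)) (c + x)) := by
              refine setLIntegral_mono' hK.measurableSet fun c hc => ?_
              have hcK := hKsub hc
              have hmem : c + x ∈ Set.Icc a b :=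
                ⟨by linarith [hcK.1, hx'.1], by linarith [hcK.2, hx'.2]⟩
              rw [Set.indicator_of_mem hmem, ← ENNReal.ofReal_mul (inv_nonneg.2 hκ.le),
                ← ENNReal.ofReal_add hκ.le (by positivity), ← ofReal_norm]
              refine ENNReal.ofReal_le_ofReal ?_
              have h2 := hη1 (c + x) hmem
              push_cast at h2
              rw [add_assoc] at h2
              refine h2.trans ?_
              -- `h ≤ κ + h² / κ`
              have h3 : 0 ≤ κ⁻¹ * (κ - h n (c + x)) ^ 2 + h n (c + x) := by
                have : 0 ≤ h n (c + x) := (norm_nonneg _).trans h2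
                positivity
              have h4 : κ⁻¹ * (κ - h n (c + x)) ^ 2 + h n (c + x) =
                  κ + κ⁻¹ * h n (c + x) ^ 2 - h n (c + x) := by
                field_simp; ring
              linarith
          _ = ENNReal.ofReal κ * volume K + ENNReal.ofReal κ⁻¹ * ∫⁻ c in K,
                (Set.Icc a b).indicator (fun y => ENNReal.ofReal (h n y ^ 2)) (c + x) := by
              rw [lintegral_add_left measurable_const, setLIntegral_const,
                lintegral_const_mul' _ _ ENNReal.ofReal_ne_top]
          _ ≤ Bd := by
              refine add_le_add_right (mul_le_mul_right ?_ _) _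
              refine (setLIntegral_le_lintegral _ _).trans ?_
              rw [lintegral_add_right_eq_self (μ := volume)
                ((Set.Icc a b).indicator (fun y => ENNReal.ofReal (h n y ^ 2))) x,
                lintegral_indicator measurableSet_Icc]
              exact hn1
      rw [← ENNReal.ofReal_le_ofReal_iff ENNReal.toReal_nonneg, ENNReal.ofReal_toReal hBd,
        ofReal_norm]
      exact h1
    have hFlim : Tendsto (fun n => F n (ε * Complex.I)) atTop
        (𝓝 (∫ c in K, G (c + ε * Complex.I))) := by
      refine tendsto_integral_of_dominated_convergence (fun _ => C / ε) (fun n => ?_)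
        (integrable_const _) (fun n => Eventually.of_forall fun c => ?_)
        (Eventually.of_forall fun c => hlim _ (by simpa using hε))
      · exact (continuous_line hε (hd n)).aestronglyMeasurable
      · simpa using hb n (c + ε * Complex.I) (by simpa using hε)
    have hFle : ‖∫ c in K, G (c + ε * Complex.I)‖ ≤
        2 * (C * volume.real K) / s + Bd.toReal := by
      have hcl : IsClosed {w : ℂ | ‖w‖ ≤ 2 * (C * volume.real K) / s + Bd.toReal} :=
        isClosed_le continuous_norm continuous_const
      exact hcl.mem_of_frequently_of_tendsto hFn hFlim
    have hGint : Integrable (fun c : ℝ => G (c + ε * Complex.I)) (volume.restrict K) := by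
      refine Integrable.of_bound (C := C / ε) ?_ (Eventually.of_forall fun c => ?_)
      · exact aestronglyMeasurable_of_tendsto_ae atTop
          (fun n => (continuous_line hε (hd n)).aestronglyMeasurable)
          (Eventually.of_forall fun c => hlim _ (by simpa using hε))
      · refine le_of_tendsto ((hlim _ (by simpa using hε)).norm)
          (Eventually.of_forall fun n => ?_)
        simpa using hb n (c + ε * Complex.I) (by simpa using hε)
    have hnonneg : ∀ c : ℝ, 0 ≤ (G (c + ε * Complex.I)).im := by
      intro c
      rw [hG _ (by simpa using hε)]
      have := integral_im (integrable_inv_sub (μ := μ) (z := c + ε * Complex.I) (by simpa using hε))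
      rw [show (∫ x : ℝ, ((x : ℂ) - (c + ε * Complex.I))⁻¹ ∂μ).im =
        RCLike.im (∫ x : ℝ, ((x : ℂ) - (c + ε * Complex.I))⁻¹ ∂μ) from rfl, ← this]
      refine integral_nonneg fun x => ?_
      exact (poisson_nonneg hε.le (x - c)).trans_eq (im_inv_sub x c ε).symm
    refine (measure_le_lintegral_im hG hε hS.measurableSet).trans ?_
    have h0 := ofReal_integral_eq_lintegral_ofReal hGint.im (Eventually.of_forall hnonneg)
    simp only [RCLike.im_to_complex] at h0
    rw [← hKdef, ← h0]
    have h1 : (∫ c in K, (G (c + ε * Complex.I)).im) ≤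
        2 * (C * volume.real K) / s + Bd.toReal := by
      have := integral_im hGint
      rw [show (∫ c in K, (G (c + ε * Complex.I)).im) =
        RCLike.im (∫ c in K, G (c + ε * Complex.I)) from this]
      exact (Complex.abs_im_le_norm _ |>.trans hFle |> fun h => (le_abs_self _).trans h)
    refine (ENNReal.ofReal_le_ofReal h1).trans ?_
    rw [ENNReal.ofReal_add (by positivity) ENNReal.toReal_nonneg, ENNReal.ofReal_toReal hBd]
    have e1 : 2 * (C * volume.real K) / s = (2 * C / s) * volume.real K := by ring
    rw [e1, ENNReal.ofReal_mul (by positivity), ofReal_measureReal hKv,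
      ENNReal.ofReal_add (by positivity) hκ.le, add_mul, add_assoc]
  -- the limit `ε → 0`
  have step2 : ∀ κ : ℝ, 0 < κ → μ S ≤ ENNReal.ofReal κ⁻¹ * M := by
    intro κ hκ
    have h1 : Tendsto (fun ε : ℝ => ENNReal.ofReal (2 * C / s + κ) *
        volume (Metric.cthickening ε S) + ENNReal.ofReal κ⁻¹ * M) (𝓝[>] 0)
        (𝓝 (ENNReal.ofReal (2 * C / s + κ) * volume S + ENNReal.ofReal κ⁻¹ * M)) := by
      refine Tendsto.add_const _ (ENNReal.Tendsto.const_mul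
        ((tendsto_measure_cthickening_of_isCompact hS).mono_left nhdsWithin_le_nhds)
        (Or.inr ENNReal.ofReal_ne_top))
    rw [hS0, mul_zero, zero_add] at h1
    refine ge_of_tendsto h1 ?_
    filter_upwards [Ioo_mem_nhdsGT hs] with ε hε
    exact step κ hκ ε hε.1 hε.2.le
  have h2 : Tendsto (fun κ : ℝ => ENNReal.ofReal κ⁻¹ * M) atTop (𝓝 0) := by
    have := ENNReal.Tendsto.mul_const (b := M)
      (ENNReal.tendsto_ofReal tendsto_inv_atTop_zero) (Or.inr hM)
    simpa using this
  refine le_antisymm (ge_of_tendsto h2 ?_) zero_le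
  filter_upwards [eventually_gt_atTop 0] with κ hκ
  exact step2 κ hκ

end Criterion


/-! ### Green functions and transfer matrices of a shell -/

namespace Data

variable {S : ℤ → Type*} [∀ n, Fintype (S n)] [∀ n, DecidableEq (S n)] (D : Data S) (n : ℤ)

/-- The resolvent `(Vₙ - z)⁻¹` of a shell; it is `0` if `z` is an eigenvalue of `Vₙ`. -/
def shellRes (z : ℂ) : EuclideanSpace ℂ (S n) →ₗ[ℂ] EuclideanSpace ℂ (S n) :=
  (D.V n - z • (1 : Matrix (S n) (S n) ℂ))⁻¹.toEuclideanLin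

theorem inner_V_left (x y : EuclideanSpace ℂ (S n)) :
    inner ℂ ((D.V n).toEuclideanLin x) y = inner ℂ x ((D.V n).toEuclideanLin y) := by
  conv_rhs => rw [← (D.isHermitian n).eq]
  rw [Matrix.toEuclideanLin_conjTranspose_eq_adjoint, LinearMap.adjoint_inner_right]

variable {D n} in
/-- `(Vₙ - z)⁻¹ (Vₙ - z) u = u` -/
theorem shellRes_apply_sub {z : ℂ} (h : (D.V n - z • (1 : Matrix (S n) (S n) ℂ)).det ≠ 0)
    (u : EuclideanSpace ℂ (S n)) :
    D.shellRes n z ((D.V n).toEuclideanLin u - z • u) = u := by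
  have h1 : (D.V n).toEuclideanLin u - z • u =
      (D.V n - z • (1 : Matrix (S n) (S n) ℂ)).toEuclideanLin u := by simp
  have h2 : ∀ A B : Matrix (S n) (S n) ℂ,
      A.toEuclideanLin (B.toEuclideanLin u) = (A * B).toEuclideanLin u := fun A B => by simp
  rw [h1, shellRes, h2, Matrix.nonsing_inv_mul _ (isUnit_iff_ne_zero.2 h)]
  simp

variable {D n} in
/-- `(Vₙ - z) (Vₙ - z)⁻¹ u = u` -/
theorem sub_shellRes {z : ℂ} (h : (D.V n - z • (1 : Matrix (S n) (S n) ℂ)).det ≠ 0)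
    (u : EuclideanSpace ℂ (S n)) :
    (D.V n).toEuclideanLin (D.shellRes n z u) - z • D.shellRes n z u = u := by
  have h1 : ∀ v, (D.V n).toEuclideanLin v - z • v =
      (D.V n - z • (1 : Matrix (S n) (S n) ℂ)).toEuclideanLin v := fun v => by simp
  have h2 : ∀ A B : Matrix (S n) (S n) ℂ,
      A.toEuclideanLin (B.toEuclideanLin u) = (A * B).toEuclideanLin u := fun A B => by simp
  rw [h1, shellRes, h2, Matrix.mul_nonsing_inv _ (isUnit_iff_ne_zero.2 h)]
  simp

theorem conj_green (z : ℂ) (x y : EuclideanSpace ℂ (S n)) :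
    starRingEnd ℂ (D.green n z x y) = D.green n (starRingEnd ℂ z) y x := by
  have h : (D.V n - starRingEnd ℂ z • (1 : Matrix (S n) (S n) ℂ))⁻¹ =
      ((D.V n - z • (1 : Matrix (S n) (S n) ℂ))⁻¹).conjTranspose := by
    rw [Matrix.conjTranspose_nonsing_inv, Matrix.conjTranspose_sub, (D.isHermitian n).eq,
      Matrix.conjTranspose_smul, Matrix.conjTranspose_one]
    rfl
  rw [green, green, h, Matrix.toEuclideanLin_conjTranspose_eq_adjoint,
    LinearMap.adjoint_inner_right, inner_conj_symm]

theorem abs_im_mul_norm_le_shell (z : ℂ) (u : EuclideanSpace ℂ (S n)) :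
    |z.im| * ‖u‖ ≤ ‖(D.V n).toEuclideanLin u - z • u‖ :=
  abs_im_mul_norm_le (D.inner_V_left n u u) z

theorem det_ne_zero_of_im {z : ℂ} (hz : z.im ≠ 0) :
    (D.V n - z • (1 : Matrix (S n) (S n) ℂ)).det ≠ 0 := by
  intro h
  obtain ⟨v, hv, hv0⟩ := Matrix.exists_mulVec_eq_zero_iff.2 h
  have h1 := D.abs_im_mul_norm_le_shell n z (WithLp.toLp 2 v)
  have h2 : (D.V n).toEuclideanLin (WithLp.toLp 2 v) - z • (WithLp.toLp 2 v) = 0 := by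
    rw [Matrix.sub_mulVec, Matrix.smul_mulVec, Matrix.one_mulVec] at hv0
    rw [Matrix.toLpLin_apply]
    ext i
    exact congrFun hv0 i
  rw [h2, norm_zero] at h1
  have h3 : 0 < |z.im| := abs_pos.2 hz
  have h4 : 0 < ‖(WithLp.toLp 2 v : EuclideanSpace ℂ (S n))‖ := by
    rw [norm_pos_iff]
    intro h5
    exact hv (by simpa using h5)
  nlinarith [mul_pos h3 h4]

theorem norm_shellRes_le {z : ℂ} (hz : z.im ≠ 0) (u : EuclideanSpace ℂ (S n)) :
    |z.im| * ‖D.shellRes n z u‖ ≤ ‖u‖ := by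
  have := D.abs_im_mul_norm_le_shell n z (D.shellRes n z u)
  rwa [sub_shellRes (D.det_ne_zero_of_im n hz)] at this

/-- The matrix `Vₙ - X` of polynomials. -/
def polyMatrix : Matrix (S n) (S n) (Polynomial ℂ) :=
  ((D.V n).map fun c => (Polynomial.C c : Polynomial ℂ)) -
    (Polynomial.X : Polynomial ℂ) • (1 : Matrix (S n) (S n) (Polynomial ℂ))

theorem map_polyMatrix (z : ℂ) :
    (Polynomial.evalRingHom z).mapMatrix (D.polyMatrix n) =
      D.V n - z • (1 : Matrix (S n) (S n) ℂ) := by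
  ext i j
  by_cases h : i = j
  · subst h; simp [polyMatrix]
  · simp [polyMatrix, h]

theorem eval_det_polyMatrix (z : ℂ) :
    (D.polyMatrix n).det.eval z = (D.V n - z • (1 : Matrix (S n) (S n) ℂ)).det := by
  rw [← map_polyMatrix, ← RingHom.map_det]; rfl

theorem det_polyMatrix_ne_zero : (D.polyMatrix n).det ≠ 0 := by
  intro h
  have := D.eval_det_polyMatrix n Complex.I
  rw [h, Polynomial.eval_zero] at this
  exact D.det_ne_zero_of_im n (by simp) this.symm

/-- The numerator of the rational function `x^* (Vₙ - z)⁻¹ y`, by Cramer's rule. -/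
def greenNum (x y : EuclideanSpace ℂ (S n)) : Polynomial ℂ :=
  ∑ i, ∑ j, Polynomial.C (starRingEnd ℂ (x i)) * (D.polyMatrix n).adjugate i j * Polynomial.C (y j)

theorem inner_toEuclideanLin {ι : Type*} [Fintype ι] [DecidableEq ι] (A : Matrix ι ι ℂ)
    (x y : EuclideanSpace ℂ ι) :
    inner ℂ x (A.toEuclideanLin y) = ∑ i, ∑ j, starRingEnd ℂ (x i) * A i j * y j := by
  simp only [PiLp.inner_apply, Matrix.toLpLin_apply, Matrix.mulVec, dotProduct,
    RCLike.inner_apply, Finset.sum_mul]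
  exact Finset.sum_congr rfl fun i _ => Finset.sum_congr rfl fun j _ => by ring

theorem green_eq_div (z : ℂ) (x y : EuclideanSpace ℂ (S n)) :
    D.green n z x y = (D.greenNum n x y).eval z / (D.polyMatrix n).det.eval z := by
  rw [green, inner_toEuclideanLin, eval_det_polyMatrix, Matrix.inv_def, Ring.inverse_eq_inv',
    greenNum, Polynomial.eval_finsetSum, Finset.sum_div]
  refine Finset.sum_congr rfl fun i _ => ?_
  rw [Polynomial.eval_finsetSum, Finset.sum_div]
  refine Finset.sum_congr rfl fun j _ => ?_
  have : (D.V n - z • (1 : Matrix (S n) (S n) ℂ)).adjugate i j =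
      ((D.polyMatrix n).adjugate i j).eval z := by
    rw [← map_polyMatrix, ← RingHom.map_adjugate]; rfl
  simp only [Matrix.smul_apply, this, Polynomial.eval_mul, Polynomial.eval_C, smul_eq_mul]
  ring

theorem det_ne_zero_of_green {z : ℂ} {x y : EuclideanSpace ℂ (S n)} (h : D.green n z x y ≠ 0) :
    (D.V n - z • (1 : Matrix (S n) (S n) ℂ)).det ≠ 0 := by
  intro h0
  rw [green_eq_div, eval_det_polyMatrix, h0, div_zero] at h
  exact h rfl

/-- The zeros include the poles, where `green` has the value `0`. -/
theorem finite_green_eq_zero {x y : EuclideanSpace ℂ (S n)} (h : ∃ z, D.green n z x y ≠ 0) :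
    {z | D.green n z x y = 0}.Finite := by
  obtain ⟨w, hw⟩ := h
  rw [green_eq_div] at hw
  have h1 : D.greenNum n x y ≠ 0 := by
    rintro h0; simp [h0] at hw
  have h2 : {z | D.green n z x y = 0} ⊆
      ↑((D.greenNum n x y).roots.toFinset ∪ (D.polyMatrix n).det.roots.toFinset) := by
    intro z hz
    have hz : D.green n z x y = 0 := hz
    rw [green_eq_div, div_eq_zero_iff] at hz
    simpa [h1, D.det_polyMatrix_ne_zero n] using hz
  exact (Finset.finite_toSet _).subset h2

theorem continuousAt_green {z : ℂ} (h : (D.V n - z • (1 : Matrix (S n) (S n) ℂ)).det ≠ 0)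
    (x y : EuclideanSpace ℂ (S n)) : ContinuousAt (fun z => D.green n z x y) z := by
  simp_rw [green_eq_div]
  rw [← eval_det_polyMatrix] at h
  exact (Polynomial.continuous _).continuousAt.div (Polynomial.continuous _).continuousAt h

theorem meromorphicAt_green (z : ℂ) (x y : EuclideanSpace ℂ (S n)) :
    MeromorphicAt (fun z => D.green n z x y) z := by
  simp_rw [green_eq_div]
  have : ∀ p : Polynomial ℂ, MeromorphicAt (fun z => p.eval z) z := fun p =>
    ((Polynomial.differentiable p).analyticAt z).meromorphicAt
  exact (this _).div (this _)

theorem conj_beta (z : ℂ) : starRingEnd ℂ (D.beta n z) = D.gamma n (starRingEnd ℂ z) :=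
  D.conj_green n z _ _

/-- The points where the formula for the transfer matrix, or for its inverse, fails. -/
def excSet : Set ℂ := {z | D.beta n z = 0} ∪ {z | D.gamma n z = 0}

variable {D n}

theorem finite_excSet (h : ∃ z, D.beta n z ≠ 0) : (D.excSet n).Finite := by
  refine (D.finite_green_eq_zero n h).union (D.finite_green_eq_zero n ?_)
  obtain ⟨z, hz⟩ := h
  refine ⟨starRingEnd ℂ z, ?_⟩
  have := D.conj_beta n z
  rw [gamma] at this
  rw [← this]
  simpa using hz

theorem TransferDefined.exists_beta {z : ℂ} (h : D.TransferDefined n z) :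
    ∃ z, D.beta n z ≠ 0 := h.1.exists

theorem det_rawTransfer {z : ℂ} (h : D.beta n z ≠ 0) :
    (D.rawTransfer n z).det = D.gamma n z / D.beta n z := by
  have ha : (D.a n : ℂ) ≠ 0 := by exact_mod_cast D.a_ne_zero n
  rw [rawTransfer, Matrix.det_fin_two_of]
  field_simp
  ring

theorem continuousAt_rawTransfer {z : ℂ} (h : D.beta n z ≠ 0) :
    ContinuousAt (D.rawTransfer n) z := by
  have hd := D.det_ne_zero_of_green n h
  have hα : ContinuousAt (D.alpha n) z := D.continuousAt_green n hd _ _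
  have hβ : ContinuousAt (D.beta n) z := D.continuousAt_green n hd _ _
  have hγ : ContinuousAt (D.gamma n) z := D.continuousAt_green n hd _ _
  have hδ : ContinuousAt (D.delta n) z := D.continuousAt_green n hd _ _
  have hβi : ContinuousAt (fun z => (D.beta n z)⁻¹) z := hβ.inv₀ h
  unfold rawTransfer
  refine continuousAt_pi.2 fun i => continuousAt_pi.2 fun j => ?_
  fin_cases i <;> fin_cases j
  · exact continuousAt_const.mul hβi
  · exact (continuousAt_const.mul hβi).mul hα
  · exact (continuousAt_const.mul hδ).mul hβi
  · exact continuousAt_const.mul (hγ.sub ((hδ.mul hβi).mul hα))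

theorem eventually_beta_ne_zero (h : ∃ z, D.beta n z ≠ 0) (z : ℂ) :
    ∀ᶠ w in 𝓝[≠] z, D.beta n w ≠ 0 := by
  have hf : ({w | D.beta n w = 0} \ {z}).Finite := (D.finite_green_eq_zero n h).sdiff
  have : ({w | D.beta n w = 0} \ {z})ᶜ ∈ 𝓝 z := hf.isClosed.isOpen_compl.mem_nhds (by simp)
  filter_upwards [nhdsWithin_le_nhds this, self_mem_nhdsWithin] with w hw hwz h0
  exact hw ⟨h0, hwz⟩

theorem transferDefined_of_ne {z : ℂ} (h : D.beta n z ≠ 0) : D.TransferDefined n z :=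
  ⟨eventually_beta_ne_zero ⟨z, h⟩ z, _,
    (continuousAt_rawTransfer h).tendsto.mono_left nhdsWithin_le_nhds⟩

theorem tendsto_transfer {z : ℂ} (h : D.TransferDefined n z) :
    Tendsto (D.rawTransfer n) (𝓝[≠] z) (𝓝 (D.transfer n z)) := by
  rw [transfer, if_pos h]
  exact tendsto_nhds_limUnder h.2

theorem transfer_eq {z : ℂ} (h : D.beta n z ≠ 0) : D.transfer n z = D.rawTransfer n z :=
  tendsto_nhds_unique (tendsto_transfer (transferDefined_of_ne h))
    ((continuousAt_rawTransfer h).tendsto.mono_left nhdsWithin_le_nhds)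

theorem continuousAt_transfer {z : ℂ} (h : D.TransferDefined n z) :
    ContinuousAt (D.transfer n) z := by
  rw [continuousAt_iff_punctured_nhds]
  refine (tendsto_transfer h).congr' ?_
  filter_upwards [h.1] with w hw
  exact (transfer_eq hw).symm

theorem tendsto_ofReal_punctured (l : ℝ) :
    Tendsto (fun x : ℝ => (x : ℂ)) (𝓝[≠] l) (𝓝[≠] (l : ℂ)) := by
  refine tendsto_nhdsWithin_iff.2 ⟨?_, ?_⟩
  · exact Complex.continuous_ofReal.continuousAt.tendsto.mono_left nhdsWithin_le_nhds
  · filter_upwards [self_mem_nhdsWithin] with x hx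
    simpa using hx

/-- For real energies `|det T| = |γ / β| = 1`, since `γ` is the complex conjugate of `β`. -/
theorem norm_det_transfer {l : ℝ} (h : D.TransferDefined n l) : ‖(D.transfer n l).det‖ = 1 := by
  have h1 : Tendsto (fun x : ℝ => ‖(D.rawTransfer n x).det‖) (𝓝[≠] l)
      (𝓝 ‖(D.transfer n l).det‖) := by
    have hc : Continuous fun M : Matrix (Fin 2) (Fin 2) ℂ => ‖M.det‖ := by fun_prop
    exact (hc.tendsto _).comp ((tendsto_transfer h).comp (tendsto_ofReal_punctured l))
  refine tendsto_nhds_unique h1 (tendsto_const_nhds.congr' ?_)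
  filter_upwards [(tendsto_ofReal_punctured l).eventually h.1] with x hx
  have h2 := D.conj_beta n x
  rw [Complex.conj_ofReal] at h2
  rw [det_rawTransfer hx, ← h2, norm_div, Complex.norm_conj, div_self (norm_ne_zero_iff.2 hx)]

theorem A_subset_excSet : D.A n ⊆ {_z | ¬ ∃ w, D.beta n w ≠ 0} ∪ D.excSet n := by
  intro z hz
  by_contra hc
  simp only [excSet, Set.mem_union, Set.mem_ofPred_eq, not_or, not_not] at hc
  obtain ⟨-, h2, h3⟩ := hc
  refine hz ⟨transferDefined_of_ne h2, ?_⟩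
  rw [transfer_eq h2, Matrix.isUnit_iff_isUnit_det, det_rawTransfer h2]
  exact isUnit_iff_ne_zero.2 (div_ne_zero h3 h2)

/-- The solutions of the eigenvalue equation on a shell with inputs `p` along `Φ` and `q`
along `Υ`. -/
theorem shell_solution {z p q : ℂ} {u ψ : EuclideanSpace ℂ (S n)}
    (hd : (D.V n - z • (1 : Matrix (S n) (S n) ℂ)).det ≠ 0)
    (h : (D.V n).toEuclideanLin u - z • u = ψ + p • D.Φ n + q • D.Υ n) :
    u = D.shellRes n z ψ + p • D.shellRes n z (D.Φ n) + q • D.shellRes n z (D.Υ n) := by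
  have := shellRes_apply_sub hd u
  rw [h, map_add, map_add, map_smul, map_smul] at this
  exact this.symm

/-- The transfer matrix maps the channel values on the left of a shell to those on its right. -/
theorem rawTransfer_mulVec {z p q : ℂ} {u : EuclideanSpace ℂ (S n)} (hβ : D.beta n z ≠ 0)
    (h : (D.V n).toEuclideanLin u - z • u = p • D.Φ n + q • D.Υ n) :
    (D.rawTransfer n z).mulVec ![D.a n * inner ℂ (D.Υ n) u, q / D.a n] =
      ![p, inner ℂ (D.Φ n) u] := by
  have ha : (D.a n : ℂ) ≠ 0 := by exact_mod_cast D.a_ne_zero n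
  have hu := shell_solution (ψ := 0) (D.det_ne_zero_of_green n hβ) (by rw [h, zero_add])
  rw [map_zero, zero_add] at hu
  have hx : inner ℂ (D.Υ n) u = p * D.beta n z + q * D.alpha n z := by
    rw [hu, inner_add_right, inner_smul_right, inner_smul_right]; rfl
  have hy : inner ℂ (D.Φ n) u = p * D.delta n z + q * D.gamma n z := by
    rw [hu, inner_add_right, inner_smul_right, inner_smul_right]; rfl
  rw [hx, hy, rawTransfer]
  ext i
  fin_cases i
  · simp [Matrix.mulVec, dotProduct]
    field_simp
    ring
  · simp [Matrix.mulVec, dotProduct]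
    field_simp
    ring

theorem meromorphicAt_rawTransfer (z : ℂ) (i j : Fin 2) :
    MeromorphicAt (fun w => D.rawTransfer n w i j) z := by
  have hα : MeromorphicAt (D.alpha n) z := D.meromorphicAt_green n z _ _
  have hβ : MeromorphicAt (fun w => (D.beta n w)⁻¹) z := (D.meromorphicAt_green n z _ _).inv
  have hγ : MeromorphicAt (D.gamma n) z := D.meromorphicAt_green n z _ _
  have hδ : MeromorphicAt (D.delta n) z := D.meromorphicAt_green n z _ _
  have hc : ∀ c : ℂ, MeromorphicAt (fun _ : ℂ => c) z := fun c => MeromorphicAt.const c z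
  fin_cases i <;> fin_cases j
  · exact (hc _).mul hβ
  · exact ((hc _).mul hβ).mul hα
  · exact ((hc _).mul hδ).mul hβ
  · exact (hc _).mul (hγ.sub ((hδ.mul hβ).mul hα))

/-- A meromorphic function that is integrable over an interval has no poles there. -/
theorem exists_tendsto_of_integrableOn {f : ℂ → ℂ} {l a b : ℝ} (hf : MeromorphicAt f l)
    (hab : a < b) (hl : l ∈ Set.Icc a b) (hint : IntegrableOn (fun x : ℝ => f x) (Set.Icc a b)) :
    ∃ c, Tendsto f (𝓝[≠] (l : ℂ)) (𝓝 c) := by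
  rw [tendsto_nhds_iff_meromorphicOrderAt_nonneg hf]
  by_contra hneg
  rw [not_le] at hneg
  obtain ⟨m, hm⟩ := WithTop.ne_top_iff_exists.1 hneg.ne_top
  rw [← hm] at hneg
  have hm0 : m < 0 := by exact_mod_cast hneg
  obtain ⟨g, hg, hgl, hfg⟩ := (meromorphicOrderAt_eq_int_iff hf).1 hm.symm
  -- a pole would dominate `1 / (x - l)`, which is not integrable
  have hbig : (fun x : ℝ => (x - l)⁻¹) =O[𝓝[≠] l] fun x : ℝ => f x := by
    refine Asymptotics.IsBigO.of_bound (2 / ‖g l‖) ?_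
    have hgn : 0 < ‖g l‖ := norm_pos_iff.2 hgl
    have h1 : ∀ᶠ w in 𝓝 (l : ℂ), ‖g l‖ / 2 < ‖g w‖ :=
      (hg.continuousAt.norm).eventually (lt_mem_nhds (half_lt_self hgn))
    have h2 : ∀ᶠ w : ℂ in 𝓝 (l : ℂ), ‖w - (l : ℂ)‖ < 1 := by
      filter_upwards [Metric.ball_mem_nhds (l : ℂ) one_pos] with w hw
      rwa [← dist_eq_norm]
    have h3 := (tendsto_ofReal_punctured l).eventually
      (hfg.and ((h1.and h2).filter_mono (nhdsWithin_le_nhds (s := {(l : ℂ)}ᶜ))))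
    filter_upwards [h3, self_mem_nhdsWithin] with x hx hxl
    obtain ⟨e, h4, h5⟩ := hx
    have hne : (x : ℂ) - l ≠ 0 := by
      rw [sub_ne_zero]; exact_mod_cast hxl
    have hpos : 0 < ‖(x : ℂ) - l‖ := norm_pos_iff.2 hne
    have h6 : ‖(x - l)⁻¹‖ = ‖(x : ℂ) - l‖ ^ (-1 : ℤ) := by
      rw [zpow_neg_one, norm_inv, ← Complex.ofReal_sub, Complex.norm_real]
    have h7 : ‖(x : ℂ) - l‖ ^ (-1 : ℤ) ≤ ‖(x : ℂ) - l‖ ^ m :=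
      zpow_le_zpow_right_of_le_one₀ hpos h5.le (by omega)
    rw [e, norm_smul, norm_zpow, h6]
    calc ‖(x : ℂ) - l‖ ^ (-1 : ℤ) ≤ ‖(x : ℂ) - l‖ ^ m := h7
      _ = 2 / ‖g l‖ * (‖(x : ℂ) - l‖ ^ m * (‖g l‖ / 2)) := by field_simp
      _ ≤ _ := by gcongr
  refine not_intervalIntegrable_of_sub_inv_isBigO_punctured hbig hab.ne
    (by rwa [Set.uIcc_of_le hab.le]) ?_
  rw [intervalIntegrable_iff_integrableOn_Icc_of_le hab.le]
  exact hint

theorem transferDefined_of_integrableOn {l a b : ℝ} (hβ : ∃ z, D.beta n z ≠ 0) (hab : a < b)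
    (hl : l ∈ Set.Icc a b)
    (hint : ∀ i j, IntegrableOn (fun x : ℝ => D.rawTransfer n x i j) (Set.Icc a b)) :
    D.TransferDefined n l := by
  refine ⟨eventually_beta_ne_zero hβ _, ?_⟩
  choose c hc using fun i j => exists_tendsto_of_integrableOn
    (meromorphicAt_rawTransfer (D := D) (n := n) (l : ℂ) i j) hab hl (hint i j)
  exact ⟨c, tendsto_pi_nhds.2 fun i => tendsto_pi_nhds.2 fun j => hc i j⟩

end Data


/-! ### Transfer matrices at eigenvalues of a shell -/

namespace Data

variable {S : ℤ → Type*} [∀ n, Fintype (S n)] [∀ n, DecidableEq (S n)] {D : Data S} {n : ℤ}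

variable (D n) in
/-- The eigenspace of `Vₙ` at `l`; it is `0` if `l` is not an eigenvalue. -/
def shellKer (l : ℝ) : Submodule ℂ (EuclideanSpace ℂ (S n)) :=
  LinearMap.ker ((D.V n).toEuclideanLin - (l : ℂ) • LinearMap.id)

theorem mem_shellKer {l : ℝ} {u : EuclideanSpace ℂ (S n)} :
    u ∈ D.shellKer n l ↔ (D.V n).toEuclideanLin u - (l : ℂ) • u = 0 := by
  simp [shellKer, LinearMap.mem_ker]

theorem inner_sub_left_of_real (l : ℝ) (x y : EuclideanSpace ℂ (S n)) :
    inner ℂ ((D.V n).toEuclideanLin x - (l : ℂ) • x) y =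
      inner ℂ x ((D.V n).toEuclideanLin y - (l : ℂ) • y) := by
  rw [inner_sub_left, inner_sub_right, inner_V_left, inner_smul_left, inner_smul_right,
    Complex.conj_ofReal]

/-- The range of `Vₙ - l` is the orthogonal complement of its kernel. -/
theorem exists_of_mem_orthogonal {l : ℝ} {r : EuclideanSpace ℂ (S n)}
    (hr : r ∈ (D.shellKer n l)ᗮ) : ∃ v, (D.V n).toEuclideanLin v - (l : ℂ) • v = r := by
  let L := (D.V n).toEuclideanLin - (l : ℂ) • LinearMap.id
  have h1 : (LinearMap.range L)ᗮ ≤ D.shellKer n l := by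
    intro u hu
    rw [mem_shellKer, ← inner_self_eq_zero (𝕜 := ℂ), inner_sub_left_of_real]
    have := (Submodule.mem_orthogonal' _ _).1 hu
      (L ((D.V n).toEuclideanLin u - (l : ℂ) • u)) ⟨_, rfl⟩
    exact this
  have h2 := Submodule.orthogonal_le h1
  rw [Submodule.orthogonal_orthogonal] at h2
  obtain ⟨v, hv⟩ := h2 hr
  exact ⟨v, by simpa [L] using hv⟩

/-- `(l - w) (Vₙ - w)⁻¹` converges to the spectral projection at `l`, as `w → l` vertically. -/
theorem tendsto_shellRes (l : ℝ) (φ : EuclideanSpace ℂ (S n)) :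
    Tendsto (fun ε : ℝ => (-(ε * Complex.I)) • D.shellRes n (l + ε * Complex.I) φ) (𝓝[>] 0)
      (𝓝 ((D.shellKer n l).starProjection φ)) := by
  set k := (D.shellKer n l).starProjection φ with hk
  have hkm : k ∈ D.shellKer n l := Submodule.starProjection_apply_mem _ _
  obtain ⟨v, hv⟩ := exists_of_mem_orthogonal (D := D)
    (Submodule.sub_starProjection_mem_orthogonal (K := D.shellKer n l) φ)
  rw [← hk] at hv
  have hle : ∀ᶠ ε : ℝ in 𝓝[>] 0,
      ‖(-(ε * Complex.I)) • D.shellRes n (l + ε * Complex.I) φ - k‖ ≤ 2 * ‖v‖ * ε := by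
    filter_upwards [self_mem_nhdsWithin] with ε hε
    have hε : 0 < ε := hε
    set w : ℂ := l + ε * Complex.I with hw
    have him : w.im = ε := by simp [hw]
    have hwim : w.im ≠ 0 := by rw [him]; exact hε.ne'
    have hd := D.det_ne_zero_of_im n hwim
    have h1 := shellRes_apply_sub hd k
    have hVk : (D.V n).toEuclideanLin k = (l : ℂ) • k := sub_eq_zero.1 (mem_shellKer.1 hkm)
    have e1 : (-(ε * Complex.I)) • D.shellRes n w k = k := by
      have : (l : ℂ) - w = -(ε * Complex.I) := by rw [hw]; ring
      rwa [hVk, ← sub_smul, map_smul, this] at h1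
    have h2 := shellRes_apply_sub hd v
    have hVv : (D.V n).toEuclideanLin v - w • v = (φ - k) + (-(ε * Complex.I)) • v := by
      rw [← hv, hw]; module
    rw [hVv, map_add, map_smul] at h2
    have e2 : (-(ε * Complex.I)) • D.shellRes n w φ - k =
        (-(ε * Complex.I)) • (v - (-(ε * Complex.I)) • D.shellRes n w v) := by
      have : D.shellRes n w (φ - k) = v - (-(ε * Complex.I)) • D.shellRes n w v :=
        eq_sub_of_add_eq h2
      rw [← this, map_sub, smul_sub, e1]
    rw [e2, norm_smul]
    have hnε : ‖-(ε * Complex.I : ℂ)‖ = ε := by simp [abs_of_pos hε]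
    rw [hnε]
    have h3 := D.norm_shellRes_le n hwim v
    rw [him, abs_of_pos hε] at h3
    have h4 : ‖v - (-(ε * Complex.I)) • D.shellRes n w v‖ ≤ ‖v‖ + ‖v‖ := by
      refine (norm_sub_le _ _).trans ?_
      rw [norm_smul, hnε]
      linarith
    nlinarith
  rw [tendsto_iff_norm_sub_tendsto_zero]
  refine squeeze_zero' (Eventually.of_forall fun _ => norm_nonneg _) hle ?_
  have : Tendsto (fun ε : ℝ => 2 * ‖v‖ * ε) (𝓝 0) (𝓝 (2 * ‖v‖ * 0)) :=
    tendsto_const_nhds.mul tendsto_id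
  rw [mul_zero] at this
  exact this.mono_left nhdsWithin_le_nhds

/-- The residue of a Green function of the shell at `l`. -/
theorem tendsto_green (l : ℝ) (x y : EuclideanSpace ℂ (S n)) :
    Tendsto (fun ε : ℝ => (-(ε * Complex.I)) * D.green n (l + ε * Complex.I) x y) (𝓝[>] 0)
      (𝓝 (inner ℂ x ((D.shellKer n l).starProjection y))) := by
  have := (tendsto_const_nhds (x := x)).inner (𝕜 := ℂ) (tendsto_shellRes (D := D) l y)
  refine this.congr fun ε => ?_
  rw [inner_smul_right]; rfl

theorem tendsto_vertical (l : ℝ) :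
    Tendsto (fun ε : ℝ => (l : ℂ) + ε * Complex.I) (𝓝[>] 0) (𝓝[≠] (l : ℂ)) := by
  refine tendsto_nhdsWithin_iff.2 ⟨?_, ?_⟩
  · have hc : Continuous fun ε : ℝ => (l : ℂ) + ε * Complex.I := by fun_prop
    have := hc.tendsto 0
    simp only [Complex.ofReal_zero, zero_mul, add_zero] at this
    exact this.mono_left nhdsWithin_le_nhds
  · filter_upwards [self_mem_nhdsWithin] with ε hε
    have hε : 0 < ε := hε
    simpa using hε.ne'

theorem tendsto_entry {l : ℝ} (h : D.TransferDefined n l) (i j : Fin 2) :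
    Tendsto (fun ε : ℝ => D.rawTransfer n (l + ε * Complex.I) i j) (𝓝[>] 0)
      (𝓝 (D.transfer n l i j)) :=
  (tendsto_pi_nhds.1 (tendsto_pi_nhds.1
    ((tendsto_transfer h).comp (tendsto_vertical l)) i) j)

/-- If the transfer matrix is defined at `l`, the spectral projections of `Υ` and `Φ` at `l`
span the same line or both vanish: the poles of the four Green functions at `l` have to cancel
in the entries of the transfer matrix. -/
theorem projections_parallel {l : ℝ} (h : D.TransferDefined n l) :
    ((D.shellKer n l).starProjection (D.Υ n) = 0 ∧ (D.shellKer n l).starProjection (D.Φ n) = 0) ∨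
    ∃ c : ℂ, c ≠ 0 ∧ (D.shellKer n l).starProjection (D.Φ n) =
      c • (D.shellKer n l).starProjection (D.Υ n) := by
  set P := (D.shellKer n l).starProjection with hP
  have ha : (D.a n : ℂ) ≠ 0 := by exact_mod_cast D.a_ne_zero n
  have hPP : ∀ x y, inner ℂ x (P y) = inner ℂ (P x) (P y) := by
    intro x y
    rw [hP, Submodule.inner_starProjection_left_eq_right]
    congr 1
    exact (Submodule.starProjection_eq_self_iff.2 (Submodule.starProjection_apply_mem _ _)).symm
  have hα := tendsto_green (D := D) l (D.Υ n) (D.Υ n)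
  have hβ := tendsto_green (D := D) l (D.Υ n) (D.Φ n)
  have hγ := tendsto_green (D := D) l (D.Φ n) (D.Υ n)
  have hδ := tendsto_green (D := D) l (D.Φ n) (D.Φ n)
  rw [← hP, hPP] at hα hβ hγ hδ
  set A := inner ℂ (P (D.Υ n)) (P (D.Υ n)) with hA
  set b := inner ℂ (P (D.Υ n)) (P (D.Φ n)) with hb
  set b' := inner ℂ (P (D.Φ n)) (P (D.Υ n)) with hb'
  set E := inner ℂ (P (D.Φ n)) (P (D.Φ n)) with hE
  have hbb : ∀ᶠ ε : ℝ in 𝓝[>] 0, D.beta n (l + ε * Complex.I) ≠ 0 :=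
    (tendsto_vertical l).eventually h.1
  -- multiply entries of `T` by `-iεβ`, whose limit is `b`, and compare the residues
  have r1 : D.transfer n l 0 1 * b = -D.a n * A := by
    refine tendsto_nhds_unique ((tendsto_entry h 0 1).mul hβ)
      ((tendsto_const_nhds.mul hα).congr' ?_)
    filter_upwards [hbb] with ε hε
    have hg : D.green n (l + ε * Complex.I) (D.Υ n) (D.Φ n) = D.beta n (l + ε * Complex.I) := rfl
    have hg' : D.green n (l + ε * Complex.I) (D.Υ n) (D.Υ n) = D.alpha n (l + ε * Complex.I) := rfl
    rw [hg, hg']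
    simp [rawTransfer]
    field_simp
  have r2 : D.transfer n l 1 0 * b * D.a n = E := by
    refine tendsto_nhds_unique (((tendsto_entry h 1 0).mul hβ).mul tendsto_const_nhds)
      (hδ.congr' ?_)
    filter_upwards [hbb] with ε hε
    have hg : D.green n (l + ε * Complex.I) (D.Υ n) (D.Φ n) = D.beta n (l + ε * Complex.I) := rfl
    have hg' : D.green n (l + ε * Complex.I) (D.Φ n) (D.Φ n) = D.delta n (l + ε * Complex.I) := rfl
    rw [hg, hg']
    simp [rawTransfer]
    field_simp
  have r3 : b' * b - E * A = 0 := by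
    have h0 : Tendsto (fun ε : ℝ => -(ε * Complex.I : ℂ)) (𝓝[>] 0) (𝓝 0) := by
      have hc : Continuous fun ε : ℝ => -(ε * Complex.I : ℂ) := by fun_prop
      have := hc.tendsto 0
      simp only [Complex.ofReal_zero, zero_mul, neg_zero] at this
      exact this.mono_left nhdsWithin_le_nhds
    have h1 := (h0.mul ((tendsto_entry h 1 1).mul hβ)).mul
      (tendsto_const_nhds (x := (D.a n : ℂ)⁻¹))
    rw [zero_mul, zero_mul] at h1
    refine (tendsto_nhds_unique h1 (((hγ.mul hβ).sub (hδ.mul hα)).congr' ?_)).symm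
    filter_upwards [hbb] with ε hε
    have hg : D.green n (l + ε * Complex.I) (D.Υ n) (D.Φ n) = D.beta n (l + ε * Complex.I) := rfl
    have hg' : D.green n (l + ε * Complex.I) (D.Φ n) (D.Φ n) = D.delta n (l + ε * Complex.I) := rfl
    have hg1 : D.green n (l + ε * Complex.I) (D.Φ n) (D.Υ n) = D.gamma n (l + ε * Complex.I) := rfl
    have hg2 : D.green n (l + ε * Complex.I) (D.Υ n) (D.Υ n) = D.alpha n (l + ε * Complex.I) := rfl
    rw [hg, hg', hg1, hg2]
    simp [rawTransfer]
    field_simp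
  by_cases hb0 : b = 0
  · left
    rw [hb0, mul_zero] at r1
    rw [hb0, mul_zero, zero_mul] at r2
    have hA0 : A = 0 := by
      have := r1.symm
      simpa [D.a_ne_zero n] using this
    exact ⟨inner_self_eq_zero.1 hA0, inner_self_eq_zero.1 r2.symm⟩
  · -- `r3` says that the Gram determinant of the two projections vanishes
    right
    have hA0 : A ≠ 0 := by
      intro hA0
      have h0 : P (D.Υ n) = 0 := inner_self_eq_zero.1 hA0
      rw [hb, h0, inner_zero_left] at hb0
      exact hb0 rfl
    refine ⟨b / A, div_ne_zero hb0 hA0, ?_⟩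
    -- equality in the Cauchy-Schwarz inequality
    have key : A • P (D.Φ n) - b • P (D.Υ n) = 0 := by
      have hAc : starRingEnd ℂ A = A := by rw [hA, inner_conj_symm]
      have hbc : starRingEnd ℂ b = b' := by rw [hb, hb', inner_conj_symm]
      rw [← inner_self_eq_zero (𝕜 := ℂ)]
      simp only [inner_sub_left, inner_sub_right, inner_smul_left, inner_smul_right, hAc, hbc]
      rw [← hA, ← hb, ← hb', ← hE]
      linear_combination (-A) * r3
    rw [sub_eq_zero] at key
    rw [div_eq_inv_mul, mul_smul, ← key, smul_smul, inv_mul_cancel₀ hA0, one_smul]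

theorem projection_Υ_eq_zero_iff {l : ℝ} (h : D.TransferDefined n l) :
    (D.shellKer n l).starProjection (D.Υ n) = 0 ↔
      (D.shellKer n l).starProjection (D.Φ n) = 0 := by
  rcases projections_parallel h with h0 | ⟨c, hc, h1⟩
  · simp [h0.1, h0.2]
  · rw [h1]; simp [hc]

theorem inner_eq_zero_iff_of_mem_shellKer {l : ℝ} (h : D.TransferDefined n l)
    {u : EuclideanSpace ℂ (S n)} (hu : u ∈ D.shellKer n l) :
    inner ℂ (D.Υ n) u = 0 ↔ inner ℂ (D.Φ n) u = 0 := by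
  have e : ∀ x, inner ℂ x u = inner ℂ ((D.shellKer n l).starProjection x) u := by
    intro x
    rw [Submodule.inner_starProjection_left_eq_right, Submodule.starProjection_eq_self_iff.2 hu]
  rw [e, e (D.Φ n)]
  rcases projections_parallel h with h0 | ⟨c, hc, h1⟩
  · simp [h0.1, h0.2]
  · rw [h1, inner_smul_left]; simp [hc]

/-- A solution with `Υ^* u = 0` and without input along `Υ` is an eigenvector without channel
components, wherever the transfer matrix is defined. -/
theorem forward_zero {l : ℝ} (h : D.TransferDefined n l) {u : EuclideanSpace ℂ (S n)} {p : ℂ}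
    (hu : (D.V n).toEuclideanLin u - (l : ℂ) • u = p • D.Φ n) (hx : inner ℂ (D.Υ n) u = 0) :
    p = 0 ∧ inner ℂ (D.Φ n) u = 0 := by
  have ha : (D.a n : ℂ) ≠ 0 := by exact_mod_cast D.a_ne_zero n
  set P := (D.shellKer n l).starProjection with hP
  have hp : p = 0 := by
    by_contra hp
    have hΦ : P (D.Φ n) = 0 := by
      have h1 : P (p • D.Φ n) = 0 := by
        rw [← hu, hP, Submodule.starProjection_apply_eq_zero_iff, Submodule.mem_orthogonal]
        intro k hk
        rw [← inner_sub_left_of_real, mem_shellKer.1 hk, inner_zero_left]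
      rw [map_smul] at h1
      exact (smul_eq_zero.1 h1).resolve_left hp
    have hΥ : P (D.Υ n) = 0 := (projection_Υ_eq_zero_iff h).2 hΦ
    -- the entry `1 / (a β)` stays bounded, while the Green function of `Υ` and `u` has no pole;
    -- the product of the two computes `p`
    have hlim := ((tendsto_entry h 0 0).mul (tendsto_green (D := D) l (D.Υ n) u)).mul
      (tendsto_const_nhds (x := (D.a n : ℂ)))
    rw [← Submodule.inner_starProjection_left_eq_right, ← hP, hΥ, inner_zero_left, mul_zero,
      zero_mul] at hlim
    have : -p = 0 := by
      refine tendsto_nhds_unique (tendsto_const_nhds.congr' ?_) hlim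
      filter_upwards [(tendsto_vertical l).eventually h.1] with ε hε
      set w : ℂ := l + ε * Complex.I with hw
      have h1 : (D.V n).toEuclideanLin u - w • u =
          p • D.Φ n + (-(ε * Complex.I)) • u := by
        rw [← hu, hw]; module
      have h2 := shellRes_apply_sub (D.det_ne_zero_of_green n hε) u
      rw [h1, map_add, map_smul, map_smul] at h2
      have h3 := congrArg (fun v => inner ℂ (D.Υ n) v) h2
      simp only [inner_add_right, inner_smul_right, hx] at h3
      have hβ : inner ℂ (D.Υ n) (D.shellRes n w (D.Φ n)) = D.beta n w := rfl
      have hg : D.green n w (D.Υ n) u = inner ℂ (D.Υ n) (D.shellRes n w u) := rfl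
      rw [hβ, ← hg] at h3
      have h4 : D.rawTransfer n w 0 0 = (D.a n : ℂ)⁻¹ * (D.beta n w)⁻¹ := by simp [rawTransfer]
      rw [h4]
      field_simp
      linear_combination -h3
    exact hp (neg_eq_zero.1 this)
  refine ⟨hp, ?_⟩
  rw [hp, zero_smul] at hu
  exact (inner_eq_zero_iff_of_mem_shellKer h (mem_shellKer.2 hu)).1 hx

/-- The mirror image of `forward_zero`: a solution with `Φ^* u = 0` and without input along `Φ`. -/
theorem backward_zero {l : ℝ} (h : D.TransferDefined n l) {u : EuclideanSpace ℂ (S n)} {q : ℂ}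
    (hu : (D.V n).toEuclideanLin u - (l : ℂ) • u = q • D.Υ n) (hy : inner ℂ (D.Φ n) u = 0) :
    q = 0 ∧ inner ℂ (D.Υ n) u = 0 := by
  have ha : (D.a n : ℂ) ≠ 0 := by exact_mod_cast D.a_ne_zero n
  set P := (D.shellKer n l).starProjection with hP
  have hq : q = 0 := by
    by_contra hq
    have hΥ : P (D.Υ n) = 0 := by
      have h1 : P (q • D.Υ n) = 0 := by
        rw [← hu, hP, Submodule.starProjection_apply_eq_zero_iff, Submodule.mem_orthogonal]
        intro k hk
        rw [← inner_sub_left_of_real, mem_shellKer.1 hk, inner_zero_left]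
      rw [map_smul] at h1
      exact (smul_eq_zero.1 h1).resolve_left hq
    have hΦ : P (D.Φ n) = 0 := (projection_Υ_eq_zero_iff h).1 hΥ
    have hlim := ((tendsto_entry h 0 0).mul (tendsto_green (D := D) l (D.Φ n) u)).mul
      (tendsto_const_nhds (x := (D.a n : ℂ)))
    rw [← Submodule.inner_starProjection_left_eq_right, ← hP, hΦ, inner_zero_left, mul_zero,
      zero_mul] at hlim
    -- `γ / β` is the determinant of the transfer matrix
    have hdet : Tendsto (fun ε : ℝ => (D.rawTransfer n (l + ε * Complex.I)).det) (𝓝[>] 0)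
        (𝓝 (D.transfer n l).det) := by
      have hc : Continuous fun M : Matrix (Fin 2) (Fin 2) ℂ => M.det := by fun_prop
      exact (hc.tendsto _).comp ((tendsto_transfer h).comp (tendsto_vertical l))
    have hq2 := (tendsto_const_nhds (x := -q)).mul hdet
    have : -q * (D.transfer n l).det = 0 := by
      refine tendsto_nhds_unique (hq2.congr' ?_) hlim
      filter_upwards [(tendsto_vertical l).eventually h.1] with ε hε
      set w : ℂ := l + ε * Complex.I with hw
      have h1 : (D.V n).toEuclideanLin u - w • u =
          q • D.Υ n + (-(ε * Complex.I)) • u := by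
        rw [← hu, hw]; module
      have h2 := shellRes_apply_sub (D.det_ne_zero_of_green n hε) u
      rw [h1, map_add, map_smul, map_smul] at h2
      have h3 := congrArg (fun v => inner ℂ (D.Φ n) v) h2
      simp only [inner_add_right, inner_smul_right, hy] at h3
      have hγ : inner ℂ (D.Φ n) (D.shellRes n w (D.Υ n)) = D.gamma n w := rfl
      have hg : D.green n w (D.Φ n) u = inner ℂ (D.Φ n) (D.shellRes n w u) := rfl
      rw [hγ, ← hg] at h3
      have h4 : D.rawTransfer n w 0 0 = (D.a n : ℂ)⁻¹ * (D.beta n w)⁻¹ := by simp [rawTransfer]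
      rw [h4, det_rawTransfer hε]
      field_simp
      linear_combination -h3
    have hd : (D.transfer n l).det ≠ 0 := by
      rw [← norm_ne_zero_iff, norm_det_transfer h]; exact one_ne_zero
    exact hq (neg_eq_zero.1 ((mul_eq_zero.1 this).resolve_right hd))
  refine ⟨hq, ?_⟩
  rw [hq, zero_smul] at hu
  exact (inner_eq_zero_iff_of_mem_shellKer h (mem_shellKer.2 hu)).2 hy

theorem self_mem_cyclic (x : EuclideanSpace ℂ (S n)) : x ∈ D.cyclic n x :=
  Submodule.mem_sInf.2 fun _ hp => hp.1

theorem V_mem_cyclic {x y : EuclideanSpace ℂ (S n)} (hy : y ∈ D.cyclic n x) :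
    (D.V n).toEuclideanLin y ∈ D.cyclic n x :=
  Submodule.mem_sInf.2 fun p hp => hp.2 y (Submodule.mem_sInf.1 hy p hp)

/-- The orthogonal complement of an eigenvector is invariant under `Vₙ`. -/
theorem cyclic_le_orthogonal {l : ℝ} {u x : EuclideanSpace ℂ (S n)} (hu : u ∈ D.shellKer n l)
    (hx : inner ℂ x u = 0) : D.cyclic n x ≤ (Submodule.span ℂ {u})ᗮ := by
  refine sInf_le ⟨?_, fun y hy => ?_⟩
  · rw [Submodule.mem_orthogonal_singleton_iff_inner_left]; exact hx
  · rw [Submodule.mem_orthogonal_singleton_iff_inner_left] at hy ⊢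
    rw [inner_V_left, sub_eq_zero.1 (mem_shellKer.1 hu), inner_smul_right, hy, mul_zero]

/-- An eigenvector of `Vₙ` orthogonal to the channel vectors is orthogonal to `𝕍ₙ`. -/
theorem eq_zero_of_mem_VV {l : ℝ} {u : EuclideanSpace ℂ (S n)} (hu : u ∈ D.shellKer n l)
    (hx : inner ℂ (D.Υ n) u = 0) (hy : inner ℂ (D.Φ n) u = 0) (hm : u ∈ D.VV n) : u = 0 := by
  have h := sup_le (cyclic_le_orthogonal hu hx) (cyclic_le_orthogonal hu hy) hm
  rw [Submodule.mem_orthogonal_singleton_iff_inner_left] at h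
  exact inner_self_eq_zero.1 h

end Data


/-! ### The one-channel operator and its resolvent -/

section DenseRange

variable {E : Type*} [NormedAddCommGroup E] [InnerProductSpace ℂ E]

/-- Orthogonality to the range of `A - z` passes to the closure of `A`. -/
theorem orthogonal_closure_graph {A : E →ₗ.[ℂ] E} (hc : A.IsClosable) {z : ℂ} {w : E}
    (hw : ∀ x : A.domain, inner ℂ (A x - z • (x : E)) w = 0) :
    ∀ p ∈ A.closure.graph, inner ℂ (p.2 - z • p.1) w = 0 := by
  rw [← hc.graph_closure_eq_closure_graph]
  have hcl : IsClosed {p : E × E | inner ℂ (p.2 - z • p.1) w = 0} :=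
    isClosed_eq (by fun_prop) continuous_const
  refine fun p hp => closure_minimal ?_ hcl hp
  rintro ⟨_, _⟩ hq
  obtain ⟨x, rfl, rfl⟩ := (LinearPMap.mem_graph_iff _).1 hq
  exact hw x

theorem dense_range_of_forall [CompleteSpace E] {A : E →ₗ.[ℂ] E} {z : ℂ}
    (h : ∀ w : E, (∀ x : A.domain, inner ℂ (A x - z • (x : E)) w = 0) → w = 0) :
    Dense (Set.range fun x : A.domain => A x - z • (x : E)) := by
  let L : A.domain →ₗ[ℂ] E := A.toFun - z • A.domain.subtype
  have hL : (Set.range fun x : A.domain => A x - z • (x : E)) = (LinearMap.range L : Set E) := by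
    ext y; simp [L]
  rw [hL, Submodule.dense_iff_topologicalClosure_eq_top,
    Submodule.topologicalClosure_eq_top_iff, Submodule.eq_bot_iff]
  intro w hw
  refine h w fun x => ?_
  exact (Submodule.mem_orthogonal _ _).1 hw _ ⟨x, rfl⟩

/-- A vector orthogonal to the range of `A - z` is an eigenvector of the adjoint, which is the
closure of `A` and symmetric, with the non-real eigenvalue `z̄`. -/
theorem dense_range_of_isSelfAdjoint [CompleteSpace E] {A : E →ₗ.[ℂ] E} (hc : A.IsClosable)
    (hsa : IsSelfAdjoint A.closure) {z : ℂ} (hz : z.im ≠ 0) :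
    Dense (Set.range fun x : A.domain => A x - z • (x : E)) := by
  refine dense_range_of_forall fun w hw => ?_
  have h1 := orthogonal_closure_graph hc hw
  have h2 : ∀ x : A.closure.domain,
      inner ℂ (starRingEnd ℂ z • w) (x : E) = inner ℂ w (A.closure x) := by
    intro x
    have h3 := h1 _ (LinearPMap.mem_graph _ x)
    rw [inner_sub_left, inner_smul_left, sub_eq_zero] at h3
    have h4 := congrArg (starRingEnd ℂ) h3
    rw [map_mul, inner_conj_symm, inner_conj_symm] at h4
    rw [inner_smul_left, h4]
  have hmem : w ∈ A.closure.adjoint.domain := LinearPMap.mem_adjoint_domain_of_exists w ⟨_, h2⟩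
  have hap := LinearPMap.adjoint_apply_eq hsa.dense_domain ⟨w, hmem⟩ h2
  have hg : (w, starRingEnd ℂ z • w) ∈ A.closure.graph := by
    rw [← (LinearPMap.isSelfAdjoint_def.1 hsa)]
    exact (LinearPMap.mem_graph_iff _).2 ⟨⟨w, hmem⟩, rfl, hap⟩
  have h5 := h1 _ hg
  rw [← sub_smul, inner_smul_left, mul_eq_zero, inner_self_eq_zero] at h5
  refine h5.resolve_left fun h6 => ?_
  rw [map_eq_zero, sub_eq_zero, Complex.conj_eq_iff_im] at h6
  exact hz h6

theorem IsResolvent.eq_zero_of_orthogonal {A : E →ₗ.[ℂ] E} {R : ℂ → E →L[ℂ] E}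
    (h : IsResolvent A.closure R) (hc : A.IsClosable) {z : ℂ} (hz : z.im ≠ 0) {w : E}
    (hw : ∀ x : A.domain, inner ℂ (A x - z • (x : E)) w = 0) : w = 0 := by
  have := orthogonal_closure_graph hc hw _ (h.mem_graph z hz w)
  simpa using this

theorem IsResolvent.inner_sub_apply {A : E →ₗ.[ℂ] E} {R : ℂ → E →L[ℂ] E}
    (h : IsResolvent A.closure R) {z : ℂ} (hz : z.im ≠ 0) (x : A.domain) (ψ : E) :
    inner ℂ (A x - starRingEnd ℂ z • (x : E)) (R z ψ) = inner ℂ (x : E) ψ := by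
  have h1 : ((x : E), A x) ∈ A.closure.graph :=
    LinearPMap.le_graph_of_le A.le_closure (LinearPMap.mem_graph _ x)
  have h2 := h.symm _ h1 _ (h.mem_graph z hz ψ)
  rw [inner_sub_left, h2, inner_add_right, inner_smul_right, inner_smul_left, Complex.conj_conj]
  ring

end DenseRange

section Extension

variable {S : ℤ → Type*} [∀ n, Fintype (S n)] {J : Set ℤ}

/-- The extension by `0` of an element of `ℓ²(⨆_{n ∈ J} Sₙ)`. -/
def ext0 (Ψ : L2 S J) (n : ℤ) : EuclideanSpace ℂ (S n) := zeroExt J (fun k => Ψ k) n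

theorem ext0_of_mem (Ψ : L2 S J) {n : ℤ} (h : n ∈ J) : ext0 Ψ n = Ψ ⟨n, h⟩ := by
  simp [ext0, zeroExt, h]

theorem ext0_coe (Ψ : L2 S J) (n : J) : ext0 Ψ n = Ψ n := ext0_of_mem Ψ n.2

theorem ext0_of_notMem (Ψ : L2 S J) {n : ℤ} (h : n ∉ J) : ext0 Ψ n = 0 := by
  simp [ext0, zeroExt, h]

theorem ext0_add (Ψ Χ : L2 S J) (n : ℤ) : ext0 (Ψ + Χ) n = ext0 Ψ n + ext0 Χ n :=
  zeroExt_add J _ _ n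

theorem ext0_smul (c : ℂ) (Ψ : L2 S J) (n : ℤ) : ext0 (c • Ψ) n = c • ext0 Ψ n :=
  zeroExt_smul J c _ n

theorem norm_ext0_le (Ψ : L2 S J) (n : ℤ) : ‖ext0 Ψ n‖ ≤ ‖Ψ‖ := by
  by_cases h : n ∈ J
  · rw [ext0_of_mem Ψ h]; exact lp.norm_apply_le_norm (by simp) Ψ _
  · rw [ext0_of_notMem Ψ h, norm_zero]; exact norm_nonneg _

variable (S J) in
/-- The `n`-th component as a continuous linear map, also for `n ∉ J`. -/
def ext0CLM (n : ℤ) : L2 S J →L[ℂ] EuclideanSpace ℂ (S n) :=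
  LinearMap.mkContinuous
    { toFun := fun Ψ => ext0 Ψ n
      map_add' := fun x y => ext0_add x y n
      map_smul' := fun c x => ext0_smul c x n } 1 fun Ψ => by
    rw [one_mul]; exact norm_ext0_le Ψ n

theorem ext0CLM_apply (n : ℤ) (Ψ : L2 S J) : ext0CLM S J n Ψ = ext0 Ψ n := rfl

theorem continuous_ext0 (n : ℤ) : Continuous fun Ψ : L2 S J => ext0 Ψ n :=
  (ext0CLM S J n).continuous

theorem inner_eq_tsum_ext0 (Ψ Χ : L2 S J) :
    inner ℂ Ψ Χ = ∑' n : ℤ, inner ℂ (ext0 Ψ n) (ext0 Χ n) := by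
  rw [lp.inner_eq_tsum, ← tsum_subtype_eq_of_support_subset (s := J)]
  · exact tsum_congr fun n => by rw [ext0_coe, ext0_coe]
  · intro n hn
    by_contra h
    exact hn (by simp [ext0_of_notMem Ψ h])

theorem ext0_injective {Ψ Χ : L2 S J} (h : ∀ n, ext0 Ψ n = ext0 Χ n) : Ψ = Χ := by
  ext1
  funext n
  have := h n
  rwa [ext0_coe, ext0_coe] at this

/-- The vector with component `x` at the shell `n` and `0` elsewhere. -/
def sgl (n : J) (x : EuclideanSpace ℂ (S n)) : L2 S J := open Classical in lp.single 2 n x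

theorem sgl_apply_self (n : J) (x : EuclideanSpace ℂ (S n)) : sgl n x n = x := by
  classical simp [sgl]

theorem sgl_apply_ne {n m : J} (x : EuclideanSpace ℂ (S n)) (h : m ≠ n) : sgl n x m = 0 := by
  classical simp [sgl, h]

theorem ext0_sgl_self (n : J) (x : EuclideanSpace ℂ (S n)) : ext0 (sgl n x) n = x := by
  rw [ext0_coe, sgl_apply_self]

theorem ext0_sgl_ne {n : J} {m : ℤ} (x : EuclideanSpace ℂ (S n)) (h : m ≠ n) :
    ext0 (sgl n x) m = 0 := by
  by_cases hm : m ∈ J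
  · rw [ext0_of_mem _ hm]
    exact sgl_apply_ne x fun h' => h (congrArg Subtype.val h')
  · exact ext0_of_notMem _ hm

theorem inner_sgl_left (n : J) (x : EuclideanSpace ℂ (S n)) (Ψ : L2 S J) :
    inner ℂ (sgl n x) Ψ = inner ℂ x (ext0 Ψ n) := by
  classical
  rw [sgl, lp.inner_single_left, ext0_coe]

/-- The element of `ℓ²(𝔾)` with the same components, for an element of `ℓ²(𝔾⁺)`. -/
def toFull (Ψ : L2 S J) : L2 S Set.univ :=
  ⟨fun n => ext0 Ψ n, by
    have h1 : Summable fun n : J => ‖ext0 Ψ n‖ ^ (2 : ℝ) := by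
      have := (lp.memℓp Ψ).summable (by norm_num)
      refine this.congr fun n => ?_
      rw [ext0_coe]; norm_num
    have h2 : Summable fun n : ℤ => ‖ext0 Ψ n‖ ^ (2 : ℝ) := by
      rw [← Function.Injective.summable_iff (f := fun n : ℤ => ‖ext0 Ψ n‖ ^ (2 : ℝ))
        (Subtype.val_injective (p := fun n => n ∈ J))]
      · exact h1
      · intro n hn
        have : n ∉ J := by simpa using hn
        rw [ext0_of_notMem Ψ this, norm_zero]
        norm_num
    refine memℓp_gen ?_
    rw [ENNReal.toReal_ofNat]
    exact h2.comp_injective (Subtype.val_injective (p := fun n => n ∈ (Set.univ : Set ℤ)))⟩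

theorem ext0_toFull (Ψ : L2 S J) (n : ℤ) : ext0 (toFull Ψ) n = ext0 Ψ n := by
  rw [ext0_of_mem _ (Set.mem_univ n)]; rfl

theorem isClosed_blockSubmodule (K : ∀ n, Submodule ℂ (EuclideanSpace ℂ (S n))) :
    IsClosed (blockSubmodule J K : Set (L2 S J)) := by
  have : (blockSubmodule J K : Set (L2 S J)) = ⋂ n : J, {Ψ | ext0 Ψ n ∈ K n} := by
    ext Ψ
    simp only [Set.mem_iInter, Set.mem_ofPred_eq, ext0_coe]
    rfl
  rw [this]
  exact isClosed_iInter fun n => (Submodule.closed_of_finiteDimensional (K n)).preimage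
    (continuous_ext0 _)

end Extension

namespace Data

variable {S : ℤ → Type*} [∀ n, Fintype (S n)] [∀ n, DecidableEq (S n)] (D : Data S) {J : Set ℤ}

theorem mem_domain_iff {Ψ : L2 S J} : Ψ ∈ (D.Hmin J).domain ↔ {n : J | Ψ n ≠ 0}.Finite := Iff.rfl

theorem Hmin_apply (Ψ : (D.Hmin J).domain) (n : J) :
    (D.Hmin J Ψ) n = D.formal (ext0 (Ψ : L2 S J)) n := rfl

theorem finite_ext0_ne {Ψ : L2 S J} (h : Ψ ∈ (D.Hmin J).domain) :
    {n : ℤ | ext0 Ψ n ≠ 0}.Finite := by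
  refine (((D.mem_domain_iff).1 h).image Subtype.val).subset fun n hn => ?_
  by_cases hJ : n ∈ J
  · exact ⟨⟨n, hJ⟩, by rw [Set.mem_ofPred_eq, ext0_of_mem Ψ hJ] at hn; exact hn, rfl⟩
  · exact absurd (ext0_of_notMem Ψ hJ) hn

theorem sgl_mem_domain (n : J) (x : EuclideanSpace ℂ (S n)) : sgl n x ∈ (D.Hmin J).domain := by
  refine (D.mem_domain_iff).2 ((Set.finite_singleton n).subset fun m hm => ?_)
  by_contra h
  exact hm (sgl_apply_ne x h)

theorem dense_domain : Dense ((D.Hmin J).domain : Set (L2 S J)) := by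
  classical
  intro Ψ
  have h := lp.hasSum_single (p := 2) (by norm_num) Ψ
  refine mem_closure_of_tendsto h (Eventually.of_forall fun s => ?_)
  exact Submodule.sum_mem _ fun n _ => D.sgl_mem_domain n (Ψ n)

theorem inner_formal_left (f g : ∀ n, EuclideanSpace ℂ (S n)) (n : ℤ) :
    inner ℂ (D.formal f n) (g n) =
      -(D.a (n + 1) * inner ℂ (f (n + 1)) (D.Υ (n + 1)) * inner ℂ (D.Φ n) (g n))
        - D.a n * inner ℂ (f (n - 1)) (D.Φ (n - 1)) * inner ℂ (D.Υ n) (g n)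
        + inner ℂ (f n) ((D.V n).toEuclideanLin (g n)) := by
  simp only [formal, inner_add_left, inner_sub_left, inner_smul_left, map_neg, map_mul,
    Complex.conj_ofReal, inner_conj_symm, inner_V_left]
  ring

theorem inner_formal_right (f g : ∀ n, EuclideanSpace ℂ (S n)) (n : ℤ) :
    inner ℂ (f n) (D.formal g n) =
      -(D.a (n + 1) * inner ℂ (f n) (D.Φ n) * inner ℂ (D.Υ (n + 1)) (g (n + 1)))
        - D.a n * inner ℂ (f n) (D.Υ n) * inner ℂ (D.Φ (n - 1)) (g (n - 1))
        + inner ℂ (f n) ((D.V n).toEuclideanLin (g n)) := by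
  simp only [formal, inner_add_right, inner_sub_right, inner_smul_right]
  ring

/-- The formal operator is symmetric, by a shift of the summation index in the hopping terms. -/
theorem tsum_inner_formal {f : ∀ n, EuclideanSpace ℂ (S n)} (hf : {n | f n ≠ 0}.Finite)
    (g : ∀ n, EuclideanSpace ℂ (S n)) :
    ∑' n, inner ℂ (D.formal f n) (g n) = ∑' n, inner ℂ (f n) (D.formal g n) := by
  obtain ⟨c, hcd⟩ : ∃ c : ℤ → ℂ, c = fun n =>
    D.a n * inner ℂ (f n) (D.Υ n) * inner ℂ (D.Φ (n - 1)) (g (n - 1)) := ⟨_, rfl⟩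
  obtain ⟨d, hdd⟩ : ∃ d : ℤ → ℂ, d = fun n =>
    D.a n * inner ℂ (f (n - 1)) (D.Φ (n - 1)) * inner ℂ (D.Υ n) (g n) := ⟨_, rfl⟩
  obtain ⟨e, hed⟩ : ∃ e : ℤ → ℂ, e = fun n =>
    inner ℂ (f n) ((D.V n).toEuclideanLin (g n)) := ⟨_, rfl⟩
  have hcs : ∀ n, c (n + 1) = D.a (n + 1) * inner ℂ (f (n + 1)) (D.Υ (n + 1)) *
      inner ℂ (D.Φ n) (g n) := by
    intro n; rw [hcd]; simp only; rw [add_sub_cancel_right]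
  have hds : ∀ n, d (n + 1) = D.a (n + 1) * inner ℂ (f n) (D.Φ n) *
      inner ℂ (D.Υ (n + 1)) (g (n + 1)) := by
    intro n; rw [hdd]; simp only; rw [add_sub_cancel_right]
  have h1 : ∀ n, inner ℂ (D.formal f n) (g n) = -c (n + 1) - d n + e n := by
    intro n
    rw [inner_formal_left, hcs, hdd, hed]
  have h2 : ∀ n, inner ℂ (f n) (D.formal g n) = -d (n + 1) - c n + e n := by
    intro n
    rw [inner_formal_right, hds, hcd, hed]
  have hsum : ∀ k : ℤ → ℂ, (∀ n, f n = 0 → k n = 0) → Summable k := fun k hk =>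
    summable_of_hasFiniteSupport (hf.subset fun n hn h0 => hn (hk n h0))
  have hc : Summable c := hsum c fun n h => by simp [hcd, h]
  have he : Summable e := hsum e fun n h => by simp [hed, h]
  have hd1 : Summable fun n => d (n + 1) := hsum _ fun n h => by simp [hds, h]
  have hd : Summable d := (Equiv.addRight (1 : ℤ)).summable_iff.1 hd1
  have hc1 : Summable fun n => c (n + 1) := (Equiv.addRight (1 : ℤ)).summable_iff.2 hc
  have tc : ∑' n, c (n + 1) = ∑' n, c n := (Equiv.addRight (1 : ℤ)).tsum_eq c
  have td : ∑' n, d (n + 1) = ∑' n, d n := (Equiv.addRight (1 : ℤ)).tsum_eq d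
  clear hcs hds hsum hcd hdd hed
  rw [tsum_congr h1, tsum_congr h2]
  rw [(hc1.neg.sub hd).tsum_add he, (hd1.neg.sub hc).tsum_add he, hc1.neg.tsum_sub hd,
    hd1.neg.tsum_sub hc, tsum_neg, tsum_neg, tc, td]
  ring

theorem inner_Hmin_left (φ : (D.Hmin J).domain) (Ψ : L2 S J) :
    inner ℂ (D.Hmin J φ) Ψ = ∑' n : ℤ, inner ℂ (D.formal (ext0 (φ : L2 S J)) n) (ext0 Ψ n) := by
  rw [inner_eq_tsum_ext0]
  refine tsum_congr fun n => ?_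
  by_cases h : n ∈ J
  · rw [ext0_of_mem (D.Hmin J φ) h, Hmin_apply]
  · rw [ext0_of_notMem Ψ h, inner_zero_right, inner_zero_right]

theorem Hmin_symm (φ χ : (D.Hmin J).domain) :
    inner ℂ (D.Hmin J φ) (χ : L2 S J) = inner ℂ (φ : L2 S J) (D.Hmin J χ) := by
  rw [inner_Hmin_left, tsum_inner_formal D (D.finite_ext0_ne φ.2), inner_eq_tsum_ext0]
  refine tsum_congr fun n => ?_
  by_cases h : n ∈ J
  · rw [ext0_of_mem (D.Hmin J χ) h, Hmin_apply]
  · rw [ext0_of_notMem (φ : L2 S J) h, inner_zero_left, inner_zero_left]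

theorem isClosable_Hmin : (D.Hmin J).IsClosable := isClosable_of_symm D.dense_domain D.Hmin_symm

theorem exists_isResolvent_full (h : D.UniquelySelfAdjoint Set.univ) :
    ∃ R, IsResolvent (D.H Set.univ) R :=
  exists_isResolvent D.dense_domain D.Hmin_symm fun _ hz =>
    dense_range_of_isSelfAdjoint D.isClosable_Hmin h hz

/-- The operator on the half space inherits essential self-adjointness: a deficiency vector `w` of
`H⁺`, extended by `0`, satisfies `(H - z̄) w = c Φ₀`, and `w` is orthogonal to `Φ₀`. -/
theorem exists_isResolvent_half (h : D.UniquelySelfAdjoint Set.univ) :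
    ∃ R, IsResolvent (D.H (Set.Ici 1)) R := by
  obtain ⟨R, hR⟩ := D.exists_isResolvent_full h
  refine exists_isResolvent D.dense_domain D.Hmin_symm fun z hz =>
    dense_range_of_forall fun w hw => ?_
  let o : (Set.univ : Set ℤ) := ⟨0, Set.mem_univ _⟩
  let k : ℂ := -(D.a 1 * inner ℂ (D.Υ 1) (ext0 w 1))
  let ξ : L2 S Set.univ := k • sgl o (D.Φ 0)
  have hz' : (starRingEnd ℂ z).im ≠ 0 := by simpa using hz
  -- cutting a test vector `φ` at the origin changes the formal operator on the shells `n ≥ 1`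
  -- only by the hopping term from the shell `0` to the shell `1`
  have key : ∀ φ : (D.Hmin (J := Set.univ)).domain,
      inner ℂ (D.Hmin _ φ - z • (φ : L2 S Set.univ)) (toFull w) =
        inner ℂ (φ : L2 S Set.univ) ξ := by
    intro φ
    let φp : L2 S (Set.Ici (1 : ℤ)) := ⟨fun n => ext0 (φ : L2 S Set.univ) n, by
      refine (memℓp_zero ?_).of_exponent_ge zero_le
      exact (D.finite_ext0_ne φ.2).preimage Subtype.val_injective.injOn⟩
    have hφp : φp ∈ (D.Hmin (Set.Ici 1)).domain :=
      (D.finite_ext0_ne φ.2).preimage Subtype.val_injective.injOn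
    have hge : ∀ n : ℤ, 1 ≤ n → ext0 φp n = ext0 (φ : L2 S Set.univ) n := by
      intro n hn
      rw [ext0_of_mem φp (show n ∈ Set.Ici (1 : ℤ) from hn)]
    have h0 := hw ⟨φp, hφp⟩
    rw [inner_sub_left, inner_smul_left, inner_Hmin_left, inner_eq_tsum_ext0] at h0
    rw [inner_sub_left, inner_smul_left, inner_Hmin_left, inner_eq_tsum_ext0]
    simp only [ext0_toFull]
    have e2 : ∑' n : ℤ, inner ℂ (ext0 (φ : L2 S Set.univ) n) (ext0 w n) =
        ∑' n : ℤ, inner ℂ (ext0 φp n) (ext0 w n) := by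
      refine tsum_congr fun n => ?_
      by_cases hn : 1 ≤ n
      · rw [hge n hn]
      · rw [ext0_of_notMem w (show n ∉ Set.Ici (1 : ℤ) from hn), inner_zero_right, inner_zero_right]
    have e1 : ∑' n : ℤ, inner ℂ (D.formal (ext0 (φ : L2 S Set.univ)) n) (ext0 w n) =
        ∑' n : ℤ, inner ℂ (D.formal (ext0 φp) n) (ext0 w n) +
          inner ℂ (φ : L2 S Set.univ) ξ := by
      have hs : Summable fun n : ℤ => inner ℂ (D.formal (ext0 φp) n) (ext0 w n) := by
        have hfin := D.finite_formal (Set.Ici 1) (fun n => φp n) hφp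
        refine summable_of_hasFiniteSupport ((hfin.image Subtype.val).subset fun n hn => ?_)
        by_cases hJ : n ∈ Set.Ici (1 : ℤ)
        · refine ⟨⟨n, hJ⟩, fun h0 => hn ?_, rfl⟩
          have h0' : D.formal (ext0 φp) n = 0 := h0
          simp [h0']
        · exact absurd (by simp [ext0_of_notMem w hJ]) hn
      have hone : ∀ n : ℤ, inner ℂ (D.formal (ext0 (φ : L2 S Set.univ)) n) (ext0 w n) =
          inner ℂ (D.formal (ext0 φp) n) (ext0 w n) +
            if n = 1 then inner ℂ (φ : L2 S Set.univ) ξ else 0 := by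
        intro n
        by_cases hn : 1 ≤ n
        · by_cases hn1 : n = 1
          · subst hn1
            have e0 : ext0 φp (1 - 1) = 0 := ext0_of_notMem _ (by simp)
            have hin : inner ℂ (φ : L2 S Set.univ) ξ =
                k * inner ℂ (ext0 (φ : L2 S Set.univ) 0) (D.Φ 0) := by
              rw [inner_smul_right, ← inner_conj_symm, inner_sgl_left, inner_conj_symm]
            rw [if_pos rfl, hin]
            simp only [formal, hge 1 le_rfl, hge (1 + 1) (by norm_num), e0, inner_zero_right,
              mul_zero, zero_smul, sub_zero, inner_add_left, inner_sub_left, inner_smul_left,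
              map_mul, Complex.conj_ofReal, inner_conj_symm, k]
            have e3 : ∀ m : ℤ, m = 0 → inner ℂ (ext0 (φ : L2 S Set.univ) m) (D.Φ m) =
                inner ℂ (ext0 (φ : L2 S Set.univ) 0) (D.Φ 0) := by rintro m rfl; rfl
            rw [e3 (1 - 1) (by norm_num)]
            ring
          · rw [if_neg hn1, add_zero]
            have hn2 : 1 ≤ n - 1 := by omega
            simp only [formal, hge n hn, hge (n + 1) (by omega), hge (n - 1) hn2]
        · rw [ext0_of_notMem w (show n ∉ Set.Ici (1 : ℤ) from hn), inner_zero_right,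
            inner_zero_right, if_neg (by omega), add_zero]
      simp_rw [hone]
      rw [hs.tsum_add (summable_of_hasFiniteSupport ((Set.finite_singleton (1 : ℤ)).subset
        fun n hn => by
          by_contra h1
          exact hn (if_neg h1))), tsum_ite_eq]
    rw [e1, e2]
    linear_combination h0
  have hu : toFull w = R (starRingEnd ℂ z) ξ := by
    rw [← sub_eq_zero]
    refine hR.eq_zero_of_orthogonal D.isClosable_Hmin hz fun φ => ?_
    have h1 := hR.inner_sub_apply hz' φ ξ
    rw [Complex.conj_conj] at h1
    rw [inner_sub_right, key, h1, sub_self]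
  have hzero : inner ℂ ξ (R (starRingEnd ℂ z) ξ) = 0 := by
    rw [← hu, inner_smul_left, inner_sgl_left, ext0_toFull,
      ext0_of_notMem w (show (o : ℤ) ∉ Set.Ici (1 : ℤ) by simp [o]), inner_zero_right, mul_zero]
  have him := hR.im_inner hz' ξ
  rw [hzero, Complex.zero_im, ← hu] at him
  have hnorm : ‖toFull w‖ = 0 := by
    have := (mul_eq_zero.1 him.symm).resolve_left hz'
    simpa using this
  refine ext0_injective fun n => ?_
  rw [← ext0_toFull, norm_eq_zero.1 hnorm, ← ext0CLM_apply, ← ext0CLM_apply, map_zero, map_zero]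

variable {D}

variable (D) in
theorem continuous_formal_ext0 (n : ℤ) : Continuous fun Ψ : L2 S J => D.formal (ext0 Ψ) n := by
  have hV : Continuous (D.V n).toEuclideanLin := LinearMap.continuous_of_finiteDimensional _
  have h3 : Continuous fun Ψ : L2 S J => (D.V n).toEuclideanLin (ext0 Ψ n) :=
    hV.comp (continuous_ext0 n)
  have h1 : Continuous fun Ψ : L2 S J => inner ℂ (D.Υ (n + 1)) (ext0 Ψ (n + 1)) :=
    continuous_const.inner (continuous_ext0 (n + 1))
  have h2 : Continuous fun Ψ : L2 S J => inner ℂ (D.Φ (n - 1)) (ext0 Ψ (n - 1)) :=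
    continuous_const.inner (continuous_ext0 (n - 1))
  exact (((continuous_const.mul h1).neg.smul continuous_const).sub
    ((continuous_const.mul h2).smul continuous_const)).add h3

/-- The closure acts by the formal expression, which involves finitely many components at a time. -/
theorem graph_H_apply {p : L2 S J × L2 S J} (hp : p ∈ (D.H J).graph) (n : ℤ) (hn : n ∈ J) :
    ext0 p.2 n = D.formal (ext0 p.1) n := by
  have hcl : IsClosed {p : L2 S J × L2 S J | ext0 p.2 n = D.formal (ext0 p.1) n} :=
    isClosed_eq ((continuous_ext0 n).comp continuous_snd)
      ((D.continuous_formal_ext0 n).comp continuous_fst)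
  have hg : (D.H J).graph = (D.Hmin J).graph.topologicalClosure :=
    (D.isClosable_Hmin.graph_closure_eq_closure_graph).symm
  rw [hg] at hp
  refine closure_minimal ?_ hcl hp
  rintro ⟨_, _⟩ hq
  obtain ⟨x, rfl, rfl⟩ := (LinearPMap.mem_graph_iff _).1 hq
  show ext0 (D.Hmin J x) n = _
  rw [ext0_of_mem _ hn, Hmin_apply]

theorem resolvent_component {R : ℂ → L2 S J →L[ℂ] L2 S J} (hR : IsResolvent (D.H J) R) {z : ℂ}
    (hz : z.im ≠ 0) (ψ : L2 S J) {n : ℤ} (hn : n ∈ J) :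
    D.formal (ext0 (R z ψ)) n = ext0 ψ n + z • ext0 (R z ψ) n := by
  have := graph_H_apply (hR.mem_graph z hz ψ) n hn
  rw [← this, ext0_add, ext0_smul]

variable (D J) in
/-- The blocks `Kₙ` reduce the operator: they are invariant under `Vₙ` and contain the channel
vectors through which shells in `J` are coupled. -/
structure Reduces (K : ∀ n, Submodule ℂ (EuclideanSpace ℂ (S n))) : Prop where
  V_mem : ∀ n ∈ J, ∀ y ∈ K n, (D.V n).toEuclideanLin y ∈ K n
  Φ_mem : ∀ n ∈ J, n + 1 ∈ J → D.Φ n ∈ K n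
  Υ_mem : ∀ n ∈ J, n - 1 ∈ J → D.Υ n ∈ K n

theorem V_mem_VV {n : ℤ} {y : EuclideanSpace ℂ (S n)} (hy : y ∈ D.VV n) :
    (D.V n).toEuclideanLin y ∈ D.VV n := by
  obtain ⟨u, hu, v, hv, rfl⟩ := Submodule.mem_sup.1 hy
  rw [map_add]
  exact Submodule.add_mem_sup (V_mem_cyclic hu) (V_mem_cyclic hv)

variable (D) in
theorem reduces_full : D.Reduces Set.univ D.VV where
  V_mem _ _ _ hy := V_mem_VV hy
  Φ_mem n _ _ := Submodule.mem_sup_right (self_mem_cyclic (D.Φ n))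
  Υ_mem n _ _ := Submodule.mem_sup_left (self_mem_cyclic (D.Υ n))

variable (D) in
theorem reduces_half :
    D.Reduces (Set.Ici 1) fun n => if n = 1 then D.cyclic n (D.Φ n) else D.VV n where
  V_mem n _ y hy := by
    by_cases h : n = 1
    · rw [if_pos h] at hy ⊢; exact V_mem_cyclic hy
    · rw [if_neg h] at hy ⊢; exact V_mem_VV hy
  Φ_mem n _ _ := by
    by_cases h : n = 1
    · rw [if_pos h]; exact self_mem_cyclic (D.Φ n)
    · rw [if_neg h]; exact Submodule.mem_sup_right (self_mem_cyclic (D.Φ n))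
  Υ_mem n _ hn' := by
    have h : n ≠ 1 := by
      rintro rfl
      simp at hn'
    rw [if_neg h]
    exact Submodule.mem_sup_left (self_mem_cyclic (D.Υ n))

/-- The projections to the blocks map the core to itself and commute with the operator there. Hence
the component of `R z ψ` orthogonal to the blocks is orthogonal to the range of `H - z̄`. -/
theorem resolvent_mem_blockSubmodule {K : ∀ n, Submodule ℂ (EuclideanSpace ℂ (S n))}
    (hK : D.Reduces J K) {R : ℂ → L2 S J →L[ℂ] L2 S J} (hR : IsResolvent (D.H J) R) {z : ℂ}
    (hz : z.im ≠ 0) {ψ : L2 S J} (hψ : ψ ∈ blockSubmodule J K) :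
    R z ψ ∈ blockSubmodule J K := by
  have hcomp : CompleteSpace (blockSubmodule J K) :=
    (isClosed_blockSubmodule K).completeSpace_coe
  set B := blockSubmodule J K with hB
  set u := R z ψ with hu
  have hw : u - B.starProjection u ∈ Bᗮ := Submodule.sub_starProjection_mem_orthogonal u
  suffices h0 : u - B.starProjection u = 0 by
    rw [sub_eq_zero.1 h0]
    exact Submodule.starProjection_apply_mem _ _
  have hz' : (starRingEnd ℂ z).im ≠ 0 := by simpa using hz
  refine hR.eq_zero_of_orthogonal D.isClosable_Hmin hz' fun φ => ?_
  let φ1 : L2 S J := ⟨fun n => (K n).starProjection (ext0 (φ : L2 S J) n), by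
    refine (memℓp_zero (Set.Finite.subset φ.2 fun n hn h0 => hn ?_)).of_exponent_ge zero_le
    rw [ext0_coe, h0, map_zero]⟩
  have hφ1d : φ1 ∈ (D.Hmin J).domain := by
    refine Set.Finite.subset φ.2 fun n hn h0 => hn ?_
    show (K n).starProjection (ext0 (φ : L2 S J) n) = 0
    rw [ext0_coe, h0, map_zero]
  have hφ1 : ∀ n, ext0 φ1 n ∈ K n := by
    intro n
    by_cases hn : n ∈ J
    · rw [ext0_of_mem φ1 hn]
      exact Submodule.starProjection_apply_mem _ _
    · rw [ext0_of_notMem φ1 hn]; exact (K n).zero_mem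
  let p1 : (D.Hmin J).domain := ⟨φ1, hφ1d⟩
  let p2 : (D.Hmin J).domain := φ - p1
  have hφ2 : ∀ n, ext0 (p2 : L2 S J) n ∈ (K n)ᗮ := by
    intro n
    by_cases hn : n ∈ J
    · rw [ext0_of_mem _ hn]
      have : (p2 : L2 S J) ⟨n, hn⟩ = (φ : L2 S J) ⟨n, hn⟩ -
          (K n).starProjection (ext0 (φ : L2 S J) n) := rfl
      rw [this, ext0_of_mem _ hn]
      exact Submodule.sub_starProjection_mem_orthogonal _
    · rw [ext0_of_notMem _ hn]; exact (K n)ᗮ.zero_mem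
  have hsum : D.Hmin J φ - starRingEnd ℂ z • (φ : L2 S J) =
      (D.Hmin J p1 - starRingEnd ℂ z • (p1 : L2 S J)) +
        (D.Hmin J p2 - starRingEnd ℂ z • (p2 : L2 S J)) := by
    have h1 : D.Hmin J φ = D.Hmin J p1 + D.Hmin J p2 := by
      rw [← LinearPMap.map_add]; congr 1; simp [p2]
    have h2 : (φ : L2 S J) = (p1 : L2 S J) + (p2 : L2 S J) := by simp [p2]
    rw [h1]
    nth_rw 1 [h2]
    rw [smul_add]; abel
  have hH1 : D.Hmin J p1 - starRingEnd ℂ z • (p1 : L2 S J) ∈ B := by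
    refine B.sub_mem (fun n => ?_) (B.smul_mem _ fun n => ?_)
    · rw [Hmin_apply]
      have hV := hK.V_mem n n.2 _ (hφ1 n)
      refine (K n).add_mem ((K n).sub_mem ?_ ?_) hV
      · by_cases hn : (n : ℤ) + 1 ∈ J
        · exact (K n).smul_mem _ (hK.Φ_mem n n.2 hn)
        · rw [show ext0 (p1 : L2 S J) ((n : ℤ) + 1) = 0 from ext0_of_notMem _ hn, inner_zero_right,
            mul_zero, neg_zero, zero_smul]
          exact (K n).zero_mem
      · by_cases hn : (n : ℤ) - 1 ∈ J
        · exact (K n).smul_mem _ (hK.Υ_mem n n.2 hn)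
        · rw [show ext0 (p1 : L2 S J) ((n : ℤ) - 1) = 0 from ext0_of_notMem _ hn, inner_zero_right,
            mul_zero, zero_smul]
          exact (K n).zero_mem
    · rw [← ext0_coe]; exact hφ1 n
  have hform2 : ∀ n : J, D.formal (ext0 (p2 : L2 S J)) n ∈ (K n)ᗮ := by
    intro n
    have hV : (D.V n).toEuclideanLin (ext0 (p2 : L2 S J) n) ∈ (K n)ᗮ := by
      rw [Submodule.mem_orthogonal]
      intro y hy
      rw [← inner_V_left]
      exact (Submodule.mem_orthogonal _ _).1 (hφ2 n) _ (hK.V_mem n n.2 y hy)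
    have h1 : inner ℂ (D.Υ ((n : ℤ) + 1)) (ext0 (p2 : L2 S J) ((n : ℤ) + 1)) = 0 := by
      by_cases hn : (n : ℤ) + 1 ∈ J
      · exact (Submodule.mem_orthogonal _ _).1 (hφ2 _) _
          (hK.Υ_mem _ hn (by rw [add_sub_cancel_right]; exact n.2))
      · rw [ext0_of_notMem _ hn, inner_zero_right]
    have h2 : inner ℂ (D.Φ ((n : ℤ) - 1)) (ext0 (p2 : L2 S J) ((n : ℤ) - 1)) = 0 := by
      by_cases hn : (n : ℤ) - 1 ∈ J
      · exact (Submodule.mem_orthogonal _ _).1 (hφ2 _) _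
          (hK.Φ_mem _ hn (by rw [sub_add_cancel]; exact n.2))
      · rw [ext0_of_notMem _ hn, inner_zero_right]
    unfold formal
    rw [h1, h2, mul_zero, mul_zero, neg_zero, zero_smul, zero_smul, sub_zero, zero_add]
    exact hV
  have hperp : ∀ x ∈ B, ∀ y : L2 S J, (∀ n : J, ext0 y n ∈ (K n)ᗮ) → inner ℂ y x = 0 := by
    intro x hx y hy
    rw [lp.inner_eq_tsum]
    refine (tsum_congr fun n => ?_).trans tsum_zero
    rw [← ext0_coe y]
    exact (Submodule.mem_orthogonal' _ _).1 (hy n) _ (hx n)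
  have hp2perp : ∀ x ∈ B, inner ℂ (D.Hmin J p2 - starRingEnd ℂ z • (p2 : L2 S J)) x = 0 := by
    intro x hx
    refine hperp x hx _ fun n => ?_
    rw [sub_eq_add_neg, ← neg_smul, ext0_add, ext0_smul, ext0_coe, Hmin_apply]
    exact (K n)ᗮ.add_mem (hform2 n) ((K n)ᗮ.smul_mem _ (hφ2 n))
  rw [hsum, inner_add_left, (Submodule.mem_orthogonal _ _).1 hw _ hH1, zero_add, inner_sub_right,
    hp2perp _ (Submodule.starProjection_apply_mem _ _), sub_zero, hu,
    hR.inner_sub_apply hz p2 ψ]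
  exact hperp ψ hψ _ fun n => hφ2 n

/-- Spectral measures of the operator in the whole space are spectral measures of its part in a
reducing subspace. -/
theorem isSpectralMeasure_part {K : ∀ n, Submodule ℂ (EuclideanSpace ℂ (S n))}
    (hK : D.Reduces J K) {R : ℂ → L2 S J →L[ℂ] L2 S J} (hR : IsResolvent (D.H J) R)
    (ψ : blockSubmodule J K) {μ : Measure ℝ} (hμ : IsFiniteMeasure μ)
    (h : ∀ z : ℂ, z.im ≠ 0 → inner ℂ (ψ : L2 S J) (R z ψ) = ∫ x : ℝ, ((x : ℂ) - z)⁻¹ ∂μ) :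
    IsSpectralMeasure (part (D.H J) (blockSubmodule J K)) ψ μ := by
  refine ⟨hμ, fun z hz => ?_⟩
  have hgr : (part (D.H J) (blockSubmodule J K)).graph =
      (D.H J).graph.comap ((blockSubmodule J K).subtype.prodMap (blockSubmodule J K).subtype) := by
    refine Submodule.toLinearPMap_graph_eq _ fun x hx hx0 => ?_
    have h1 : ((x.1 : L2 S J), (x.2 : L2 S J)) ∈ (D.H J).graph := hx
    rw [hx0] at h1
    have := LinearPMap.graph_fst_eq_zero_snd _ h1 rfl
    exact Subtype.ext this
  have hu : R z ψ ∈ blockSubmodule J K := resolvent_mem_blockSubmodule hK hR hz ψ.2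
  have hmem : ((⟨R z ψ, hu⟩ : blockSubmodule J K),
      ψ + z • (⟨R z ψ, hu⟩ : blockSubmodule J K)) ∈
        (part (D.H J) (blockSubmodule J K)).graph := by
    rw [hgr]
    exact hR.mem_graph z hz ψ
  obtain ⟨φ, h1, h2⟩ := (LinearPMap.mem_graph_iff _).1 hmem
  refine ⟨φ, ?_, ?_⟩
  · rw [h2, h1, add_sub_cancel_right]
  · rw [h1, ← h z hz]; rfl

end Data


/-! ### Resolvents of bounded dissipative operators -/

section Dissipative

variable {E : Type*} [NormedAddCommGroup E] [InnerProductSpace ℂ E]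
  {M : E →L[ℂ] E} {z : ℂ}

/-- The resolvent `(M - z)⁻¹` of a bounded operator. -/
def boundedRes (M : E →L[ℂ] E) (z : ℂ) : E →L[ℂ] E := -resolvent M z

theorem im_inner_sub_smul (x : E) :
    (inner ℂ (M x - z • x) x).im = z.im * ‖x‖ ^ 2 - (inner ℂ x (M x)).im := by
  have h : inner ℂ x x = ((‖x‖ ^ 2 : ℝ) : ℂ) := by
    rw [inner_self_eq_norm_sq_to_K]; push_cast; rfl
  rw [inner_sub_left, inner_smul_left, ← inner_conj_symm (M x) x, h,
    Complex.sub_im, Complex.conj_im, Complex.mul_im, Complex.ofReal_im,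
    Complex.ofReal_re, Complex.conj_im]
  ring

theorem algebraMap_sub_apply (x : E) :
    (algebraMap ℂ (E →L[ℂ] E) z - M) x = z • x - M x := by
  simp [Algebra.algebraMap_eq_smul_one]

variable [CompleteSpace E]

theorem mem_resolventSet_of_dissipative (hM : ∀ x, (inner ℂ x (M x)).im ≤ 0) (hz : 0 < z.im) :
    z ∈ resolventSet ℂ M := by
  have h : IsUnit (M - algebraMap ℂ (E →L[ℂ] E) z) := by
    refine ContinuousLinearMap.isUnit_of_forall_le_norm_inner_map _ (c := ⟨z.im, hz.le⟩) hz ?_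
    intro x
    have h1 : (M - algebraMap ℂ (E →L[ℂ] E) z) x = M x - z • x := by
      simp [Algebra.algebraMap_eq_smul_one]
    rw [h1]
    refine le_trans ?_ (Complex.abs_im_le_norm _)
    rw [im_inner_sub_smul]
    refine le_trans ?_ (le_abs_self _)
    have := hM x
    show ‖x‖ ^ 2 * z.im ≤ _
    linarith [mul_comm (‖x‖ ^ 2) z.im]
  rw [spectrum.mem_resolventSet_iff, ← neg_sub]
  exact h.neg

theorem sub_boundedRes (hM : ∀ x, (inner ℂ x (M x)).im ≤ 0) (hz : 0 < z.im) (ψ : E) :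
    M (boundedRes M z ψ) - z • boundedRes M z ψ = ψ := by
  have h := Ring.mul_inverse_cancel _ (mem_resolventSet_of_dissipative hM hz)
  have h1 : (algebraMap ℂ (E →L[ℂ] E) z - M) (resolvent M z ψ) = ψ :=
    congrArg (fun L : E →L[ℂ] E => L ψ) h
  rw [algebraMap_sub_apply] at h1
  have h2 : boundedRes M z ψ = -resolvent M z ψ := rfl
  rw [h2, map_neg, smul_neg, sub_neg_eq_add, neg_add_eq_sub, h1]

theorem boundedRes_sub (hM : ∀ x, (inner ℂ x (M x)).im ≤ 0) (hz : 0 < z.im) (x : E) :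
    boundedRes M z (M x - z • x) = x := by
  have h := Ring.inverse_mul_cancel _ (mem_resolventSet_of_dissipative hM hz)
  have h1 : resolvent M z ((algebraMap ℂ (E →L[ℂ] E) z - M) x) = x :=
    congrArg (fun L : E →L[ℂ] E => L x) h
  rw [algebraMap_sub_apply] at h1
  have h2 : boundedRes M z (M x - z • x) = -resolvent M z (M x - z • x) := rfl
  rw [h2, ← map_neg, neg_sub, h1]

theorem im_inner_boundedRes (hM : ∀ x, (inner ℂ x (M x)).im ≤ 0) (hz : 0 < z.im) (ψ : E) :
    (inner ℂ ψ (boundedRes M z ψ)).im =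
      z.im * ‖boundedRes M z ψ‖ ^ 2 - (inner ℂ (boundedRes M z ψ) (M (boundedRes M z ψ))).im := by
  rw [← im_inner_sub_smul (z := z), sub_boundedRes hM hz]

theorem norm_boundedRes_le (hM : ∀ x, (inner ℂ x (M x)).im ≤ 0) (hz : 0 < z.im) (ψ : E) :
    ‖boundedRes M z ψ‖ ≤ z.im⁻¹ * ‖ψ‖ := by
  have h1 : z.im * ‖boundedRes M z ψ‖ ^ 2 ≤ ‖ψ‖ * ‖boundedRes M z ψ‖ :=
    calc z.im * ‖boundedRes M z ψ‖ ^ 2 ≤ (inner ℂ ψ (boundedRes M z ψ)).im := by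
          rw [im_inner_boundedRes hM hz]
          linarith [hM (boundedRes M z ψ)]
      _ ≤ ‖inner ℂ ψ (boundedRes M z ψ)‖ := (le_abs_self _).trans (Complex.abs_im_le_norm _)
      _ ≤ _ := norm_inner_le_norm _ _
  rcases (norm_nonneg (boundedRes M z ψ)).eq_or_lt with h0 | h0
  · rw [← h0]; positivity
  · rw [inv_mul_eq_div, le_div_iff₀ hz]
    refine le_of_mul_le_mul_right ?_ h0
    linarith [mul_comm ‖boundedRes M z ψ‖ z.im, h1,
      show ‖boundedRes M z ψ‖ * z.im * ‖boundedRes M z ψ‖ = z.im * ‖boundedRes M z ψ‖ ^ 2 by ring]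

theorem differentiableAt_inner_boundedRes (hM : ∀ x, (inner ℂ x (M x)).im ≤ 0) (hz : 0 < z.im)
    (ψ : E) : DifferentiableAt ℂ (fun z => inner ℂ ψ (boundedRes M z ψ)) z := by
  have h1 := (spectrum.hasDerivAt_resolvent_const_left
    (mem_resolventSet_of_dissipative hM hz)).differentiableAt
  have h2 : DifferentiableAt ℂ (fun z => boundedRes M z ψ) z :=
    h1.neg.clm_apply (differentiableAt_const ψ)
  exact ((innerSL ℂ ψ).differentiableAt).comp z h2

/-- Strong resolvent convergence, for bounded dissipative operators that eventually agree with the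
limit operator on each vector of a core. -/
theorem tendsto_boundedRes {A : E →ₗ.[ℂ] E} (hc : A.IsClosable) {R : ℂ → E →L[ℂ] E}
    (hR : IsResolvent A.closure R) {Mn : ℕ → E →L[ℂ] E}
    (hM : ∀ n x, (inner ℂ x (Mn n x)).im ≤ 0)
    (hA : ∀ φ : A.domain, ∀ᶠ n in atTop, Mn n φ = A φ) (hz : 0 < z.im) (ψ : E) :
    Tendsto (fun n => boundedRes (Mn n) z ψ) atTop (𝓝 (R z ψ)) := by
  rw [Metric.tendsto_atTop']
  intro ε hε
  have hg := hR.mem_graph z hz.ne' ψ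
  rw [← hc.graph_closure_eq_closure_graph] at hg
  -- a core vector `φ` close to `R z ψ` in the graph norm
  have hcont : Tendsto (fun p : E × E => z.im⁻¹ * ‖ψ - (p.2 - z • p.1)‖ + ‖p.1 - R z ψ‖)
      (𝓝 (R z ψ, ψ + z • R z ψ)) (𝓝 0) := by
    have : Continuous fun p : E × E => z.im⁻¹ * ‖ψ - (p.2 - z • p.1)‖ + ‖p.1 - R z ψ‖ := by
      fun_prop
    have h := this.tendsto (R z ψ, ψ + z • R z ψ)
    simpa using h
  obtain ⟨p, hp1, hp2⟩ := ((mem_closure_iff_frequently.1 hg).and_eventually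
    (hcont.eventually (gt_mem_nhds hε))).exists
  obtain ⟨φ, h1, h2⟩ := (LinearPMap.mem_graph_iff _).1 hp1
  obtain ⟨N, hN⟩ := eventually_atTop.1 (hA φ)
  refine ⟨N, fun n hn => ?_⟩
  have h3 : boundedRes (Mn n) z ψ - φ = boundedRes (Mn n) z (ψ - (p.2 - z • p.1)) := by
    rw [map_sub, ← h1, ← h2, ← hN n hn.le, boundedRes_sub (hM n) hz]
  rw [dist_eq_norm]
  calc ‖boundedRes (Mn n) z ψ - R z ψ‖
      = ‖boundedRes (Mn n) z (ψ - (p.2 - z • p.1)) + (p.1 - R z ψ)‖ := by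
        rw [← h3, h1]; congr 1; abel
    _ ≤ z.im⁻¹ * ‖ψ - (p.2 - z • p.1)‖ + ‖p.1 - R z ψ‖ :=
        (norm_add_le _ _).trans (add_le_add (norm_boundedRes_le (hM n) hz _) le_rfl)
    _ < ε := hp2

end Dissipative

/-! ### Box operators with a dissipative boundary term -/

section Box

variable {S : ℤ → Type*} [∀ n, Fintype (S n)] {J : Set ℤ}

theorem finite_trunc (N : ℕ) : {n : J | |(n : ℤ)| ≤ N}.Finite :=
  Set.Finite.preimage (f := Subtype.val) Subtype.val_injective.injOn
    (show {n : ℤ | |n| ≤ N}.Finite from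
      (Set.finite_Icc (-(N : ℤ)) N).subset fun _ hn => abs_le.1 hn)

/-- Restriction to the shells with `|n| ≤ N`. -/
def trunc (N : ℕ) (Ψ : L2 S J) : L2 S J :=
  ⟨fun n => if |(n : ℤ)| ≤ N then Ψ n else 0, by
    refine (memℓp_zero ((finite_trunc N).subset fun n hn => ?_)).of_exponent_ge zero_le
    by_contra h
    exact hn (if_neg h)⟩

theorem ext0_trunc (N : ℕ) (Ψ : L2 S J) (n : ℤ) :
    ext0 (trunc N Ψ) n = if |n| ≤ N then ext0 Ψ n else 0 := by
  by_cases hn : n ∈ J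
  · rw [ext0_of_mem _ hn, ext0_of_mem _ hn]; rfl
  · rw [ext0_of_notMem _ hn, ext0_of_notMem _ hn, ite_self]

theorem trunc_add (N : ℕ) (Ψ Χ : L2 S J) : trunc N (Ψ + Χ) = trunc N Ψ + trunc N Χ := by
  refine ext0_injective fun n => ?_
  rw [ext0_add, ext0_trunc, ext0_trunc, ext0_trunc, ext0_add]
  split_ifs <;> simp

theorem trunc_smul (N : ℕ) (c : ℂ) (Ψ : L2 S J) : trunc N (c • Ψ) = c • trunc N Ψ := by
  refine ext0_injective fun n => ?_
  rw [ext0_smul, ext0_trunc, ext0_trunc, ext0_smul]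
  split_ifs <;> simp

theorem inner_trunc_left (N : ℕ) (Ψ Χ : L2 S J) :
    inner ℂ (trunc N Ψ) Χ = inner ℂ Ψ (trunc N Χ) := by
  rw [inner_eq_tsum_ext0, inner_eq_tsum_ext0]
  refine tsum_congr fun n => ?_
  rw [ext0_trunc, ext0_trunc]
  split_ifs <;> simp

namespace Data

variable [∀ n, DecidableEq (S n)] (D : Data S)

theorem trunc_mem_domain (N : ℕ) (Ψ : L2 S J) : trunc N Ψ ∈ (D.Hmin J).domain := by
  refine (D.mem_domain_iff).2 ((finite_trunc N).subset fun n hn => ?_)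
  by_contra h
  exact hn (if_neg h)

variable (J) in
/-- The operator restricted to the shells with `|n| ≤ N` (Dirichlet boundary conditions). -/
def boxLinear (N : ℕ) : L2 S J →ₗ[ℂ] L2 S J where
  toFun Ψ := trunc N (D.Hmin J ⟨trunc N Ψ, D.trunc_mem_domain N Ψ⟩)
  map_add' x y := by
    rw [← trunc_add, ← LinearPMap.map_add]
    congr 2
    exact Subtype.ext (trunc_add N x y)
  map_smul' c x := by
    rw [RingHom.id_apply, ← trunc_smul, ← LinearPMap.map_smul]
    congr 2
    exact Subtype.ext (trunc_smul N c x)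

theorem boxLinear_isSymmetric (N : ℕ) : (D.boxLinear J N).IsSymmetric := by
  intro x y
  show inner ℂ (trunc N (D.Hmin J _)) y = inner ℂ x (trunc N (D.Hmin J _))
  rw [inner_trunc_left, ← inner_trunc_left N x]
  exact D.Hmin_symm ⟨_, D.trunc_mem_domain N x⟩ ⟨_, D.trunc_mem_domain N y⟩

/-- The box operator with the dissipative boundary term `-i Φ_N Φ_N^*`. Boundedness of the Dirichlet
part is automatic for a symmetric operator that is defined everywhere. -/
def box {N : ℕ} (hN : (N : ℤ) ∈ J) : L2 S J →L[ℂ] L2 S J :=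
  ⟨D.boxLinear J N, (D.boxLinear_isSymmetric N).continuous⟩ -
    Complex.I • (innerSL ℂ (sgl (⟨N, hN⟩ : J) (D.Φ N))).smulRight (sgl (⟨N, hN⟩ : J) (D.Φ N))

variable {N : ℕ} (hN : (N : ℤ) ∈ J)

theorem box_apply (x : L2 S J) : D.box hN x = D.boxLinear J N x -
    (Complex.I * inner ℂ (D.Φ N) (ext0 x N)) • sgl (⟨N, hN⟩ : J) (D.Φ N) := by
  rw [mul_smul]
  show D.boxLinear J N x - Complex.I • (inner ℂ (sgl (⟨N, hN⟩ : J) (D.Φ N)) x •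
    sgl (⟨N, hN⟩ : J) (D.Φ N)) = _
  rw [inner_sgl_left]

theorem im_inner_box (x : L2 S J) :
    (inner ℂ x (D.box hN x)).im = -‖inner ℂ (D.Φ N) (ext0 x N)‖ ^ 2 := by
  have h1 : (inner ℂ x (D.boxLinear J N x)).im = 0 := by
    rw [← Complex.conj_eq_iff_im, inner_conj_symm]
    exact D.boxLinear_isSymmetric N x x
  have h2 : inner ℂ x (sgl (⟨N, hN⟩ : J) (D.Φ N)) =
      starRingEnd ℂ (inner ℂ (D.Φ N) (ext0 x N)) := by
    rw [← inner_conj_symm, inner_sgl_left]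
  rw [box_apply, inner_sub_right, inner_smul_right, h2, Complex.sub_im, h1, mul_assoc,
    Complex.mul_conj, Complex.I_mul_im, Complex.ofReal_re, Complex.normSq_eq_norm_sq, zero_sub]

theorem im_inner_box_nonpos (x : L2 S J) : (inner ℂ x (D.box hN x)).im ≤ 0 := by
  rw [im_inner_box]; simp

/-- On a vector with finitely many non-zero components, all large boxes agree with the operator. -/
theorem box_eq_Hmin (φ : (D.Hmin J).domain) :
    ∀ᶠ N : ℕ in atTop, ∀ hN : (N : ℤ) ∈ J, D.box hN φ = D.Hmin J φ := by
  have hf := D.finite_ext0_ne φ.2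
  obtain ⟨K, hK⟩ : ∃ K : ℕ, ∀ n : ℤ, (K : ℤ) < |n| → ext0 (φ : L2 S J) n = 0 := by
    refine ⟨hf.toFinset.sup Int.natAbs, fun n hn => ?_⟩
    by_contra h
    have h1 := Finset.le_sup (f := Int.natAbs) (hf.mem_toFinset.2 h)
    have h2 : |n| = (n.natAbs : ℤ) := Int.abs_eq_natAbs n
    omega
  filter_upwards [eventually_gt_atTop (K + 1)] with N hN hNJ
  have h1 : trunc N (φ : L2 S J) = φ := by
    refine ext0_injective fun n => ?_
    rw [ext0_trunc]
    split_ifs with h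
    · rfl
    · exact (hK n (by omega)).symm
  have h2 : (⟨trunc N (φ : L2 S J), D.trunc_mem_domain N (φ : L2 S J)⟩ : (D.Hmin J).domain) = φ :=
    Subtype.ext h1
  have h3 : D.boxLinear J N φ = trunc N (D.Hmin J φ) := by
    show trunc N (D.Hmin J _) = _
    rw [h2]
  rw [box_apply, h3, hK N (by rw [Nat.abs_cast]; omega), inner_zero_right, mul_zero, zero_smul,
    sub_zero]
  refine ext0_injective fun n => ?_
  rw [ext0_trunc]
  split_ifs with h
  · rfl
  · by_cases hn : n ∈ J
    · have e1 := hK n (by omega)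
      have e2 := hK (n + 1) (by
        rcases abs_cases n with ⟨h5, h6⟩ | ⟨h5, h6⟩ <;>
          rcases abs_cases (n + 1) with ⟨h7, h8⟩ | ⟨h7, h8⟩ <;> omega)
      have e3 := hK (n - 1) (by
        rcases abs_cases n with ⟨h5, h6⟩ | ⟨h5, h6⟩ <;>
          rcases abs_cases (n - 1) with ⟨h7, h8⟩ | ⟨h7, h8⟩ <;> omega)
      rw [ext0_of_mem _ hn, Hmin_apply]
      simp [formal, e1, e2, e3]
    · exact (ext0_of_notMem _ hn).symm

/-- The solution of the box equation `(M_N - z) u = ψ`. -/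
def boxSol (z : ℂ) (ψ : L2 S J) : L2 S J := boundedRes (D.box hN) z ψ

/-- The two channel values between the shells `n` and `n + 1` of the solution `u` of the box
equation: the incoming value `aₙ₊₁ Υₙ₊₁^* uₙ₊₁`, which at the right end is replaced by the
boundary value `i Φ_N^* u_N`, and the outgoing value `Φₙ^* uₙ`. -/
def chan (N : ℕ) (u : L2 S J) (n : ℤ) : Fin 2 → ℂ :=
  ![if n = N then Complex.I * inner ℂ (D.Φ n) (ext0 u n)
    else D.a (n + 1) * inner ℂ (D.Υ (n + 1)) (ext0 u (n + 1)), inner ℂ (D.Φ n) (ext0 u n)]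

/-- The box equation in a single shell: the neighbouring shells enter through the channel values,
and so does the boundary term if `n = N`. -/
theorem shell_boxSol {z : ℂ} (hz : 0 < z.im) (ψ : L2 S J) {n : ℤ} (hn : n ∈ J) (h1 : -(N : ℤ) < n)
    (h2 : n ≤ N) :
    (D.V n).toEuclideanLin (ext0 (D.boxSol hN z ψ) n) - z • ext0 (D.boxSol hN z ψ) n =
      ext0 ψ n + D.chan N (D.boxSol hN z ψ) n 0 • D.Φ n +
        (D.a n * D.chan N (D.boxSol hN z ψ) (n - 1) 1) • D.Υ n := by
  have h := congrArg (fun x => ext0 x n)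
    (sub_boundedRes (D.im_inner_box_nonpos hN) hz ψ)
  rw [show boundedRes (D.box hN) z ψ = D.boxSol hN z ψ from rfl] at h
  set u := D.boxSol hN z ψ
  have hb : ext0 (D.box hN u) n = D.formal (ext0 (trunc N u)) n -
      (if n = N then (Complex.I * inner ℂ (D.Φ N) (ext0 u N)) else 0) • D.Φ n := by
    rw [box_apply, sub_eq_add_neg, ← neg_smul, ext0_add, ext0_smul, sub_eq_add_neg, ← neg_smul]
    congr 1
    · show ext0 (trunc N (D.Hmin J _)) n = _
      rw [ext0_trunc, if_pos (abs_le.2 ⟨h1.le, h2⟩), ext0_of_mem _ hn, Hmin_apply]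
    · by_cases hnN : n = N
      · subst hnN
        rw [if_pos rfl, ext0_sgl_self (⟨N, hN⟩ : J)]
      · rw [if_neg hnN, ext0_sgl_ne (n := (⟨N, hN⟩ : J)) _ hnN, smul_zero, neg_zero, zero_smul]
  rw [sub_eq_add_neg, ← neg_smul, ext0_add, ext0_smul, hb] at h
  have e0 : ext0 (trunc N u) n = ext0 u n := by rw [ext0_trunc, if_pos (abs_le.2 ⟨h1.le, h2⟩)]
  have e1 : ext0 (trunc N u) (n - 1) = ext0 u (n - 1) := by
    rw [ext0_trunc, if_pos (abs_le.2 ⟨by omega, by omega⟩)]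
  have hy : D.chan N u (n - 1) 1 = inner ℂ (D.Φ (n - 1)) (ext0 u (n - 1)) := rfl
  rw [hy, ← h]
  unfold formal
  rw [e0, e1]
  by_cases hnN : n = N
  · have e2 : ext0 (trunc N u) (n + 1) = 0 := by
      rw [ext0_trunc, if_neg]
      rw [abs_of_nonneg (by omega)]
      omega
    have hx : D.chan N u n 0 = Complex.I * inner ℂ (D.Φ n) (ext0 u n) := by
      simp [chan, hnN]
    rw [hx, e2, inner_zero_right, if_pos hnN]
    subst hnN
    module
  · have e2 : ext0 (trunc N u) (n + 1) = ext0 u (n + 1) := by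
      rw [ext0_trunc, if_pos (abs_le.2 ⟨by omega, by omega⟩)]
    have hx : D.chan N u n 0 = D.a (n + 1) * inner ℂ (D.Υ (n + 1)) (ext0 u (n + 1)) := by
      simp [chan, hnN]
    rw [hx, e2, if_neg hnN]
    module

/-- The dissipation at the right end of the box is a lower bound for the imaginary part of the
Green's function. -/
theorem norm_chan_sq_le {z : ℂ} (hz : 0 < z.im) (ψ : L2 S J) :
    ‖inner ℂ (D.Φ N) (ext0 (D.boxSol hN z ψ) N)‖ ^ 2 ≤ ‖inner ℂ ψ (D.boxSol hN z ψ)‖ := by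
  refine le_trans ?_ ((le_abs_self _).trans (Complex.abs_im_le_norm _))
  have h := im_inner_boundedRes (D.im_inner_box_nonpos hN) hz ψ
  rw [im_inner_box] at h
  have : 0 ≤ z.im * ‖boundedRes (D.box hN) z ψ‖ ^ 2 := by positivity
  show _ ≤ (inner ℂ ψ (boundedRes (D.box hN) z ψ)).im
  rw [h]
  show ‖inner ℂ (D.Φ N) (ext0 (boundedRes (D.box hN) z ψ) N)‖ ^ 2 ≤ _
  linarith

end Data

end Box


/-! ### Transfer matrix bounds for the Green's functions -/

section SumNorm

/-- The sum of the absolute values of the entries of a matrix. -/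
def sumNorm (M : Matrix (Fin 2) (Fin 2) ℂ) : ℝ := ∑ i, ∑ j, ‖M i j‖

theorem sumNorm_nonneg (M : Matrix (Fin 2) (Fin 2) ℂ) : 0 ≤ sumNorm M :=
  Finset.sum_nonneg fun _ _ => Finset.sum_nonneg fun _ _ => norm_nonneg _

theorem continuous_sumNorm : Continuous sumNorm := by unfold sumNorm; fun_prop

/-- `M⁻¹ = (det M)⁻¹ adj M`, and the entries of `adj M` are those of `M` up to signs. -/
theorem norm_det_mul_norm_le (M : Matrix (Fin 2) (Fin 2) ℂ) (w : Fin 2 → ℂ) :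
    ‖M.det‖ * ‖w‖ ≤ sumNorm M * ‖M.mulVec w‖ := by
  have h : M.det • w = M.adjugate.mulVec (M.mulVec w) := by
    rw [Matrix.mulVec_mulVec, Matrix.adjugate_mul, Matrix.smul_mulVec, Matrix.one_mulVec]
  rw [← norm_smul, h]
  set v := M.mulVec w
  refine (pi_norm_le_iff_of_nonneg (mul_nonneg (sumNorm_nonneg M) (norm_nonneg v))).2 fun i => ?_
  have h0 := norm_le_pi_norm v 0
  have h1 := norm_le_pi_norm v 1
  have hn := norm_nonneg v
  have hs : sumNorm M = ‖M 0 0‖ + ‖M 0 1‖ + (‖M 1 0‖ + ‖M 1 1‖) := by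
    simp [sumNorm, Fin.sum_univ_two]
  have key : ∀ c d : ℂ, ‖c‖ + ‖d‖ ≤ sumNorm M → ‖c * v 0 + d * v 1‖ ≤ sumNorm M * ‖v‖ := by
    intro c d hcd
    calc ‖c * v 0 + d * v 1‖ ≤ ‖c‖ * ‖v 0‖ + ‖d‖ * ‖v 1‖ := by
          rw [← norm_mul, ← norm_mul]; exact norm_add_le _ _
      _ ≤ ‖c‖ * ‖v‖ + ‖d‖ * ‖v‖ := by gcongr
      _ ≤ sumNorm M * ‖v‖ := by rw [← add_mul]; gcongr
  have p00 := norm_nonneg (M 0 0)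
  have p01 := norm_nonneg (M 0 1)
  have p10 := norm_nonneg (M 1 0)
  have p11 := norm_nonneg (M 1 1)
  fin_cases i
  · have := key (M 1 1) (-M 0 1) (by rw [norm_neg, hs]; linarith)
    simpa [Matrix.adjugate_fin_two, Matrix.mulVec, dotProduct, Fin.sum_univ_two] using this
  · have := key (-M 1 0) (M 0 0) (by rw [norm_neg, hs]; linarith)
    simpa [Matrix.adjugate_fin_two, Matrix.mulVec, dotProduct, Fin.sum_univ_two] using this

end SumNorm

/-- If `f` is continuous at all points of a compact real interval, the values slightly above the
interval are uniformly controlled by those on the interval. -/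
theorem eventually_le_add_one {f : ℂ → ℝ} {a b : ℝ} (hf : ∀ x ∈ Set.Icc a b, ContinuousAt f x) :
    ∀ᶠ η : ℝ in 𝓝[>] 0, ∀ x ∈ Set.Icc a b, f (x + η * Complex.I) ≤ f x + 1 := by
  refine nhdsWithin_le_nhds ?_
  refine isCompact_Icc.eventually_forall_of_forall_eventually fun x hx => ?_
  have h1 : Tendsto (fun p : ℝ × ℝ => (p.2 : ℂ) + p.1 * Complex.I) (𝓝 (0, x)) (𝓝 (x : ℂ)) := by
    have : Continuous fun p : ℝ × ℝ => (p.2 : ℂ) + p.1 * Complex.I := by fun_prop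
    simpa using this.tendsto (0, x)
  have h2 : Tendsto (fun p : ℝ × ℝ => (p.2 : ℂ)) (𝓝 (0, x)) (𝓝 (x : ℂ)) := by
    have : Continuous fun p : ℝ × ℝ => (p.2 : ℂ) := by fun_prop
    simpa using this.tendsto (0, x)
  have h3 := ((hf x hx).tendsto.comp h1).sub ((hf x hx).tendsto.comp h2)
  rw [sub_self] at h3
  filter_upwards [h3.eventually (gt_mem_nhds one_pos)] with p hp
  have : f ((p.2 : ℂ) + p.1 * Complex.I) - f p.2 < 1 := hp
  linarith

namespace Data

variable {S : ℤ → Type*} [∀ n, Fintype (S n)] (D : Data S)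

theorem chan_sub_one {J : Set ℤ} {N : ℕ} (u : L2 S J) {n : ℤ} (hn : n ≤ N) :
    D.chan N u (n - 1) =
      ![D.a n * inner ℂ (D.Υ n) (ext0 u n), inner ℂ (D.Φ (n - 1)) (ext0 u (n - 1))] := by
  have h : ∀ m : ℤ, m = n → D.a m * inner ℂ (D.Υ m) (ext0 u m) =
      D.a n * inner ℂ (D.Υ n) (ext0 u n) := by rintro m rfl; rfl
  rw [chan, if_neg (by omega), h (n - 1 + 1) (by ring)]

variable [∀ n, DecidableEq (S n)]

/-- The product `T_{z,K+m} ⋯ T_{z,K+1}` of transfer matrices. -/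
def transferProd (K : ℕ) (z : ℂ) : ℕ → Matrix (Fin 2) (Fin 2) ℂ
  | 0 => 1
  | m + 1 => D.transfer (K + m + 1) z * transferProd K z m

theorem continuousAt_transferProd {z : ℂ} (h : ∀ n : ℤ, 1 ≤ n → D.TransferDefined n z) (K m : ℕ) :
    ContinuousAt (fun z => D.transferProd K z m) z := by
  induction m with
  | zero => exact continuousAt_const
  | succ m ih => exact (continuousAt_transfer (h _ (by omega))).mul ih

theorem norm_det_transferProd {l : ℝ} (h : ∀ n : ℤ, 1 ≤ n → D.TransferDefined n l) (K m : ℕ) :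
    ‖(D.transferProd K l m).det‖ = 1 := by
  induction m with
  | zero => simp [transferProd]
  | succ m ih =>
    rw [transferProd, Matrix.det_mul, norm_mul, ih, mul_one]
    exact norm_det_transfer (h _ (by omega))

variable {J : Set ℤ}

theorem transfer_mulVec_chan {N : ℕ} (hN : (N : ℤ) ∈ J) {z : ℂ} (hz : 0 < z.im) (ψ : L2 S J)
    {n : ℤ} (hn : n ∈ J) (h1 : -(N : ℤ) < n) (h2 : n ≤ N) (hψ : ext0 ψ n = 0)
    (hβ : D.beta n z ≠ 0) :
    (D.transfer n z).mulVec (D.chan N (D.boxSol hN z ψ) (n - 1)) =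
      D.chan N (D.boxSol hN z ψ) n := by
  have h := D.shell_boxSol hN hz ψ hn h1 h2
  rw [hψ, zero_add] at h
  have h3 := rawTransfer_mulVec hβ h
  have ha : (D.a n : ℂ) ≠ 0 := Complex.ofReal_ne_zero.2 (D.a_ne_zero n)
  rw [mul_div_cancel_left₀ _ ha] at h3
  rw [transfer_eq hβ, D.chan_sub_one _ h2]
  refine h3.trans ?_
  ext i
  fin_cases i <;> rfl

/-- Transfer across the shells `K + 1, …, K + m + 1`. The initial vector `w` need not consist of the
channel values to the left of the shell `K + 1`, which allows for a source in this shell. -/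
theorem transferProd_mulVec {K m : ℕ} (hN : ((K + (m + 1) : ℕ) : ℤ) ∈ J)
    (hJ : ∀ n : ℤ, 1 ≤ n → n ∈ J) {z : ℂ} (hz : 0 < z.im) (ψ : L2 S J) {w : Fin 2 → ℂ}
    (hw : (D.transfer (K + 1) z).mulVec w = D.chan (K + (m + 1)) (D.boxSol hN z ψ) (K + 1))
    (hψ : ∀ n : ℤ, K + 1 < n → ext0 ψ n = 0)
    (hβ : ∀ n : ℤ, K < n → n ≤ K + (m + 1) → D.beta n z ≠ 0) :
    (D.transferProd K z (m + 1)).mulVec w =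
      D.chan (K + (m + 1)) (D.boxSol hN z ψ) (K + (m + 1)) := by
  have key : ∀ j : ℕ, j ≤ m → (D.transferProd K z (j + 1)).mulVec w =
      D.chan (K + (m + 1)) (D.boxSol hN z ψ) (K + j + 1) := by
    intro j hj
    induction j with
    | zero =>
      simp only [transferProd, mul_one]
      simpa using hw
    | succ j ih =>
      have h1 := ih (by omega)
      rw [transferProd, ← Matrix.mulVec_mulVec, h1]
      have h2 := D.transfer_mulVec_chan hN hz ψ (n := K + (j + 1 : ℕ) + 1) (hJ _ (by omega))
        (by push_cast; omega) (by push_cast; omega) (hψ _ (by omega))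
        (hβ _ (by omega) (by push_cast; omega))
      have e : (K : ℤ) + (j + 1 : ℕ) + 1 - 1 = K + j + 1 := by push_cast; ring
      rw [e] at h2
      exact h2
  have h := key m le_rfl
  rw [h, add_assoc]

/-- The Green's function of `ψ` in a box is bounded, near `l`, by the channel values at the right
side of the shell `K`, where the products of transfer matrices start: these are given by a vector
`w` that the product maps to the channel values at the right end of the box. -/
def Controlled (ψ : L2 S J) (l : ℝ) : Prop :=
  ∃ (C : ℝ) (K m₀ : ℕ), 0 ≤ C ∧ ∀ᶠ z in 𝓝 (l : ℂ), 0 < z.im → ∀ m : ℕ, m₀ ≤ m →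
    ∀ hN : ((K + m : ℕ) : ℤ) ∈ J, (∀ n : ℤ, K < n → n ≤ K + m → D.beta n z ≠ 0) →
    ∃ w : Fin 2 → ℂ,
      (D.transferProd K z m).mulVec w = D.chan (K + m) (D.boxSol hN z ψ) (K + m) ∧
      ‖inner ℂ ψ (D.boxSol hN z ψ)‖ ≤ C * (1 + ‖w‖)

variable {D}

/-- The Green's function of `Φ₀` is itself a channel value to the right of the shell `0`. -/
theorem controlled_Φ (hJ : ∀ n : ℤ, 1 ≤ n → n ∈ J) (h0 : (0 : ℤ) ∈ J) (l : ℝ) :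
    D.Controlled (sgl (⟨0, h0⟩ : J) (D.Φ 0)) l := by
  refine ⟨1, 0, 1, zero_le_one, Eventually.of_forall fun z hz m hm hN hβ => ?_⟩
  obtain ⟨m, rfl⟩ : ∃ k, m = k + 1 := ⟨m - 1, by omega⟩
  set ψ := sgl (⟨0, h0⟩ : J) (D.Φ 0)
  have hψ : ∀ n : ℤ, n ≠ 0 → ext0 ψ n = 0 := fun n hn => ext0_sgl_ne (n := (⟨0, h0⟩ : J)) _ hn
  refine ⟨D.chan (0 + (m + 1)) (D.boxSol hN z ψ) 0, ?_, ?_⟩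
  · refine D.transferProd_mulVec hN hJ hz ψ ?_ (fun n hn => hψ n (by omega)) hβ
    have h := D.transfer_mulVec_chan hN hz ψ (n := 1) (hJ 1 le_rfl) (by push_cast; omega)
      (by push_cast; omega) (hψ 1 (by omega)) (hβ 1 (by norm_num) (by push_cast; omega))
    simpa using h
  · rw [inner_sgl_left, one_mul]
    have := norm_le_pi_norm (D.chan (0 + (m + 1)) (D.boxSol hN z ψ) 0) 1
    have h2 : D.chan (0 + (m + 1)) (D.boxSol hN z ψ) 0 1 =
      inner ℂ (D.Φ 0) (ext0 (D.boxSol hN z ψ) 0) := rfl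
    rw [h2] at this
    linarith

/-- The source `Υ₁` is absorbed into the channel values to the left of the first shell. -/
theorem controlled_Υ (hJ : ∀ n : ℤ, 1 ≤ n → n ∈ J) (l : ℝ) :
    D.Controlled (sgl (⟨1, hJ 1 le_rfl⟩ : J) (D.Υ 1)) l := by
  refine ⟨|D.a 1|⁻¹, 0, 1, by positivity, Eventually.of_forall fun z hz m hm hN hβ => ?_⟩
  obtain ⟨m, rfl⟩ : ∃ k, m = k + 1 := ⟨m - 1, by omega⟩
  set ψ := sgl (⟨1, hJ 1 le_rfl⟩ : J) (D.Υ 1)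
  have hψ : ∀ n : ℤ, n ≠ 1 → ext0 ψ n = 0 := fun n hn =>
    ext0_sgl_ne (n := (⟨1, hJ 1 le_rfl⟩ : J)) _ hn
  have hψ1 : ext0 ψ 1 = D.Υ 1 := ext0_sgl_self (⟨1, hJ 1 le_rfl⟩ : J) _
  set u := D.boxSol hN z ψ
  have ha : (D.a 1 : ℂ) ≠ 0 := Complex.ofReal_ne_zero.2 (D.a_ne_zero 1)
  have hβ1 : D.beta 1 z ≠ 0 := hβ 1 (by norm_num) (by push_cast; omega)
  have h := D.shell_boxSol hN hz ψ (n := 1) (hJ 1 le_rfl) (by push_cast; omega)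
    (by push_cast; omega)
  rw [hψ1] at h
  have h' : (D.V 1).toEuclideanLin (ext0 u 1) - z • ext0 u 1 =
      D.chan (0 + (m + 1)) u 1 0 • D.Φ 1 +
        (1 + D.a 1 * D.chan (0 + (m + 1)) u (1 - 1) 1) • D.Υ 1 := by
    rw [h]; module
  have h3 := rawTransfer_mulVec hβ1 h'
  refine ⟨![D.a 1 * inner ℂ (D.Υ 1) (ext0 u 1),
    (1 + D.a 1 * D.chan (0 + (m + 1)) u (1 - 1) 1) / D.a 1], ?_, ?_⟩
  · refine D.transferProd_mulVec hN hJ hz ψ ?_ (fun n hn => hψ n (by push_cast at hn; omega)) hβ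
    have e : ((0 : ℕ) : ℤ) + 1 = 1 := by norm_num
    rw [e, transfer_eq hβ1]
    refine h3.trans ?_
    ext i
    fin_cases i <;> rfl
  · rw [inner_sgl_left]
    refine le_trans ?_ (mul_le_mul_of_nonneg_left (le_add_of_nonneg_left zero_le_one)
      (by positivity))
    rw [inv_mul_eq_div, le_div_iff₀ (abs_pos.2 (D.a_ne_zero 1))]
    refine le_trans (le_of_eq ?_) (norm_le_pi_norm _ (0 : Fin 2))
    show _ = ‖(D.a 1 : ℂ) * inner ℂ (D.Υ 1) (ext0 u 1)‖
    rw [norm_mul, Complex.norm_real, Real.norm_eq_abs, mul_comm]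

/-- The system of inequalities for `U = ‖u‖` and `Q = ‖q‖` in `exists_backward_bound`, where `t` is
the distance of the energies, `M` a bound for the resolvent of the shell, and `g = |γ|`. -/
theorem backward_arith {M g t U Q X A y : ℝ} (hM : 0 < M) (hg : 0 < g) (ht : 0 ≤ t) (hU : 0 ≤ U)
    (hQ : 0 ≤ Q) (hX : 0 ≤ X) (hA : A ≤ X) (hy : y ≤ X) (h1 : U ≤ M * A + M * t * U + M * Q)
    (h2 : g * Q ≤ y + M * A + M * t * U) (ht1 : M * t ≤ 1 / 2) (ht2 : 2 * M * (M * t) ≤ g / 2) :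
    U + Q ≤ (2 * M * (1 + 2 * (1 + 2 * M) / g) + 2 * (1 + 2 * M) / g) * X := by
  have hMt : 0 ≤ M * t := mul_nonneg hM.le ht
  have e1 : M * A ≤ M * X := mul_le_mul_of_nonneg_left hA hM.le
  have e2 : M * t * U ≤ 1 / 2 * U := mul_le_mul_of_nonneg_right ht1 hU
  have h3 : U ≤ 2 * (M * X) + 2 * (M * Q) := by linarith
  have e3 : M * t * U ≤ M * t * (2 * (M * X)) + M * t * (2 * (M * Q)) := by
    rw [← mul_add]; exact mul_le_mul_of_nonneg_left h3 hMt
  have e4 : M * t * (2 * (M * X)) ≤ 1 / 2 * (2 * (M * X)) :=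
    mul_le_mul_of_nonneg_right ht1 (by positivity)
  have e5 : M * t * (2 * (M * Q)) ≤ g / 2 * Q := by
    have := mul_le_mul_of_nonneg_right ht2 hQ
    linarith [show M * t * (2 * (M * Q)) = 2 * M * (M * t) * Q by ring]
  have h7 : Q ≤ 2 * (1 + 2 * M) / g * X := by
    rw [div_mul_eq_mul_div, le_div_iff₀ hg]
    linarith [show 2 * (1 + 2 * M) * X = 2 * X + 4 * (M * X) by ring, mul_comm Q g]
  have h8 := mul_le_mul_of_nonneg_left h7 (mul_nonneg zero_le_two hM.le)
  linarith [show (2 * M * (1 + 2 * (1 + 2 * M) / g) + 2 * (1 + 2 * M) / g) * X =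
    2 * (M * X) + 2 * M * (2 * (1 + 2 * M) / g * X) + 2 * (1 + 2 * M) / g * X by ring]

/-- Away from the exceptional points of a shell, the solution in the shell and the incoming value
from the left are bounded by the source and the values on the right. -/
theorem exists_backward_bound {n : ℤ} {l : ℂ} (h : l ∉ D.excSet n) :
    ∃ C : ℝ, 0 ≤ C ∧ ∀ᶠ z in 𝓝 l, ∀ (u ψ : EuclideanSpace ℂ (S n)) (p q : ℂ),
      (D.V n).toEuclideanLin u - z • u = ψ + p • D.Φ n + q • D.Υ n →
      ‖u‖ + ‖q‖ ≤ C * (‖ψ‖ + ‖p‖ + ‖inner ℂ (D.Φ n) u‖) := by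
  have hγ : D.gamma n l ≠ 0 := fun h0 => h (Or.inr h0)
  have hd := D.det_ne_zero_of_green n hγ
  let L := LinearMap.toContinuousLinearMap (D.shellRes n l)
  obtain ⟨M, hMdef⟩ : ∃ M : ℝ, M = ‖L‖ + 1 := ⟨_, rfl⟩
  have hM0 : 0 < M := by rw [hMdef]; positivity
  have hM : ∀ x, ‖D.shellRes n l x‖ ≤ M * ‖x‖ := fun x =>
    (L.le_opNorm x).trans (mul_le_mul_of_nonneg_right (by linarith) (norm_nonneg x))
  obtain ⟨g, hgdef⟩ : ∃ g : ℝ, g = ‖D.gamma n l‖ := ⟨_, rfl⟩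
  have hg : 0 < g := hgdef ▸ norm_pos_iff.2 hγ
  refine ⟨2 * M * (1 + 2 * (1 + 2 * M) / g) + 2 * (1 + 2 * M) / g, by positivity, ?_⟩
  have hτ : 0 < min (1 / (2 * M)) (g / (4 * M ^ 2)) := by positivity
  filter_upwards [Metric.ball_mem_nhds l hτ] with z hz u ψ p q huz
  rw [Metric.mem_ball, dist_eq_norm, lt_min_iff] at hz
  obtain ⟨t, ht⟩ : ∃ t : ℝ, t = ‖z - l‖ := ⟨_, rfl⟩
  rw [← ht] at hz
  have ht0 : 0 ≤ t := ht ▸ norm_nonneg _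
  have ht1 : M * t ≤ 1 / 2 := by
    have := (lt_div_iff₀ (by positivity)).1 hz.1
    linarith
  have ht2 : 2 * M * (M * t) ≤ g / 2 := by
    have := (lt_div_iff₀ (by positivity)).1 hz.2
    nlinarith
  have hul : (D.V n).toEuclideanLin u - l • u =
      (ψ + (z - l) • u) + p • D.Φ n + q • D.Υ n := by
    have : (D.V n).toEuclideanLin u - l • u =
      ((D.V n).toEuclideanLin u - z • u) + (z - l) • u := by module
    rw [this, huz]; abel
  have hsol := shell_solution hd hul
  obtain ⟨U, hU⟩ : ∃ U : ℝ, U = ‖u‖ := ⟨_, rfl⟩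
  obtain ⟨Q, hQ⟩ : ∃ Q : ℝ, Q = ‖q‖ := ⟨_, rfl⟩
  obtain ⟨X, hX⟩ : ∃ X : ℝ, X = ‖ψ‖ + ‖p‖ + ‖inner ℂ (D.Φ n) u‖ := ⟨_, rfl⟩
  have hψ' : ‖ψ + (z - l) • u‖ ≤ ‖ψ‖ + t * U := by
    rw [ht, hU, ← norm_smul]; exact norm_add_le _ _
  have hΦ := hM (D.Φ n)
  have hΥ := hM (D.Υ n)
  rw [D.norm_Φ, mul_one] at hΦ
  rw [D.norm_Υ, mul_one] at hΥ
  have hy := norm_nonneg (inner ℂ (D.Φ n) u)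
  have hp := norm_nonneg p
  have hQ0 : 0 ≤ Q := hQ ▸ norm_nonneg q
  have hU0 : 0 ≤ U := hU ▸ norm_nonneg u
  have hX0 : 0 ≤ X := by rw [hX]; positivity
  have hR1 : ‖D.shellRes n l (ψ + (z - l) • u)‖ ≤ M * (‖ψ‖ + t * U) :=
    (hM _).trans (mul_le_mul_of_nonneg_left hψ' hM0.le)
  have h1 : U ≤ M * (‖ψ‖ + t * U) + ‖p‖ * M + Q * M := by
    have h2 : U ≤ ‖D.shellRes n l (ψ + (z - l) • u)‖ + ‖p • D.shellRes n l (D.Φ n)‖ +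
        ‖q • D.shellRes n l (D.Υ n)‖ := by
      rw [hU]
      conv_lhs => rw [hsol]
      exact norm_add₃_le
    rw [norm_smul, norm_smul, ← hQ] at h2
    have := mul_le_mul_of_nonneg_left hΦ hp
    have := mul_le_mul_of_nonneg_left hΥ hQ0
    linarith
  have h2 : g * Q ≤ ‖inner ℂ (D.Φ n) u‖ + M * (‖ψ‖ + t * U) + ‖p‖ * M := by
    have e : q * D.gamma n l = inner ℂ (D.Φ n) u -
        inner ℂ (D.Φ n) (D.shellRes n l (ψ + (z - l) • u)) -
          p * inner ℂ (D.Φ n) (D.shellRes n l (D.Φ n)) := by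
      have := congrArg (fun x => inner ℂ (D.Φ n) x) hsol
      simp only [inner_add_right, inner_smul_right] at this
      rw [show D.gamma n l = inner ℂ (D.Φ n) (D.shellRes n l (D.Υ n)) from rfl]
      linear_combination -this
    have hn1 : ∀ x, ‖inner ℂ (D.Φ n) x‖ ≤ ‖x‖ := fun x => by
      simpa [D.norm_Φ] using norm_inner_le_norm (𝕜 := ℂ) (D.Φ n) x
    have e2 : g * Q = ‖q * D.gamma n l‖ := by rw [norm_mul, hgdef, hQ, mul_comm]
    rw [e2, e]
    refine (norm_sub_le _ _).trans (add_le_add ((norm_sub_le _ _).trans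
      (add_le_add le_rfl ((hn1 _).trans hR1))) ?_)
    rw [norm_mul]
    exact mul_le_mul_of_nonneg_left ((hn1 _).trans hΦ) hp
  rw [← hU, ← hQ, ← hX]
  exact backward_arith (A := ‖ψ‖ + ‖p‖) (y := ‖inner ℂ (D.Φ n) u‖) hM0 hg ht0 hU0 hQ0 hX0
    (by rw [hX]; linarith) (by rw [hX]; linarith [norm_nonneg ψ])
    (by linarith) (by linarith) ht1 ht2

/-- The channel values to the left of finitely many shells are bounded by those on the right. -/
theorem exists_chan_bound {K : ℕ} {l : ℝ} {ψ : L2 S J} (d : ℕ)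
    (h : ∀ j : ℤ, K - d < j → j ≤ K → j ∈ J ∧ (l : ℂ) ∉ D.excSet j ∧ ext0 ψ j = 0) :
    ∃ C : ℝ, 0 ≤ C ∧ ∀ᶠ z in 𝓝 (l : ℂ), 0 < z.im → ∀ m : ℕ, d + 1 ≤ m →
      ∀ hN : ((K + m : ℕ) : ℤ) ∈ J,
        ‖D.chan (K + m) (D.boxSol hN z ψ) (K - d)‖ ≤
          C * ‖D.chan (K + m) (D.boxSol hN z ψ) K‖ := by
  induction d with
  | zero => exact ⟨1, zero_le_one, Eventually.of_forall fun z _ m _ hN => by simp⟩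
  | succ d ih =>
    obtain ⟨C, hC0, hC⟩ := ih fun j h1 h2 => h j (by push_cast; omega) h2
    obtain ⟨hJ, hexc, hψ⟩ := h (K - d) (by push_cast; omega) (by omega)
    obtain ⟨C', hC'0, hC'⟩ := exists_backward_bound hexc
    refine ⟨2 * (|D.a (K - d)| + |D.a (K - d)|⁻¹) * C' * C, by positivity, ?_⟩
    filter_upwards [hC, hC'] with z h1 h2 hz m hm hN
    have h3 := h1 hz m (by omega) hN
    set u := D.boxSol hN z ψ
    have h4 := D.shell_boxSol hN hz ψ (n := K - d) hJ (by push_cast; omega) (by push_cast; omega)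
    have h5 := h2 _ _ _ _ h4
    rw [hψ, norm_zero, zero_add] at h5
    have hy : inner ℂ (D.Φ (K - d)) (ext0 u (K - d)) = D.chan (K + m) u (K - d) 1 := rfl
    rw [show ext0 (D.boxSol hN z ψ) (K - d) = ext0 u (K - d) from rfl, hy] at h5
    have h6 := norm_le_pi_norm (D.chan (K + m) u (K - d)) 0
    have h7 := norm_le_pi_norm (D.chan (K + m) u (K - d)) 1
    have e : (K : ℤ) - (d + 1 : ℕ) = K - d - 1 := by push_cast; ring
    have ha : 0 < |D.a (K - d)| := abs_pos.2 (D.a_ne_zero _)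
    rw [e]
    set c := ‖D.chan (K + m) u K‖
    have h8 : ‖ext0 u (K - d)‖ + ‖(D.a (K - d) : ℂ) * D.chan (K + m) u (K - d - 1) 1‖ ≤
        2 * (C' * (C * c)) := by
      refine h5.trans ?_
      have : C' * (‖D.chan (K + m) u (K - d) 0‖ + ‖D.chan (K + m) u (K - d) 1‖) ≤
          C' * (C * c + C * c) := mul_le_mul_of_nonneg_left
            (add_le_add (h6.trans h3) (h7.trans h3)) hC'0
      linarith
    have hX : 0 ≤ 2 * (C' * (C * c)) := by positivity
    refine (pi_norm_le_iff_of_nonneg (by positivity)).2 fun i => ?_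
    have hsplit : 2 * (|D.a (K - d)| + |D.a (K - d)|⁻¹) * C' * C * c =
        |D.a (K - d)| * (2 * (C' * (C * c))) + |D.a (K - d)|⁻¹ * (2 * (C' * (C * c))) := by ring
    rw [hsplit]
    fin_cases i
    · refine le_trans ?_ (le_add_of_nonneg_right (by positivity))
      show ‖D.chan (K + m) u (K - d - 1) 0‖ ≤ _
      have e0 : D.chan (K + m) u (K - d - 1) 0 =
          D.a (K - d) * inner ℂ (D.Υ (K - d)) (ext0 u (K - d)) := by
        rw [D.chan_sub_one u (by push_cast; omega)]; rfl
      rw [e0, norm_mul, Complex.norm_real, Real.norm_eq_abs]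
      refine mul_le_mul_of_nonneg_left ?_ ha.le
      have h9 := norm_inner_le_norm (𝕜 := ℂ) (D.Υ (K - d)) (ext0 u (K - d))
      rw [D.norm_Υ, one_mul] at h9
      exact h9.trans ((le_add_of_nonneg_right (norm_nonneg _)).trans h8)
    · refine le_trans ?_ (le_add_of_nonneg_left (by positivity))
      show ‖D.chan (K + m) u (K - d - 1) 1‖ ≤ _
      have h9 := (le_add_of_nonneg_left (norm_nonneg _)).trans h8
      rw [norm_mul, Complex.norm_real, Real.norm_eq_abs] at h9
      rw [inv_mul_eq_div, le_div_iff₀ ha, mul_comm]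
      exact h9

/-- Vectors in a single shell, off the exceptional points of the shells between this shell and the
origin. -/
theorem controlled_sgl (hJ : ∀ n : ℤ, 1 ≤ n → n ∈ J) (hJ' : IsUpperSet J) (k : J)
    (x : EuclideanSpace ℂ (S k)) {l : ℝ}
    (hl : ∀ j : ℤ, (k : ℤ) ≤ j → j ≤ max (k : ℤ) 0 → (l : ℂ) ∉ D.excSet j) :
    D.Controlled (sgl k x) l := by
  obtain ⟨k, hk⟩ := k
  set ψ := sgl (⟨k, hk⟩ : J) x
  have hψ : ∀ n : ℤ, n ≠ k → ext0 ψ n = 0 := fun n hn => ext0_sgl_ne (n := (⟨k, hk⟩ : J)) _ hn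
  have hψk : ext0 ψ k = x := ext0_sgl_self (⟨k, hk⟩ : J) _
  obtain ⟨K, hK⟩ : ∃ K : ℕ, (K : ℤ) = max k 0 :=
    ⟨(max k 0).toNat, Int.toNat_of_nonneg (le_max_right _ _)⟩
  obtain ⟨d, hd⟩ : ∃ d : ℕ, (d : ℤ) = K - k := ⟨(K - k).toNat, Int.toNat_of_nonneg (by omega)⟩
  have hk' : (K : ℤ) - d = k := by omega
  obtain ⟨C, hC0, hC⟩ := exists_chan_bound (D := D) (K := K) (l := l) (ψ := ψ) d
    fun j h1 h2 => ⟨hJ' (by omega) hk, hl j (show k ≤ j by omega) (show j ≤ max k 0 by omega),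
      hψ j (by omega)⟩
  obtain ⟨C', hC'0, hC'⟩ := exists_backward_bound (hl k le_rfl (le_max_left _ _))
  refine ⟨‖x‖ * C' * (‖x‖ + 2 * C), K, d + 1, by positivity, ?_⟩
  filter_upwards [hC, hC'] with z h1 h2 hz m hm hN hβ
  obtain ⟨m, rfl⟩ : ∃ j, m = j + 1 := ⟨m - 1, by omega⟩
  have h3 := h1 hz (m + 1) hm hN
  rw [hk'] at h3
  set u := D.boxSol hN z ψ
  refine ⟨D.chan (K + (m + 1)) u K, ?_, ?_⟩
  · refine D.transferProd_mulVec hN hJ hz ψ ?_ (fun n hn => hψ n (by omega)) hβ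
    have h := D.transfer_mulVec_chan hN hz ψ (n := K + 1) (hJ _ (by omega)) (by push_cast; omega)
      (by push_cast; omega) (hψ _ (by omega)) (hβ _ (by omega) (by omega))
    rwa [add_sub_cancel_right] at h
  · have h4 := D.shell_boxSol hN hz ψ (n := k) hk (by push_cast; omega) (by push_cast; omega)
    have h5 := h2 _ _ _ _ h4
    rw [hψk] at h5
    have hy : inner ℂ (D.Φ k) (ext0 u k) = D.chan (K + (m + 1)) u k 1 := rfl
    rw [show ext0 (D.boxSol hN z ψ) k = ext0 u k from rfl, hy] at h5
    have h6 := (norm_le_pi_norm (D.chan (K + (m + 1)) u k) 0).trans h3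
    have h7 := (norm_le_pi_norm (D.chan (K + (m + 1)) u k) 1).trans h3
    set c := ‖D.chan (K + (m + 1)) u K‖
    have hc : 0 ≤ c := norm_nonneg _
    rw [inner_sgl_left]
    have h8 : ‖ext0 u k‖ ≤ C' * (‖x‖ + C * c + C * c) := by
      refine (le_add_of_nonneg_right (norm_nonneg _)).trans (h5.trans ?_)
      exact mul_le_mul_of_nonneg_left (by linarith) hC'0
    refine (norm_inner_le_norm _ _).trans ((mul_le_mul_of_nonneg_left h8 (norm_nonneg x)).trans ?_)
    have h9 : ‖x‖ + C * c + C * c ≤ (‖x‖ + 2 * C) * (1 + c) := by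
      nlinarith [mul_nonneg (norm_nonneg x) hc]
    have := mul_le_mul_of_nonneg_left h9 (mul_nonneg (norm_nonneg x) hC'0)
    nlinarith

end Data


/-! ### Absence of singular spectrum under bounds for the transfer matrices -/

section NullFor

variable {E : Type*} [NormedAddCommGroup E] [InnerProductSpace ℂ E] {A : E →ₗ.[ℂ] E}
  {R : ℂ → E →L[ℂ] E} {T : Set ℝ}

/-- Inner regularity reduces null sets to compact ones. -/
theorem measure_eq_zero_of_isCompact {μ : Measure ℝ} [IsFiniteMeasure μ] {T : Set ℝ}
    (hT : MeasurableSet T) (h : ∀ S, S ⊆ T → IsCompact S → μ S = 0) : μ T = 0 := by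
  rw [hT.measure_eq_iSup_isCompact]
  simp only [ENNReal.iSup_eq_zero]
  exact h

/-- The measure `μ` has the Stieltjes transform `⟪ψ, R z ψ⟫` in the upper half plane. -/
def Represents (R : ℂ → E →L[ℂ] E) (ψ : E) (μ : Measure ℝ) : Prop :=
  ∀ z : ℂ, 0 < z.im → inner ℂ ψ (R z ψ) = ∫ x : ℝ, ((x : ℂ) - z)⁻¹ ∂μ

/-- The set `T` is a null set for the spectral measure at `ψ`. -/
def NullFor (R : ℂ → E →L[ℂ] E) (T : Set ℝ) (ψ : E) : Prop :=
  ∀ μ : Measure ℝ, IsFiniteMeasure μ → Represents R ψ μ → μ T = 0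

/-- `Im ⟪ψ, R z ψ⟫ = Im z ‖R z ψ‖²` is a non-negative quadratic form in `ψ`. -/
theorem IsResolvent.im_inner_add_le (hR : IsResolvent A R) {z : ℂ} (hz : 0 < z.im) (φ χ : E) :
    (inner ℂ (φ + χ) (R z (φ + χ))).im ≤
      2 * (inner ℂ φ (R z φ)).im + 2 * (inner ℂ χ (R z χ)).im := by
  rw [hR.im_inner hz.ne', hR.im_inner hz.ne', hR.im_inner hz.ne', map_add]
  have h1 : ‖R z φ + R z χ‖ ^ 2 ≤ 2 * ‖R z φ‖ ^ 2 + 2 * ‖R z χ‖ ^ 2 := by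
    have h2 := norm_add_le (R z φ) (R z χ)
    have h3 := pow_le_pow_left₀ (norm_nonneg _) h2 2
    nlinarith [sq_nonneg (‖R z φ‖ - ‖R z χ‖)]
  nlinarith [mul_le_mul_of_nonneg_left h1 hz.le]

theorem nullFor_zero (R : ℂ → E →L[ℂ] E) (hT : MeasurableSet T) : NullFor R T (0 : E) := by
  intro μ hμ h
  refine measure_eq_zero_of_isCompact hT fun S _ hS => ?_
  have h0 : ∀ z : ℂ, 0 < z.im → (fun _ => 0 : ℂ → ℂ) z =
      ∫ x : ℝ, ((x : ℂ) - z)⁻¹ ∂(0 : Measure ℝ) := fun z _ => by simp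
  have := measure_le_of_im_le h h0 h0 (fun z hz => by simp) hS
  simpa using this

theorem NullFor.add [CompleteSpace E] (hR : IsResolvent A R) (hT : MeasurableSet T) {φ χ : E}
    (hφ : NullFor R T φ) (hχ : NullFor R T χ) : NullFor R T (φ + χ) := by
  intro μ hμ h
  obtain ⟨μ₁, hμ₁, -, h₁⟩ := hR.exists_measure φ
  obtain ⟨μ₂, hμ₂, -, h₂⟩ := hR.exists_measure χ
  have h₁' : Represents R φ μ₁ := fun z hz => h₁ z hz.ne'
  have h₂' : Represents R χ μ₂ := fun z hz => h₂ z hz.ne'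
  refine measure_eq_zero_of_isCompact hT fun S hST hS => ?_
  have := measure_le_of_im_le h h₁' h₂' (fun z hz => hR.im_inner_add_le hz φ χ) hS
  rw [measure_mono_null hST (hφ μ₁ hμ₁ h₁'), measure_mono_null hST (hχ μ₂ hμ₂ h₂')] at this
  simpa using this

/-- The spectral measure at `ψ` is at most twice the sum of those at `φ` and `ψ - φ`, and the latter
has total mass at most a multiple of `‖ψ - φ‖²`. -/
theorem isClosed_nullFor [CompleteSpace E] (hR : IsResolvent A R) (hT : MeasurableSet T) :
    IsClosed {ψ | NullFor R T ψ} := by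
  refine isClosed_of_closure_subset fun ψ hψ μ hμ h => ?_
  refine measure_eq_zero_of_isCompact hT fun S hST hS => ?_
  have key : ∀ φ, NullFor R T φ →
      μ S ≤ 2 * (ENNReal.ofReal Real.pi * ENNReal.ofReal (‖ψ - φ‖ ^ 2)) := by
    intro φ hφ
    obtain ⟨μ₁, hμ₁, -, h₁⟩ := hR.exists_measure φ
    obtain ⟨μ₂, hμ₂, hle, h₂⟩ := hR.exists_measure (ψ - φ)
    have h₁' : Represents R φ μ₁ := fun z hz => h₁ z hz.ne'
    have h₂' : Represents R (ψ - φ) μ₂ := fun z hz => h₂ z hz.ne'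
    have := measure_le_of_im_le h h₁' h₂' (fun z hz => by
      have := hR.im_inner_add_le hz φ (ψ - φ)
      rwa [add_sub_cancel] at this) hS
    rw [measure_mono_null hST (hφ μ₁ hμ₁ h₁'), mul_zero, mul_zero, zero_add] at this
    refine this.trans ?_
    gcongr
    exact (measure_mono (Set.subset_univ S)).trans hle
  have hcont : Tendsto (fun φ => 2 * (ENNReal.ofReal Real.pi * ENNReal.ofReal (‖ψ - φ‖ ^ 2)))
      (𝓝 ψ) (𝓝 0) := by
    have h1 : Tendsto (fun φ => ENNReal.ofReal (‖ψ - φ‖ ^ 2)) (𝓝 ψ) (𝓝 0) := by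
      have h2 : Continuous fun φ => ENNReal.ofReal (‖ψ - φ‖ ^ 2) :=
        ENNReal.continuous_ofReal.comp (by fun_prop)
      simpa using h2.tendsto ψ
    have h3 := ENNReal.Tendsto.const_mul (a := 2)
      (ENNReal.Tendsto.const_mul (a := ENNReal.ofReal Real.pi) h1 (Or.inr ENNReal.ofReal_ne_top))
      (Or.inr (by simp))
    simpa using h3
  by_contra h0
  obtain ⟨φ, hφ1, hφ2⟩ := ((mem_closure_iff_frequently.1 hψ).and_eventually
    (hcont.eventually (gt_mem_nhds (pos_iff_ne_zero.2 h0)))).exists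
  exact absurd (key φ hφ1) (not_le.2 hφ2)

end NullFor

namespace Data

variable {S : ℤ → Type*} [∀ n, Fintype (S n)] [∀ n, DecidableEq (S n)] (D : Data S)

/-- The transfer matrices are defined on `I` for all `n ≥ 1`, and for their products starting at any
shell, the `L⁴` norms on compact intervals do not tend to infinity. Rational end points make this
a countable family of conditions, as is needed for almost sure statements. -/
structure Regular (I : Set ℝ) : Prop where
  defined : ∀ l ∈ I, ∀ n : ℤ, 1 ≤ n → D.TransferDefined n (l : ℂ)
  bounded : ∀ (K : ℕ) (a b : ℚ), Set.Icc (a : ℝ) b ⊆ I → ∃ M : ℝ≥0∞, M ≠ ∞ ∧ ∃ᶠ m in atTop,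
    ∫⁻ x in Set.Icc (a : ℝ) b, ENNReal.ofReal (sumNorm (D.transferProd K x m) ^ 4) ≤ M

/-- The function `β` has finitely many zeros, so horizontal lines close to the real axis avoid all
of them. -/
theorem eventually_forall_beta_ne_zero {n : ℤ} (h : ∃ z, D.beta n z ≠ 0) :
    ∀ᶠ η : ℝ in 𝓝[>] 0, ∀ x : ℝ, D.beta n (x + η * Complex.I) ≠ 0 := by
  have hfin := D.finite_green_eq_zero n (x := D.Υ n) (y := D.Φ n) h
  have h1 : ∀ᶠ η : ℝ in 𝓝[>] 0, ∀ ζ ∈ {z | D.green n z (D.Υ n) (D.Φ n) = 0}, η ≠ ζ.im := by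
    rw [hfin.eventually_all]
    intro ζ _
    rcases le_or_gt ζ.im 0 with h0 | h0
    · filter_upwards [self_mem_nhdsWithin] with η hη
      exact (lt_of_le_of_lt h0 hη).ne'
    · filter_upwards [nhdsWithin_le_nhds (gt_mem_nhds h0)] with η hη
      exact hη.ne
  filter_upwards [h1] with η hη x hx
  refine hη _ hx ?_
  simp

variable {D} {J : Set ℤ} {R : ℂ → L2 S J →L[ℂ] L2 S J}

/-- The self-improving bound in `norm_green_le`, with `g²` the size of the Green's function: it is
bounded by a multiple of `1 + g`, hence by a constant. -/
theorem green_arith {C s g w : ℝ} (hC : 0 ≤ C) (hg : g ^ 2 ≤ C * (1 + w))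
    (hw : w ≤ 2 * (s + 1) * g) : g ^ 2 ≤ 2 * C + 4 * C ^ 2 * (s + 1) ^ 2 := by
  have h1 := mul_le_mul_of_nonneg_left hw hC
  nlinarith [sq_nonneg (g - 2 * C * (s + 1))]

theorem sq_green_bound_le {C s : ℝ} :
    (2 * C + 4 * C ^ 2 * (s + 1) ^ 2) ^ 2 ≤ (8 * C ^ 2 + 256 * C ^ 4) + 256 * C ^ 4 * s ^ 4 := by
  have h1 : (s + 1) ^ 4 ≤ 8 * (s ^ 4 + 1) := by
    nlinarith [sq_nonneg (s - 1), sq_nonneg (s ^ 2 - 1), sq_nonneg (s ^ 2 - s),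
      sq_nonneg (s ^ 2 - 2 * s + 1)]
  have h2 : (2 * C + 4 * C ^ 2 * (s + 1) ^ 2) ^ 2 ≤ 8 * C ^ 2 + 32 * C ^ 4 * (s + 1) ^ 4 := by
    nlinarith [sq_nonneg (2 * C - 4 * C ^ 2 * (s + 1) ^ 2)]
  have h3 := mul_le_mul_of_nonneg_left h1 (by positivity : 0 ≤ 32 * C ^ 4)
  linarith

/-- The transfer matrix expresses a controlled Green's function through the boundary value at the
right end of the box, whose square is bounded by the imaginary part of the same Green's function.
This turns bounds for the products of transfer matrices into bounds for the Green's function. -/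
theorem norm_green_le {ψ : L2 S J} {z : ℂ} (hz : 0 < z.im) {K m : ℕ}
    (hN : ((K + m : ℕ) : ℤ) ∈ J) {w : Fin 2 → ℂ} {C s : ℝ} (hC : 0 ≤ C)
    (hw : (D.transferProd K z m).mulVec w = D.chan (K + m) (D.boxSol hN z ψ) (K + m))
    (hG : ‖inner ℂ ψ (D.boxSol hN z ψ)‖ ≤ C * (1 + ‖w‖))
    (hs : sumNorm (D.transferProd K z m) ≤ s + 1)
    (hdet : 1 / 2 ≤ ‖(D.transferProd K z m).det‖) :
    ‖inner ℂ ψ (D.boxSol hN z ψ)‖ ≤ 2 * C + 4 * C ^ 2 * (s + 1) ^ 2 := by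
  have h1 := norm_det_mul_norm_le (D.transferProd K z m) w
  rw [hw] at h1
  have h2 := D.norm_chan_sq_le hN hz ψ
  set y := inner ℂ (D.Φ (K + m : ℕ)) (ext0 (D.boxSol hN z ψ) (K + m : ℕ)) with hy
  have h3 : ‖D.chan (K + m) (D.boxSol hN z ψ) (K + m)‖ ≤ ‖y‖ := by
    have e : (K : ℤ) + m = (K + m : ℕ) := by push_cast; rfl
    rw [e]
    refine (pi_norm_le_iff_of_nonneg (norm_nonneg _)).2 fun i => ?_
    fin_cases i
    · show ‖D.chan (K + m) (D.boxSol hN z ψ) (K + m : ℕ) 0‖ ≤ ‖y‖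
      rw [chan, if_pos rfl]
      show ‖Complex.I * y‖ ≤ ‖y‖
      rw [norm_mul, Complex.norm_I, one_mul]
    · exact le_rfl
  obtain ⟨G, hGdef⟩ : ∃ G : ℝ, G = ‖inner ℂ ψ (D.boxSol hN z ψ)‖ := ⟨_, rfl⟩
  rw [← hGdef] at h2 hG ⊢
  have hG0 : 0 ≤ G := hGdef ▸ norm_nonneg _
  have h4 : ‖y‖ ≤ Real.sqrt G := Real.le_sqrt_of_sq_le h2
  have hs0 : 0 ≤ s + 1 := (sumNorm_nonneg _).trans hs
  have h5 : ‖w‖ ≤ 2 * (s + 1) * Real.sqrt G := by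
    have h6 : 1 / 2 * ‖w‖ ≤ (s + 1) * Real.sqrt G :=
      (mul_le_mul_of_nonneg_right hdet (norm_nonneg w)).trans
        (h1.trans (mul_le_mul hs (h3.trans h4) (norm_nonneg _) hs0))
    linarith
  have h7 := green_arith hC (g := Real.sqrt G) (by rw [Real.sq_sqrt hG0]; exact hG) h5
  rwa [Real.sq_sqrt hG0] at h7

/-- Near an energy where `ψ` is controlled, the spectral measure at `ψ` has no singular part: the
Green's functions of the boxes converge to that of the operator and are bounded in `L²` on
horizontal segments, so that the criterion `measure_eq_zero_of_bound` applies. -/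
theorem exists_null_nhds (hJ : ∀ n : ℤ, 1 ≤ n → n ∈ J) (hR : IsResolvent (D.H J) R) {I : Set ℝ}
    (hI : IsOpen I) (hreg : D.Regular I) {l : ℝ} (hl : l ∈ I) {ψ : L2 S J}
    (hψ : D.Controlled ψ l) {μ : Measure ℝ} [IsFiniteMeasure μ] (hμ : Represents R ψ μ) :
    ∃ δ > 0, ∀ T : Set ℝ, IsCompact T → T ⊆ Set.Icc (l - δ) (l + δ) → volume T = 0 → μ T = 0 := by
  obtain ⟨C, K, m₀, hC0, hC⟩ := hψ
  obtain ⟨r, hr, hball⟩ := Metric.eventually_nhds_iff_ball.1 hC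
  obtain ⟨ρ, hρ, hIball⟩ := Metric.isOpen_iff.1 hI l hl
  obtain ⟨a, ha1, ha2⟩ := exists_rat_btwn (show l - min (r / 2) ρ < l by
    have := lt_min (half_pos hr) hρ; linarith)
  obtain ⟨b, hb1, hb2⟩ := exists_rat_btwn (show l < l + min (r / 2) ρ by
    have := lt_min (half_pos hr) hρ; linarith)
  have hmin1 := min_le_left (r / 2) ρ
  have hmin2 := min_le_right (r / 2) ρ
  have hab : Set.Icc (a : ℝ) b ⊆ I := fun x hx => hIball (by
    rw [Metric.mem_ball, Real.dist_eq, abs_lt]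
    exact ⟨by linarith [hx.1], by linarith [hx.2]⟩)
  -- the neighbourhood has to keep the distance `s` from the end points of `[a, b]`
  obtain ⟨s, hs0, hs1, hs2⟩ : ∃ s : ℝ, 0 < s ∧ s ≤ (l - a) / 3 ∧ s ≤ (b - l) / 3 :=
    ⟨min ((l - a) / 3) ((b - l) / 3), lt_min (by linarith) (by linarith), min_le_left _ _,
      min_le_right _ _⟩
  refine ⟨s, hs0, fun T hT hTs hT0 => ?_⟩
  -- boxes large enough to contain the support of `ψ`
  have hN : ∀ m : ℕ, ((K + (m + (m₀ + 1)) : ℕ) : ℤ) ∈ J := fun m => hJ _ (by push_cast; omega)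
  let Gn : ℕ → ℂ → ℂ := fun m z => inner ℂ ψ (D.boxSol (hN m) z ψ)
  let σ : ℕ → ℝ → ℝ := fun m x => sumNorm (D.transferProd K x (m + (m₀ + 1)))
  obtain ⟨M, hM, hfreq⟩ := hreg.bounded K a b hab
  have hdefd : ∀ x ∈ Set.Icc (a : ℝ) b, ∀ n : ℤ, 1 ≤ n → D.TransferDefined n (x : ℂ) :=
    fun x hx => hreg.defined x (hab hx)
  refine measure_eq_zero_of_bound (μ := μ) (G := fun z => inner ℂ ψ (R z ψ)) (Gn := Gn)
    (C := ‖ψ‖ ^ 2) hμ ?_ ?_ ?_ (a := a) (b := b)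
    (h := fun m x => 2 * C + 4 * C ^ 2 * (σ m x + 1) ^ 2) ?_
    (M := ENNReal.ofReal (8 * C ^ 2 + 256 * C ^ 4) * volume (Set.Icc (a : ℝ) b) +
      ENNReal.ofReal (256 * C ^ 4) * M) ?_ ?_ hT hs0 ?_ hT0
  · exact fun m z hz => differentiableAt_inner_boundedRes (D.im_inner_box_nonpos (hN m)) hz ψ
  · intro m z hz
    refine (norm_inner_le_norm _ _).trans ?_
    have := norm_boundedRes_le (D.im_inner_box_nonpos (hN m)) hz ψ
    have h2 := mul_le_mul_of_nonneg_left this (norm_nonneg ψ)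
    refine h2.trans (le_of_eq ?_)
    rw [div_eq_mul_inv]; ring
  · intro z hz
    have h1 := tendsto_boundedRes D.isClosable_Hmin hR
      (Mn := fun m => D.box (hN m)) (fun m => D.im_inner_box_nonpos (hN m)) (fun φ => by
        have ht : Tendsto (fun m : ℕ => K + (m + (m₀ + 1))) atTop atTop :=
          tendsto_atTop_mono (fun m => show m ≤ _ by omega) tendsto_id
        filter_upwards [ht.eventually (D.box_eq_Hmin φ)] with m hm
        exact hm (hN m)) hz ψ
    exact tendsto_const_nhds.inner h1
  · -- for fixed `m`, the products above `[a, b]` are close to those on `[a, b]`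
    refine Eventually.of_forall fun m => ?_
    have h1 : ∀ᶠ η : ℝ in 𝓝[>] 0, ∀ x ∈ Set.Icc (a : ℝ) b,
        sumNorm (D.transferProd K (x + η * Complex.I) (m + (m₀ + 1))) ≤ σ m x + 1 :=
      eventually_le_add_one (f := fun z => sumNorm (D.transferProd K z (m + (m₀ + 1))))
        fun x hx => continuous_sumNorm.continuousAt.comp
          (D.continuousAt_transferProd (hdefd x hx) K _)
    have h2 := eventually_le_add_one (a := a) (b := b)
      (f := fun z => -2 * ‖(D.transferProd K z (m + (m₀ + 1))).det‖) fun x hx => by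
        have hc : ContinuousAt (fun z => (D.transferProd K z (m + (m₀ + 1))).det) (x : ℂ) :=
          (continuous_id.matrix_det).continuousAt.comp
            (D.continuousAt_transferProd (hdefd x hx) K (m + (m₀ + 1)))
        exact hc.norm.const_mul _
    have h3 : ∀ᶠ η : ℝ in 𝓝[>] 0, ∀ n ∈ Set.Ioc (K : ℤ) (K + (m + (m₀ + 1)) : ℕ),
        ∀ x : ℝ, D.beta n (x + η * Complex.I) ≠ 0 := by
      rw [(Set.finite_Ioc _ _).eventually_all]
      intro n hn
      exact D.eventually_forall_beta_ne_zero
        ((hreg.defined l hl n (by have := hn.1; omega)).exists_beta)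
    filter_upwards [h1, h2, h3, self_mem_nhdsWithin,
      nhdsWithin_le_nhds (gt_mem_nhds (half_pos hr))] with η e1 e2 e3 hη0 hηr x hx
    have hη0' : 0 < η := hη0
    have hzim : 0 < ((x : ℂ) + η * Complex.I).im := by simpa using hη0'
    have hzball : (x : ℂ) + η * Complex.I ∈ Metric.ball (l : ℂ) r := by
      rw [Metric.mem_ball, dist_eq_norm]
      have : (x : ℂ) + η * Complex.I - l = ((x - l : ℝ) : ℂ) + η * Complex.I := by push_cast; ring
      rw [this]
      refine (norm_add_le _ _).trans_lt ?_
      rw [norm_mul, Complex.norm_I, mul_one, Complex.norm_real, Complex.norm_real, Real.norm_eq_abs,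
        Real.norm_eq_abs, abs_of_pos hη0']
      have : |x - l| < r / 2 := abs_lt.2 ⟨by linarith [hx.1], by linarith [hx.2]⟩
      linarith
    obtain ⟨w, hw1, hw2⟩ := hball _ hzball hzim (m + (m₀ + 1)) (by omega) (hN m)
      (fun n hn1 hn2 => e3 n ⟨hn1, by push_cast; push_cast at hn2; exact hn2⟩ x)
    refine norm_green_le hzim (hN m) hC0 (by exact_mod_cast hw1) hw2 (e1 x hx) ?_
    have e4 := e2 x hx
    rw [D.norm_det_transferProd (hdefd x hx)] at e4
    linarith
  · exact ENNReal.add_ne_top.2 ⟨ENNReal.mul_ne_top ENNReal.ofReal_ne_top (by simp),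
      ENNReal.mul_ne_top ENNReal.ofReal_ne_top hM⟩
  · have hfreq' : ∃ᶠ m in atTop, ∫⁻ x in Set.Icc (a : ℝ) b,
        ENNReal.ofReal (σ m x ^ 4) ≤ M := by
      rw [← Filter.map_add_atTop_eq_nat (m₀ + 1)] at hfreq
      exact hfreq
    refine hfreq'.mono fun m hm => ?_
    calc ∫⁻ x in Set.Icc (a : ℝ) b,
          ENNReal.ofReal ((2 * C + 4 * C ^ 2 * (σ m x + 1) ^ 2) ^ 2)
        ≤ ∫⁻ x in Set.Icc (a : ℝ) b, (ENNReal.ofReal (8 * C ^ 2 + 256 * C ^ 4) +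
            ENNReal.ofReal (256 * C ^ 4) * ENNReal.ofReal (σ m x ^ 4)) := by
          refine lintegral_mono fun x => ?_
          rw [← ENNReal.ofReal_mul (by positivity), ← ENNReal.ofReal_add (by positivity)
            (by positivity)]
          exact ENNReal.ofReal_le_ofReal sq_green_bound_le
      _ = ENNReal.ofReal (8 * C ^ 2 + 256 * C ^ 4) * volume (Set.Icc (a : ℝ) b) +
            ENNReal.ofReal (256 * C ^ 4) *
              ∫⁻ x in Set.Icc (a : ℝ) b, ENNReal.ofReal (σ m x ^ 4) := by
          rw [lintegral_add_left measurable_const, lintegral_const_mul' _ _ ENNReal.ofReal_ne_top,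
            lintegral_const, Measure.restrict_apply_univ]
      _ ≤ _ := by gcongr
  · intro x hx
    have := hTs hx
    exact ⟨by linarith [this.1], by linarith [this.2]⟩

/-- The local statement `exists_null_nhds` suffices by the Lindelöf property of the line. -/
theorem nullFor_of_controlled (hJ : ∀ n : ℤ, 1 ≤ n → n ∈ J) (hR : IsResolvent (D.H J) R)
    {I : Set ℝ} (hI : IsOpen I) (hreg : D.Regular I) {ψ : L2 S J} {T : Set ℝ}
    (hT : MeasurableSet T) (hTI : T ⊆ I) (hT0 : volume T = 0)
    (hψ : ∀ l ∈ T, D.Controlled ψ l) : NullFor R T ψ := by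
  intro μ hμ h
  refine measure_null_of_locally_null T fun l hl => ?_
  obtain ⟨δ, hδ, hnull⟩ := exists_null_nhds hJ hR hI hreg (hTI hl) (hψ l hl) h
  refine ⟨T ∩ Set.Icc (l - δ) (l + δ), inter_mem_nhdsWithin _ (Icc_mem_nhds (by linarith)
    (by linarith)), ?_⟩
  refine measure_eq_zero_of_isCompact (hT.inter measurableSet_Icc) fun U hU hUc => ?_
  exact hnull U hUc (hU.trans Set.inter_subset_right)
    (measure_mono_null (hU.trans Set.inter_subset_left) hT0)

end Data


/-! ### Absence of eigenvalues at regular energies -/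

/-- Without an atom at `l` of its spectral measure, `g` is orthogonal to the weak limits of
`ε R(l + iε) ψ`. -/
theorem tendsto_mul_inner_of_nullFor {E : Type*} [NormedAddCommGroup E] [InnerProductSpace ℂ E]
    [CompleteSpace E] {A : E →ₗ.[ℂ] E} {R : ℂ → E →L[ℂ] E} (hR : IsResolvent A R) {g : E} {l : ℝ}
    (hg : NullFor R {l} g) (ψ : E) :
    Tendsto (fun ε : ℝ => (ε : ℂ) * inner ℂ g (R (l + ε * Complex.I) ψ)) (𝓝[>] 0) (𝓝 0) := by
  obtain ⟨μ, hμ, -, h⟩ := hR.exists_measure g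
  have h' : Represents R g μ := fun z hz => h z hz.ne'
  have h0 := tendsto_mul_im (G := fun z => inner ℂ g (R z g)) h' (hg μ hμ h')
  have h1 := (ENNReal.tendsto_toReal ENNReal.zero_ne_top).comp h0
  have h2 : Tendsto (fun ε : ℝ => Real.sqrt (ENNReal.toReal (ENNReal.ofReal
      (ε * (inner ℂ g (R (l + ε * Complex.I) g)).im))) * ‖ψ‖) (𝓝[>] 0) (𝓝 0) := by
    have := (Real.continuous_sqrt.tendsto _ |>.comp h1).mul_const ‖ψ‖
    simpa using this
  refine squeeze_zero_norm' ?_ h2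
  filter_upwards [self_mem_nhdsWithin] with ε hε
  have hε' : 0 < ε := hε
  obtain ⟨z, hz⟩ : ∃ z : ℂ, z = l + ε * Complex.I := ⟨_, rfl⟩
  have hzim : z.im = ε := by simp [hz]
  rw [← hz]
  have hz0 : z.im ≠ 0 := by rw [hzim]; exact hε'.ne'
  have hz0' : (starRingEnd ℂ z).im ≠ 0 := by simpa using hz0
  -- `⟪g, R_z ψ⟫ = ⟪R_{z̄} g, ψ⟫`, and `ε² ‖R_{z̄} g‖² = ε Im ⟪g, R_z g⟫`
  have e1 : inner ℂ g (R z ψ) = inner ℂ (R (starRingEnd ℂ z) g) ψ := by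
    rw [hR.inner_apply hz0', Complex.conj_conj]
  have e2 : (inner ℂ g (R z g)).im = ε * ‖R (starRingEnd ℂ z) g‖ ^ 2 := by
    have e3 : inner ℂ g (R z g) = starRingEnd ℂ (inner ℂ g (R (starRingEnd ℂ z) g)) := by
      rw [inner_conj_symm, hR.inner_apply hz0', Complex.conj_conj]
    rw [e3, Complex.conj_im, hR.im_inner hz0', Complex.conj_im, hzim]
    ring
  rw [e2, ENNReal.toReal_ofReal (by positivity), e1, norm_mul, Complex.norm_real, Real.norm_eq_abs,
    abs_of_pos hε', show ε * (ε * ‖R (starRingEnd ℂ z) g‖ ^ 2) =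
      (ε * ‖R (starRingEnd ℂ z) g‖) ^ 2 by ring, Real.sqrt_sq (by positivity), mul_assoc]
  exact mul_le_mul_of_nonneg_left (norm_inner_le_norm _ _) hε'.le

namespace Data

variable {S : ℤ → Type*} [∀ n, Fintype (S n)] [∀ n, DecidableEq (S n)] {D : Data S} {J : Set ℤ}
  {R : ℂ → L2 S J →L[ℂ] L2 S J}

/-- A formal eigenvector in the spaces `𝕍ₙ` whose two channel values between the shells `0` and `1`
vanish is zero: the vanishing of these values propagates to all shells. -/
theorem eq_zero_of_formal (hJ' : IsUpperSet J) (hJ : ∀ n : ℤ, 1 ≤ n → n ∈ J) {l : ℝ}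
    (hdef : ∀ n ∈ J, D.TransferDefined n (l : ℂ)) {u : ∀ n, EuclideanSpace ℂ (S n)}
    (hu : ∀ n ∈ J, D.formal u n = (l : ℂ) • u n) (hu0 : ∀ n, n ∉ J → u n = 0)
    (hV : ∀ n ∈ J, u n ∈ D.VV n) (hΥ : inner ℂ (D.Υ 1) (u 1) = 0)
    (hΦ : inner ℂ (D.Φ 0) (u 0) = 0) (n : ℤ) : u n = 0 := by
  have hsol : ∀ n ∈ J, (D.V n).toEuclideanLin (u n) - (l : ℂ) • u n =
      (D.a (n + 1) * inner ℂ (D.Υ (n + 1)) (u (n + 1))) • D.Φ n +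
        (D.a n * inner ℂ (D.Φ (n - 1)) (u (n - 1))) • D.Υ n := by
    intro n hn
    rw [← hu n hn]
    unfold formal
    module
  have ha : ∀ n, (D.a n : ℂ) ≠ 0 := fun n => Complex.ofReal_ne_zero.2 (D.a_ne_zero n)
  have hfw : ∀ k : ℕ, inner ℂ (D.Υ (k + 1)) (u (k + 1)) = 0 ∧ inner ℂ (D.Φ k) (u k) = 0 := by
    intro k
    induction k with
    | zero => simpa using ⟨hΥ, hΦ⟩
    | succ k ih =>
      have hmem : (k : ℤ) + 1 ∈ J := hJ _ (by omega)
      have h1 := hsol _ hmem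
      have h2 : inner ℂ (D.Φ ((k : ℤ) + 1 - 1)) (u ((k : ℤ) + 1 - 1)) = 0 := by
        rw [add_sub_cancel_right]; exact ih.2
      rw [h2, mul_zero, zero_smul, add_zero] at h1
      obtain ⟨h3, h4⟩ := forward_zero (hdef _ hmem) h1 ih.1
      push_cast
      exact ⟨(mul_eq_zero.1 h3).resolve_left (ha _), h4⟩
  have hbw : ∀ k : ℕ, inner ℂ (D.Υ (-k + 1)) (u (-k + 1)) = 0 ∧
      inner ℂ (D.Φ (-k)) (u (-k)) = 0 := by
    intro k
    induction k with
    | zero => simpa using ⟨hΥ, hΦ⟩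
    | succ k ih =>
      have e1 : (-((k + 1 : ℕ) : ℤ) + 1) = -k := by push_cast; ring
      have e2 : (-((k + 1 : ℕ) : ℤ)) = -k - 1 := by push_cast; ring
      rw [e1, e2]
      by_cases hmem : -(k : ℤ) ∈ J
      · have h1 := hsol _ hmem
        rw [ih.1, mul_zero, zero_smul, zero_add] at h1
        obtain ⟨h3, h4⟩ := backward_zero (hdef _ hmem) h1 ih.2
        exact ⟨h4, (mul_eq_zero.1 h3).resolve_left (ha _)⟩
      · have hmem' : -(k : ℤ) - 1 ∉ J := fun h => hmem (hJ' (by omega) h)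
        rw [hu0 _ hmem, hu0 _ hmem', inner_zero_right, inner_zero_right]
        exact ⟨rfl, rfl⟩
  have hall : ∀ n : ℤ, inner ℂ (D.Υ (n + 1)) (u (n + 1)) = 0 ∧ inner ℂ (D.Φ n) (u n) = 0 := by
    intro n
    rcases Int.eq_nat_or_neg n with ⟨k, rfl | rfl⟩
    · exact hfw k
    · exact hbw k
  by_cases hn : n ∈ J
  · have h1 := hsol n hn
    have h2 := hall (n - 1)
    rw [sub_add_cancel] at h2
    rw [(hall n).1, h2.2, mul_zero, mul_zero, zero_smul, zero_smul, zero_add] at h1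
    exact eq_zero_of_mem_VV (mem_shellKer.2 h1) h2.1 (hall n).2 (hV n hn)
  · exact hu0 n hn

/-- No eigenvalues: the vectors `ε (H - l - iε)⁻¹ ψ` have weak limit points as `ε → 0`, which are
formal eigenvectors, and their channel values at the vectors `Υ₁` and `Φ₀` vanish. -/
theorem nullFor_singleton_sgl (hJ' : IsUpperSet J) (hJ : ∀ n : ℤ, 1 ≤ n → n ∈ J)
    (hR : IsResolvent (D.H J) R) {K : ∀ n, Submodule ℂ (EuclideanSpace ℂ (S n))}
    (hK : D.Reduces J K) (hKV : ∀ n, K n ≤ D.VV n) {l : ℝ}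
    (hdef : ∀ n ∈ J, D.TransferDefined n (l : ℂ))
    (hΥ : NullFor R {l} (sgl (⟨1, hJ 1 le_rfl⟩ : J) (D.Υ 1)))
    (hΦ : ∀ h0 : (0 : ℤ) ∈ J, NullFor R {l} (sgl (⟨0, h0⟩ : J) (D.Φ 0)))
    (k : J) {x : EuclideanSpace ℂ (S k)} (hx : x ∈ K k) : NullFor R {l} (sgl k x) := by
  intro μ hμ h
  obtain ⟨ψ, hψ⟩ : ∃ ψ, ψ = sgl k x := ⟨_, rfl⟩
  rw [← hψ] at h
  have hψK : ψ ∈ blockSubmodule J K := by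
    intro n
    rw [hψ]
    by_cases hn : n = k
    · subst hn; rw [sgl_apply_self]; exact hx
    · rw [sgl_apply_ne x hn]; exact (K n).zero_mem
  let 𝒰 : Ultrafilter ℝ := Ultrafilter.of (𝓝[>] (0 : ℝ))
  have h𝒰 : (𝒰 : Filter ℝ) ≤ 𝓝[>] 0 := Ultrafilter.of_le _
  let v : ℝ → L2 S J := fun ε => (ε : ℂ) • R (l + ε * Complex.I) ψ
  have hzim : ∀ ε : ℝ, ((l : ℂ) + ε * Complex.I).im = ε := fun ε => by simp
  have hpos : ∀ᶠ ε in (𝒰 : Filter ℝ), 0 < ε := h𝒰 self_mem_nhdsWithin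
  have hvb : ∀ᶠ ε in (𝒰 : Filter ℝ), ‖v ε‖ ≤ ‖ψ‖ := by
    filter_upwards [hpos] with ε hε
    have h1 := hR.norm_apply_le (z := l + ε * Complex.I) (by rw [hzim]; exact hε.ne') ψ
    rw [hzim, abs_of_pos hε, inv_mul_eq_div, le_div_iff₀ hε] at h1
    rw [norm_smul, Complex.norm_real, Real.norm_eq_abs, abs_of_pos hε, mul_comm]
    exact h1
  have hlim : ∀ n : ℤ, ∃ w, Tendsto (fun ε => ext0 (v ε) n) (𝒰 : Filter ℝ) (𝓝 w) := by
    intro n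
    have hc : IsCompact (Metric.closedBall (0 : EuclideanSpace ℂ (S n)) ‖ψ‖) :=
      isCompact_closedBall _ _
    obtain ⟨w, -, hw⟩ := hc.ultrafilter_le_nhds (𝒰.map fun ε => ext0 (v ε) n) (by
      rw [le_principal_iff]
      show ∀ᶠ ε in (𝒰 : Filter ℝ), ext0 (v ε) n ∈ Metric.closedBall _ _
      filter_upwards [hvb] with ε hε
      rw [mem_closedBall_zero_iff]
      exact (norm_ext0_le _ _).trans hε)
    exact ⟨w, hw⟩
  choose u hu using hlim
  have hε0 : Tendsto (fun ε : ℝ => (ε : ℂ)) (𝒰 : Filter ℝ) (𝓝 0) := by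
    have h1 : Tendsto (fun ε : ℝ => (ε : ℂ)) (𝓝 0) (𝓝 ((0 : ℝ) : ℂ)) :=
      Complex.continuous_ofReal.tendsto 0
    rw [Complex.ofReal_zero] at h1
    exact h1.mono_left (h𝒰.trans nhdsWithin_le_nhds)
  have hz : Tendsto (fun ε : ℝ => (l : ℂ) + ε * Complex.I) (𝒰 : Filter ℝ) (𝓝 (l : ℂ)) := by
    simpa using (hε0.mul_const Complex.I).const_add (l : ℂ)
  have hinner : ∀ g : ∀ n, EuclideanSpace ℂ (S n), ∀ n, Tendsto
      (fun ε => inner ℂ (g n) (ext0 (v ε) n)) (𝒰 : Filter ℝ) (𝓝 (inner ℂ (g n) (u n))) :=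
    fun g n => tendsto_const_nhds.inner (hu n)
  have hformal : ∀ n ∈ J, D.formal u n = (l : ℂ) • u n := by
    intro n hn
    have hV : Continuous (D.V n).toEuclideanLin := LinearMap.continuous_of_finiteDimensional _
    have h1 : Tendsto (fun ε => D.formal (ext0 (v ε)) n) (𝒰 : Filter ℝ) (𝓝 (D.formal u n)) :=
      ((((hinner D.Υ (n + 1)).const_mul _).neg.smul_const (D.Φ n)).sub
        (((hinner D.Φ (n - 1)).const_mul _).smul_const (D.Υ n))).add
          ((hV.tendsto (u n)).comp (hu n))
    have h2 : Tendsto (fun ε : ℝ => (ε : ℂ) • ext0 ψ n + ((l : ℂ) + ε * Complex.I) • ext0 (v ε) n)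
        (𝒰 : Filter ℝ) (𝓝 ((l : ℂ) • u n)) := by
      simpa using (hε0.smul_const (ext0 ψ n)).add (hz.smul (hu n))
    refine tendsto_nhds_unique_of_eventuallyEq h1 h2 ?_
    filter_upwards [hpos] with ε hε
    have h3 := resolvent_component hR (z := l + ε * Complex.I) (by rw [hzim]; exact hε.ne') ψ hn
    have h4 : ext0 (v ε) = fun n => (ε : ℂ) • ext0 (R (l + ε * Complex.I) ψ) n :=
      funext fun n => ext0_smul _ _ n
    rw [h4, formal_smul, h3]
    module
  have hu0 : ∀ n, n ∉ J → u n = 0 := by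
    intro n hn
    refine tendsto_nhds_unique (hu n) ?_
    simp only [ext0_of_notMem _ hn]
    exact tendsto_const_nhds
  have huK : ∀ n ∈ J, u n ∈ D.VV n := by
    intro n hn
    refine hKV n ((Submodule.closed_of_finiteDimensional (K n)).mem_of_tendsto (hu n) ?_)
    filter_upwards [hpos] with ε hε
    have h1 := resolvent_mem_blockSubmodule hK hR (z := l + ε * Complex.I)
      (by rw [hzim]; exact hε.ne') hψK
    rw [ext0_smul, ext0_of_mem _ hn]
    exact (K n).smul_mem _ (h1 ⟨n, hn⟩)
  have hchan : ∀ (n : J) (g : EuclideanSpace ℂ (S n)), NullFor R {l} (sgl n g) →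
      inner ℂ g (u n) = 0 := by
    intro n g hg
    have h1 := (tendsto_mul_inner_of_nullFor hR hg ψ).mono_left h𝒰
    refine tendsto_nhds_unique (tendsto_const_nhds.inner (hu n)) (h1.congr fun ε => ?_)
    rw [inner_sgl_left, ext0_smul, inner_smul_right]
  have hΦ0 : inner ℂ (D.Φ 0) (u 0) = 0 := by
    by_cases h0 : (0 : ℤ) ∈ J
    · exact hchan ⟨0, h0⟩ _ (hΦ h0)
    · rw [hu0 0 h0, inner_zero_right]
  have huz := eq_zero_of_formal hJ' hJ hdef hformal hu0 huK (hchan ⟨1, hJ 1 le_rfl⟩ _ hΥ) hΦ0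
  -- the atom at `l` is bounded by `ε Im ⟪ψ, R ψ⟫`, which tends to `0`
  have h5 : Tendsto (fun ε : ℝ => inner ℂ ψ (v ε)) (𝒰 : Filter ℝ) (𝓝 0) := by
    have : Tendsto (fun ε : ℝ => inner ℂ x (ext0 (v ε) k)) (𝒰 : Filter ℝ)
        (𝓝 (inner ℂ x (u k))) := tendsto_const_nhds.inner (hu k)
    rw [huz, inner_zero_right] at this
    refine this.congr fun ε => ?_
    rw [hψ, inner_sgl_left]
  have h6 : Tendsto (fun ε : ℝ => ENNReal.ofReal (inner ℂ ψ (v ε)).im) (𝒰 : Filter ℝ) (𝓝 0) := by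
    have := (ENNReal.continuous_ofReal.comp Complex.continuous_im).tendsto 0 |>.comp h5
    rw [show (ENNReal.ofReal ∘ Complex.im) 0 = 0 by simp] at this
    exact this
  refine le_antisymm (ge_of_tendsto h6 ?_) zero_le
  filter_upwards [hpos] with ε hε
  refine (measure_singleton_le (G := fun z => inner ℂ ψ (R z ψ)) h hε l).trans (le_of_eq ?_)
  congr 1
  rw [inner_smul_right, Complex.im_ofReal_mul]

end Data


/-! ### Pure absolute continuity for a fixed operator -/

theorem hasSum_sgl {S : ℤ → Type*} [∀ n, Fintype (S n)] {J : Set ℤ} (ψ : L2 S J) :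
    HasSum (fun n : J => sgl n (ψ n)) ψ := by
  classical
  have h := lp.hasSum_single (p := 2) (by norm_num) ψ
  convert! h using 2 with n

namespace Data

variable {S : ℤ → Type*} [∀ n, Fintype (S n)] [∀ n, DecidableEq (S n)] {D : Data S} {J : Set ℤ}
  {R : ℂ → L2 S J →L[ℂ] L2 S J}

/-- The exceptional points of the finitely many shells between the shell `k` and the origin carry at
most point masses, which are excluded separately. -/
theorem nullFor_sgl (hJ' : IsUpperSet J) (hJ : ∀ n : ℤ, 1 ≤ n → n ∈ J)
    (hR : IsResolvent (D.H J) R) {K : ∀ n, Submodule ℂ (EuclideanSpace ℂ (S n))}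
    (hK : D.Reduces J K) (hKV : ∀ n, K n ≤ D.VV n) {I : Set ℝ} (hI : IsOpen I)
    (hreg : D.Regular I) (hβ : ∀ n ∈ J, ∃ z, D.beta n z ≠ 0) {T : Set ℝ} (hT : MeasurableSet T)
    (hTI : T ⊆ I) (hT0 : volume T = 0)
    (hdef : ∀ l ∈ T, ∀ n ∈ J, D.TransferDefined n (l : ℂ))
    (k : J) {x : EuclideanSpace ℂ (S k)} (hx : x ∈ K k) : NullFor R T (sgl k x) := by
  obtain ⟨F, hFdef⟩ : ∃ F : Set ℝ, F = ⋃ j ∈ Set.Icc (k : ℤ) (max (k : ℤ) 0),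
    {l : ℝ | (l : ℂ) ∈ D.excSet j} := ⟨_, rfl⟩
  have hF : F.Finite := by
    rw [hFdef]
    refine (Set.finite_Icc _ _).biUnion fun j hj => ?_
    exact (finite_excSet (hβ j (hJ' hj.1 k.2))).preimage Complex.ofReal_injective.injOn
  have h1 : NullFor R (T \ F) (sgl k x) := by
    refine nullFor_of_controlled hJ hR hI hreg (hT.diff hF.measurableSet)
      (Set.sdiff_subset.trans hTI) (measure_mono_null Set.sdiff_subset hT0) fun l hl => ?_
    refine controlled_sgl hJ hJ' k x fun j h1 h2 h3 => hl.2 ?_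
    rw [hFdef]
    exact Set.mem_biUnion (show j ∈ Set.Icc (k : ℤ) (max (k : ℤ) 0) from ⟨h1, h2⟩) h3
  have hpt : ∀ l ∈ T, NullFor R {l} (sgl k x) := by
    intro l hl
    have hs : ({l} : Set ℝ) ⊆ I := Set.singleton_subset_iff.2 (hTI hl)
    refine nullFor_singleton_sgl hJ' hJ hR hK hKV (hdef l hl) ?_ (fun h0 => ?_) k hx
    · exact nullFor_of_controlled hJ hR hI hreg (measurableSet_singleton l) hs (by simp)
        fun x _ => controlled_Υ hJ x
    · exact nullFor_of_controlled hJ hR hI hreg (measurableSet_singleton l) hs (by simp)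
        fun x _ => controlled_Φ hJ h0 x
  intro μ hμ h
  have h2 : μ (T ∩ F) = 0 := by
    refine (measure_null_iff_singleton (hF.subset Set.inter_subset_right).countable).2
      fun l hl => hpt l hl.1 μ hμ h
  rw [← Set.sdiff_union_inter T F]
  exact measure_union_null (h1 μ hμ h) h2

/-- The vectors for which a fixed set is a spectral null set form a closed subspace. So it suffices
to consider vectors supported on a single shell. -/
theorem purelyACOn_of_regular (hJ' : IsUpperSet J) (hJ : ∀ n : ℤ, 1 ≤ n → n ∈ J)
    (hR : IsResolvent (D.H J) R) {K : ∀ n, Submodule ℂ (EuclideanSpace ℂ (S n))}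
    (hK : D.Reduces J K) (hKV : ∀ n, K n ≤ D.VV n) {I : Set ℝ} (hI : IsOpen I)
    (hreg : D.Regular I) :
    PurelyACOn (part (D.H J) (blockSubmodule J K)) {l ∈ I | (l : ℂ) ∉ D.B J} := by
  intro ψ
  obtain ⟨μ, hμ, -, h⟩ := hR.exists_measure (ψ : L2 S J)
  refine ⟨μ, isSpectralMeasure_part hK hR ψ hμ h, ?_⟩
  by_cases hβ : ∀ n ∈ J, ∃ z, D.beta n z ≠ 0
  swap
  · -- a broken channel: `B` is everything
    push Not at hβ
    obtain ⟨n, hn, hz⟩ := hβ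
    have hB : {l ∈ I | (l : ℂ) ∉ D.B J} = ∅ := by
      refine Set.eq_empty_iff_forall_notMem.2 fun l hl => hl.2 ?_
      refine Set.mem_biUnion hn fun hdef => ?_
      obtain ⟨z, hz'⟩ := hdef.1.exists_beta
      exact hz' (hz z)
    rw [hB, Measure.restrict_empty]
    exact Measure.AbsolutelyContinuous.zero _
  have hBc : (D.B J).Countable := by
    refine (Set.to_countable J).biUnion fun n hn => ?_
    refine (Set.Finite.countable (finite_excSet (hβ n hn))).mono fun z hz => ?_
    rcases A_subset_excSet hz with h1 | h1
    · exact absurd (hβ n hn) h1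
    · exact h1
  have hBm : MeasurableSet {l ∈ I | (l : ℂ) ∉ D.B J} :=
    hI.measurableSet.inter
      (Complex.measurable_ofReal hBc.measurableSet).compl
  refine Measure.AbsolutelyContinuous.mk fun N hN hN0 => ?_
  rw [Measure.restrict_apply hN]
  obtain ⟨T, hT⟩ : ∃ T : Set ℝ, T = N ∩ {l ∈ I | (l : ℂ) ∉ D.B J} := ⟨_, rfl⟩
  rw [← hT]
  have hTm : MeasurableSet T := hT ▸ hN.inter hBm
  have hTI : T ⊆ I := by rw [hT]; exact fun l hl => hl.2.1
  have hT0 : volume T = 0 := measure_mono_null (hT ▸ Set.inter_subset_left) hN0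
  have hdef : ∀ l ∈ T, ∀ n ∈ J, D.TransferDefined n (l : ℂ) := by
    intro l hl n hn
    rw [hT] at hl
    by_contra h1
    exact hl.2.2 (Set.mem_biUnion hn fun h2 => h1 h2.1)
  have hψ : NullFor R T (ψ : L2 S J) := by
    refine (isClosed_nullFor hR hTm).mem_of_tendsto (hasSum_sgl (ψ : L2 S J))
      (Eventually.of_forall fun s => ?_)
    classical
    induction s using Finset.induction_on with
    | empty => exact nullFor_zero R hTm
    | insert n s hn ih =>
      rw [Set.mem_ofPred_eq, Finset.sum_insert hn]
      exact NullFor.add hR hTm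
        (nullFor_sgl hJ' hJ hR hK hKV hI hreg hβ hTm hTI hT0 hdef n (ψ.2 n)) ih
  exact hψ μ hμ fun z hz => h z hz.ne'

variable (D) in
theorem purelyACOn_full (hsa : D.UniquelySelfAdjoint Set.univ) {I : Set ℝ} (hI : IsOpen I)
    (hreg : D.Regular I) :
    PurelyACOn (part (D.H Set.univ) D.fullSpace) {l ∈ I | (l : ℂ) ∉ D.B Set.univ} := by
  obtain ⟨R, hR⟩ := D.exists_isResolvent_full hsa
  exact purelyACOn_of_regular (fun _ _ _ _ => Set.mem_univ _) (fun _ _ => Set.mem_univ _) hR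
    D.reduces_full (fun _ => le_rfl) hI hreg

variable (D) in
theorem purelyACOn_half (hsa : D.UniquelySelfAdjoint Set.univ) {I : Set ℝ} (hI : IsOpen I)
    (hreg : D.Regular I) :
    PurelyACOn (part (D.H (Set.Ici 1)) D.halfSpace) {l ∈ I | (l : ℂ) ∉ D.B (Set.Ici 1)} := by
  obtain ⟨R, hR⟩ := D.exists_isResolvent_half hsa
  refine purelyACOn_of_regular (isUpperSet_Ici 1) (fun _ h => h) hR D.reduces_half (fun n => ?_) hI
    hreg
  by_cases h : n = 1
  · rw [if_pos h]; exact le_sup_right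
  · rw [if_neg h]

end Data


/-! ### Invariant quadratic forms of elliptic matrices -/

section Form

/-- The image of `x` under the real symmetric matrix with entries `α`, `β`, `γ`. -/
def covec (α β γ : ℝ) (x : Fin 2 → ℂ) : Fin 2 → ℂ := ![α * x 0 + β * x 1, β * x 0 + γ * x 1]

/-- The real part of the sesquilinear form on `ℂ²` given by a real symmetric matrix. -/
def rform (α β γ : ℝ) (x y : Fin 2 → ℂ) : ℝ :=
  (∑ i, starRingEnd ℂ (covec α β γ x i) * y i).re

variable {α β γ κ L : ℝ} {T : Matrix (Fin 2) (Fin 2) ℂ}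

theorem rform_eq (x y : Fin 2 → ℂ) : rform α β γ x y =
    (α * (x 0).re + β * (x 1).re) * (y 0).re + (α * (x 0).im + β * (x 1).im) * (y 0).im +
      ((β * (x 0).re + γ * (x 1).re) * (y 1).re + (β * (x 0).im + γ * (x 1).im) * (y 1).im) := by
  simp [rform, covec, Fin.sum_univ_two]
  ring

theorem rform_add_self (x y : Fin 2 → ℂ) : rform α β γ (x + y) (x + y) =
    rform α β γ x x + 2 * rform α β γ x y + rform α β γ y y := by
  simp only [rform_eq, Pi.add_apply, Complex.add_re, Complex.add_im]
  ring

theorem continuous_rform : Continuous fun x : Fin 2 → ℂ => rform α β γ x x := by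
  simp only [rform_eq]
  fun_prop

/-- A positive definite quadratic form that is invariant under `T`, with quantitative bounds. -/
structure IsInvariantForm (κ L : ℝ) (T : Matrix (Fin 2) (Fin 2) ℂ) (α β γ : ℝ) : Prop where
  κ_pos : 0 < κ
  abs_α_le : |α| ≤ L
  abs_β_le : |β| ≤ L
  abs_γ_le : |γ| ≤ L
  le : ∀ v : Fin 2 → ℂ, κ * ‖v‖ ^ 2 ≤ rform α β γ v v
  invariant : ∀ v : Fin 2 → ℂ, rform α β γ (T.mulVec v) (T.mulVec v) = rform α β γ v v

theorem norm_sq_le_sum (v : Fin 2 → ℂ) : ‖v‖ ^ 2 ≤ ‖v 0‖ ^ 2 + ‖v 1‖ ^ 2 := by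
  have h : ‖v‖ ≤ Real.sqrt (‖v 0‖ ^ 2 + ‖v 1‖ ^ 2) := by
    refine (pi_norm_le_iff_of_nonneg (Real.sqrt_nonneg _)).2 fun i => Real.le_sqrt_of_sq_le ?_
    fin_cases i
    · exact le_add_of_nonneg_right (sq_nonneg _)
    · exact le_add_of_nonneg_left (sq_nonneg _)
  exact (Real.le_sqrt (norm_nonneg _) (by positivity)).1 h

/-- A real matrix `!![a, b; c, d]` of determinant one preserves the form with the matrix
`!![c, (d - a) / 2; (d - a) / 2, -b]` of determinant `1 - (a + d)² / 4`. -/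
theorem exists_isInvariantForm (hT : T ∈ expSL2) {τ K : ℝ} (hτ : τ < 2) (htr : ‖T.trace‖ ≤ τ)
    (hK : ∀ i j, ‖T i j‖ ≤ K) :
    0 < (1 - τ ^ 2 / 4) / (2 * K) ∧
      ∃ α β γ, IsInvariantForm ((1 - τ ^ 2 / 4) / (2 * K)) K T α β γ := by
  obtain ⟨r, M, hdet, rfl⟩ := hT
  have hexp : ‖Complex.exp (r * Complex.I)‖ = 1 := Complex.norm_exp_ofReal_mul_I r
  obtain ⟨e, he⟩ : ∃ e : ℂ, e = Complex.exp (r * Complex.I) := ⟨_, rfl⟩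
  rw [← he] at hexp htr hK ⊢
  obtain ⟨a, ha⟩ : ∃ a, a = M 0 0 := ⟨_, rfl⟩
  obtain ⟨b, hb⟩ : ∃ b, b = M 0 1 := ⟨_, rfl⟩
  obtain ⟨c, hc⟩ : ∃ c, c = M 1 0 := ⟨_, rfl⟩
  obtain ⟨d, hd⟩ : ∃ d, d = M 1 1 := ⟨_, rfl⟩
  have hent : ∀ i j, |M i j| ≤ K := by
    intro i j
    have := hK i j
    rwa [Matrix.smul_apply, Matrix.map_apply, smul_eq_mul, norm_mul, hexp, one_mul,
      Complex.norm_real, Real.norm_eq_abs] at this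
  have hta : |a + d| ≤ τ := by
    rw [Matrix.trace_smul, Matrix.trace_fin_two, Matrix.map_apply, Matrix.map_apply, smul_eq_mul,
      norm_mul, hexp, one_mul, ← Complex.ofReal_add, Complex.norm_real, Real.norm_eq_abs, ← ha,
      ← hd] at htr
    exact htr
  have hτ0 : 0 ≤ τ := (abs_nonneg _).trans hta
  have hD : 0 < 1 - τ ^ 2 / 4 := by nlinarith
  have hsq : (a + d) ^ 2 ≤ τ ^ 2 := by rw [← sq_abs]; gcongr
  rw [Matrix.det_fin_two, ← ha, ← hb, ← hc, ← hd] at hdet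
  have hba := hent 0 1
  have hca := hent 1 0
  have haa := hent 0 0
  have hda := hent 1 1
  rw [← ha] at haa
  rw [← hb] at hba
  rw [← hc] at hca
  rw [← hd] at hda
  have hbc : (1 - τ ^ 2 / 4) + ((d - a) / 2) ^ 2 ≤ -(b * c) := by nlinarith
  have hc0 : c ≠ 0 := by
    rintro rfl
    nlinarith [sq_nonneg ((d - a) / 2)]
  have hcpos := abs_pos.2 hc0
  have hK0 : 0 < K := hcpos.trans_le hca
  -- the sign makes the form positive
  obtain ⟨σ, hσ1, hσ2⟩ : ∃ σ : ℝ, σ ^ 2 = 1 ∧ σ * c = |c| := by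
    rcases lt_or_gt_of_ne hc0 with h | h
    · exact ⟨-1, by norm_num, by rw [abs_of_neg h]; ring⟩
    · exact ⟨1, by norm_num, by rw [abs_of_pos h]; ring⟩
  have hσ3 : |σ| = 1 := by rwa [← sq_eq_sq₀ (abs_nonneg σ) zero_le_one, sq_abs, one_pow]
  obtain ⟨h, hh⟩ : ∃ h, h = (d - a) / 2 := ⟨_, rfl⟩
  refine ⟨by positivity, σ * c, σ * h, σ * -b, by positivity, ?_, ?_, ?_, fun v => ?_, fun v => ?_⟩
  · rw [abs_mul, hσ3, one_mul]; exact hca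
  · rw [abs_mul, hσ3, one_mul, hh, abs_div, abs_two]
    linarith [abs_sub d a]
  · rw [abs_mul, hσ3, one_mul, abs_neg]; exact hba
  · have hp : 0 < σ * c := hσ2 ▸ hcpos
    have hdet' : (1 - τ ^ 2 / 4) ≤ (σ * c) * (σ * -b) - (σ * h) ^ 2 := by
      have : (σ * c) * (σ * -b) - (σ * h) ^ 2 = σ ^ 2 * (-(b * c) - h ^ 2) := by ring
      rw [this, hσ1, one_mul, hh]
      linarith
    have hq : 0 < σ * -b := by
      by_contra h0
      have := mul_nonpos_of_nonneg_of_nonpos hp.le (not_lt.1 h0)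
      nlinarith [sq_nonneg (σ * h)]
    have htr2 : σ * c + σ * -b ≤ 2 * K := by
      have e1 : σ * c ≤ K := hσ2 ▸ hca
      have e2 : σ * -b ≤ |σ * -b| := le_abs_self _
      rw [abs_mul, hσ3, one_mul, abs_neg] at e2
      linarith
    have key : ∀ x y : ℝ, (1 - τ ^ 2 / 4) / (2 * K) * (x ^ 2 + y ^ 2) ≤
        (σ * c) * x ^ 2 + 2 * (σ * h) * x * y + (σ * -b) * y ^ 2 := by
      generalize σ * c = p at *
      generalize σ * -b = q at *
      generalize σ * h = k at *
      intro x y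
      have e1 : (1 - τ ^ 2 / 4) * (x ^ 2 + y ^ 2) ≤
          (p + q) * (p * x ^ 2 + 2 * k * x * y + q * y ^ 2) := by
        have := mul_le_mul_of_nonneg_right hdet' (add_nonneg (sq_nonneg x) (sq_nonneg y))
        nlinarith [sq_nonneg (p * x + k * y), sq_nonneg (k * x + q * y)]
      have e2 : 0 ≤ p * x ^ 2 + 2 * k * x * y + q * y ^ 2 := by
        by_contra h0
        have h1 := mul_neg_of_pos_of_neg (add_pos hp hq) (not_le.1 h0)
        have h2 : 0 ≤ (1 - τ ^ 2 / 4) * (x ^ 2 + y ^ 2) := by positivity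
        linarith
      rw [div_mul_eq_mul_div, div_le_iff₀ (by positivity)]
      have := mul_le_mul_of_nonneg_left htr2 e2
      linarith
    have h1 := key (v 0).re (v 1).re
    have h2 := key (v 0).im (v 1).im
    have h3 := mul_le_mul_of_nonneg_left (norm_sq_le_sum v)
      (show 0 ≤ (1 - τ ^ 2 / 4) / (2 * K) by positivity)
    rw [← Complex.normSq_eq_norm_sq, ← Complex.normSq_eq_norm_sq, Complex.normSq_apply,
      Complex.normSq_apply] at h3
    rw [rform_eq]
    linarith
  · have hM : ∀ i, (e • M.map (fun x : ℝ => (x : ℂ))).mulVec v i =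
        e * (M i 0 * v 0 + M i 1 * v 1) := by
      intro i
      simp [Matrix.mulVec, dotProduct, Fin.sum_univ_two]
      ring
    have he2 : e.re * e.re + e.im * e.im = 1 := by
      rw [← Complex.normSq_apply, Complex.normSq_eq_norm_sq, hexp, one_pow]
    have hphase : ∀ x : Fin 2 → ℂ, ∀ y : Fin 2 → ℂ, (∀ i, y i = e * x i) →
        rform (σ * c) (σ * h) (σ * -b) y y = rform (σ * c) (σ * h) (σ * -b) x x := by
      intro x y hy
      simp only [rform_eq, hy, Complex.mul_re, Complex.mul_im]
      generalize σ * c = p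
      generalize σ * -b = q
      generalize σ * h = k
      linear_combination (p * ((x 0).re ^ 2 + (x 0).im ^ 2) +
        2 * k * ((x 0).re * (x 1).re + (x 0).im * (x 1).im) +
        q * ((x 1).re ^ 2 + (x 1).im ^ 2)) * he2
    rw [hphase (fun i => M i 0 * v 0 + M i 1 * v 1) _ hM]
    simp only [rform_eq, ← ha, ← hb, ← hc, ← hd, Complex.add_re, Complex.add_im, Complex.mul_re,
      Complex.mul_im, Complex.ofReal_re, Complex.ofReal_im, zero_mul, sub_zero, add_zero]
    rw [hh]
    linear_combination σ * (c * ((v 0).re ^ 2 + (v 0).im ^ 2) +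
      (d - a) * ((v 0).re * (v 1).re + (v 0).im * (v 1).im) -
      b * ((v 1).re ^ 2 + (v 1).im ^ 2)) * hdet

theorem norm_mulVec_le (M : Matrix (Fin 2) (Fin 2) ℂ) (w : Fin 2 → ℂ) :
    ‖M.mulVec w‖ ≤ sumNorm M * ‖w‖ := by
  refine (pi_norm_le_iff_of_nonneg (mul_nonneg (sumNorm_nonneg M) (norm_nonneg w))).2 fun i => ?_
  have h1 : ‖M.mulVec w i‖ ≤ ∑ j, ‖M i j‖ * ‖w‖ := by
    refine (norm_sum_le Finset.univ fun j => M i j * w j).trans (Finset.sum_le_sum fun j _ => ?_)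
    rw [norm_mul]
    exact mul_le_mul_of_nonneg_left (norm_le_pi_norm w j) (norm_nonneg _)
  rw [← Finset.sum_mul] at h1
  refine h1.trans (mul_le_mul_of_nonneg_right ?_ (norm_nonneg w))
  exact Finset.single_le_sum (f := fun i => ∑ j, ‖M i j‖)
    (fun i _ => Finset.sum_nonneg fun j _ => norm_nonneg _) (Finset.mem_univ i)

namespace IsInvariantForm

theorem nonneg (h : IsInvariantForm κ L T α β γ) (v : Fin 2 → ℂ) : 0 ≤ rform α β γ v v :=
  le_trans (mul_nonneg h.κ_pos.le (sq_nonneg _)) (h.le v)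

theorem L_nonneg (h : IsInvariantForm κ L T α β γ) : 0 ≤ L := (abs_nonneg _).trans h.abs_α_le

theorem norm_covec_le (h : IsInvariantForm κ L T α β γ) (x : Fin 2 → ℂ) (i : Fin 2) :
    ‖covec α β γ x i‖ ≤ 2 * L * ‖x‖ := by
  have key : ∀ p q : ℝ, |p| ≤ L → |q| ≤ L → ‖(p : ℂ) * x 0 + q * x 1‖ ≤ 2 * L * ‖x‖ := by
    intro p q hp hq
    calc ‖(p : ℂ) * x 0 + q * x 1‖ ≤ |p| * ‖x 0‖ + |q| * ‖x 1‖ := by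
          refine (norm_add_le _ _).trans (le_of_eq ?_)
          rw [norm_mul, norm_mul, Complex.norm_real, Complex.norm_real, Real.norm_eq_abs,
            Real.norm_eq_abs]
      _ ≤ L * ‖x‖ + L * ‖x‖ := add_le_add
          (mul_le_mul hp (norm_le_pi_norm x 0) (norm_nonneg _) h.L_nonneg)
          (mul_le_mul hq (norm_le_pi_norm x 1) (norm_nonneg _) h.L_nonneg)
      _ = _ := by ring
  fin_cases i
  · exact key _ _ h.abs_α_le h.abs_β_le
  · exact key _ _ h.abs_β_le h.abs_γ_le

theorem abs_rform_le (h : IsInvariantForm κ L T α β γ) (x y : Fin 2 → ℂ) :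
    |rform α β γ x y| ≤ 4 * L * ‖x‖ * ‖y‖ := by
  refine (Complex.abs_re_le_norm _).trans ((norm_sum_le _ _).trans ?_)
  have h1 : ∀ i, ‖starRingEnd ℂ (covec α β γ x i) * y i‖ ≤ 2 * L * ‖x‖ * ‖y‖ := by
    intro i
    rw [norm_mul, RCLike.norm_conj]
    exact mul_le_mul (h.norm_covec_le x i) (norm_le_pi_norm y i) (norm_nonneg _)
      (mul_nonneg (mul_nonneg zero_le_two h.L_nonneg) (norm_nonneg x))
  rw [Fin.sum_univ_two]
  linarith [h1 0, h1 1]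

theorem le_norm_sq (h : IsInvariantForm κ L T α β γ) (v : Fin 2 → ℂ) :
    rform α β γ v v ≤ 4 * L * ‖v‖ ^ 2 := by
  have := (le_abs_self _).trans (h.abs_rform_le v v)
  linarith [show 4 * L * ‖v‖ * ‖v‖ = 4 * L * ‖v‖ ^ 2 by ring]

theorem sq_rform_le (h : IsInvariantForm κ L T α β γ) (x y : Fin 2 → ℂ) :
    rform α β γ x y ^ 2 ≤ rform α β γ x x * rform α β γ y y := by
  have hlin : ∀ s t : ℝ, 0 ≤ s ^ 2 * rform α β γ x x + 2 * s * t * rform α β γ x y +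
      t ^ 2 * rform α β γ y y := by
    intro s t
    have h1 := h.nonneg ((fun i => (s : ℂ) * x i) + fun i => (t : ℂ) * y i)
    refine h1.trans (le_of_eq ?_)
    rw [rform_add_self]
    simp only [rform_eq, Complex.mul_re, Complex.mul_im, Complex.ofReal_re, Complex.ofReal_im,
      zero_mul, sub_zero, add_zero]
    ring
  rcases (h.nonneg x).eq_or_lt with h0 | h0
  · have hx : ‖x‖ = 0 := by
      have h2 := h.le x
      rw [← h0] at h2
      have h3 : ‖x‖ ^ 2 ≤ 0 := by
        by_contra h4
        exact absurd h2 (not_le.2 (mul_pos h.κ_pos (not_le.1 h4)))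
      exact pow_eq_zero_iff two_ne_zero |>.1 (le_antisymm h3 (sq_nonneg _))
    have h5 := h.abs_rform_le x y
    rw [hx, mul_zero, zero_mul] at h5
    rw [abs_nonpos_iff.1 h5, ← h0]
    simp
  · have h6 := hlin (-rform α β γ x y) (rform α β γ x x)
    have h7 : 0 ≤ rform α β γ x x * (rform α β γ x x * rform α β γ y y - rform α β γ x y ^ 2) := by
      linarith [show rform α β γ x x * (rform α β γ x x * rform α β γ y y - rform α β γ x y ^ 2) =
        (-rform α β γ x y) ^ 2 * rform α β γ x x + 2 * -rform α β γ x y * rform α β γ x x *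
          rform α β γ x y + rform α β γ x x ^ 2 * rform α β γ y y by ring]
    have := nonneg_of_mul_nonneg_right h7 h0
    linarith

/-- One step of the product of perturbed matrices, up to terms of second order in the
perturbation `Y`. -/
theorem sq_rform_step_le (h : IsInvariantForm κ L T α β γ)
    (Y : Matrix (Fin 2) (Fin 2) ℂ) (w : Fin 2 → ℂ) :
    rform α β γ ((T + Y).mulVec w) ((T + Y).mulVec w) ^ 2 ≤ rform α β γ w w ^ 2 +
      4 * rform α β γ w w * rform α β γ (T.mulVec w) (Y.mulVec w) +
      (8 * (4 * L / κ) * sumNorm Y ^ 2 + 3 * (4 * L / κ) ^ 2 * sumNorm Y ^ 4) *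
        rform α β γ w w ^ 2 := by
  have hcs := h.sq_rform_le (T.mulVec w) (Y.mulVec w)
  have hq := h.nonneg w
  have hy := h.nonneg (Y.mulVec w)
  have hyle : rform α β γ (Y.mulVec w) (Y.mulVec w) ≤
      4 * L / κ * sumNorm Y ^ 2 * rform α β γ w w := by
    have h1 := h.le_norm_sq (Y.mulVec w)
    have h2 := norm_mulVec_le Y w
    have h3 : ‖Y.mulVec w‖ ^ 2 ≤ sumNorm Y ^ 2 * ‖w‖ ^ 2 := by
      rw [← mul_pow]; exact pow_le_pow_left₀ (norm_nonneg _) h2 2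
    have h4 : ‖w‖ ^ 2 ≤ rform α β γ w w / κ := by
      rw [le_div_iff₀ h.κ_pos, mul_comm]; exact h.le w
    have h5 : 0 ≤ 4 * L := by linarith [h.L_nonneg]
    calc _ ≤ 4 * L * (sumNorm Y ^ 2 * (rform α β γ w w / κ)) := by
          refine h1.trans (mul_le_mul_of_nonneg_left (h3.trans ?_) h5)
          exact mul_le_mul_of_nonneg_left h4 (sq_nonneg _)
      _ = _ := by ring
  rw [Matrix.add_mulVec, rform_add_self, h.invariant w]
  rw [h.invariant w] at hcs
  generalize rform α β γ w w = q at *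
  generalize rform α β γ (Y.mulVec w) (Y.mulVec w) = r at *
  generalize rform α β γ (T.mulVec w) (Y.mulVec w) = B at *
  obtain ⟨ρ, hρ⟩ : ∃ ρ, ρ = 4 * L / κ * sumNorm Y ^ 2 := ⟨_, rfl⟩
  have e1 : 8 * (4 * L / κ) * sumNorm Y ^ 2 + 3 * (4 * L / κ) ^ 2 * sumNorm Y ^ 4 =
      8 * ρ + 3 * ρ ^ 2 := by rw [hρ]; ring
  rw [e1]
  rw [← hρ] at hyle
  have e2 : (q + 2 * B + r) ^ 2 ≤ q ^ 2 + 4 * q * B + 8 * (q * r) + 3 * r ^ 2 := by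
    nlinarith [sq_nonneg (B - r)]
  have e3 : q * r ≤ ρ * q ^ 2 := by
    have := mul_le_mul_of_nonneg_left hyle hq
    linarith [show q * (ρ * q) = ρ * q ^ 2 by ring]
  have e4 : r ^ 2 ≤ ρ ^ 2 * q ^ 2 := by
    rw [← mul_pow]; exact pow_le_pow_left₀ hy hyle 2
  linarith [show (8 * ρ + 3 * ρ ^ 2) * q ^ 2 = 8 * (ρ * q ^ 2) + 3 * (ρ ^ 2 * q ^ 2) by ring]

theorem rform_mulVec (Y : Matrix (Fin 2) (Fin 2) ℂ) (x w : Fin 2 → ℂ) :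
    rform α β γ x (Y.mulVec w) =
      ∑ i, ∑ j, (Y i j * (starRingEnd ℂ (covec α β γ x i) * w j)).re := by
  simp only [rform, Matrix.mulVec, dotProduct, Finset.mul_sum, Complex.re_sum]
  exact Finset.sum_congr rfl fun i _ => Finset.sum_congr rfl fun j _ => by congr 1; ring

theorem norm_coeff_le (h : IsInvariantForm κ L T α β γ) (w : Fin 2 → ℂ) (i j : Fin 2) :
    ‖starRingEnd ℂ (covec α β γ (T.mulVec w) i) * w j‖ ≤ 2 * L / κ * rform α β γ w w := by
  have h1 : κ * ‖T.mulVec w‖ ^ 2 ≤ rform α β γ w w := h.invariant w ▸ h.le (T.mulVec w)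
  have h2 := h.le w
  have h3 : κ * (‖T.mulVec w‖ * ‖w‖) ≤ rform α β γ w w := by
    nlinarith [mul_nonneg h.κ_pos.le (sq_nonneg (‖T.mulVec w‖ - ‖w‖))]
  rw [norm_mul, RCLike.norm_conj]
  calc _ ≤ 2 * L * ‖T.mulVec w‖ * ‖w‖ := mul_le_mul (h.norm_covec_le _ i) (norm_le_pi_norm w j)
        (norm_nonneg _) (mul_nonneg (mul_nonneg zero_le_two h.L_nonneg) (norm_nonneg _))
    _ = 2 * L / κ * (κ * (‖T.mulVec w‖ * ‖w‖)) := by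
        field_simp [h.κ_pos.ne']
    _ ≤ _ := mul_le_mul_of_nonneg_left h3
        (div_nonneg (mul_nonneg zero_le_two h.L_nonneg) h.κ_pos.le)

end IsInvariantForm

end Form


/-! ### Moments of products of independent random matrices -/

section Moments

variable {Ω : Type*} [MeasurableSpace Ω] {P : Measure Ω}

theorem integrable_norm_pow {f : Ω → ℂ} (hf : Measurable f) {k : ℕ} {c : ℝ} (hc : 0 ≤ c)
    (h : ∫⁻ ω, ‖f ω‖ₑ ^ k ∂P ≤ ENNReal.ofReal c) :
    Integrable (fun ω => ‖f ω‖ ^ k) P ∧ ∫ ω, ‖f ω‖ ^ k ∂P ≤ c := by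
  have hm : AEStronglyMeasurable (fun ω => ‖f ω‖ ^ k) P :=
    (hf.norm.pow_const k).aestronglyMeasurable
  have h1 : ∫⁻ ω, ENNReal.ofReal (‖f ω‖ ^ k) ∂P ≤ ENNReal.ofReal c := by
    refine le_trans (le_of_eq (lintegral_congr fun ω => ?_)) h
    rw [ENNReal.ofReal_pow (norm_nonneg _), ofReal_norm]
  have h0 : 0 ≤ᵐ[P] fun ω => ‖f ω‖ ^ k := Eventually.of_forall fun ω => by positivity
  refine ⟨⟨hm, ?_⟩, ?_⟩
  · rw [hasFiniteIntegral_iff_ofReal h0]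
    exact h1.trans_lt ENNReal.ofReal_lt_top
  · rw [integral_eq_lintegral_of_nonneg_ae h0 hm]
    exact ENNReal.toReal_le_of_le_ofReal hc h1

theorem integrable_of_norm_sq [IsFiniteMeasure P] {f : Ω → ℂ} (hf : Measurable f)
    (h : Integrable (fun ω => ‖f ω‖ ^ 2) P) : Integrable f P := by
  refine ((integrable_const (1 : ℝ)).add h).mono' hf.aestronglyMeasurable
    (Eventually.of_forall fun ω => ?_)
  show ‖f ω‖ ≤ 1 + ‖f ω‖ ^ 2
  nlinarith [sq_nonneg (‖f ω‖ - 1)]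

theorem sq_sumNorm_le (Y : Matrix (Fin 2) (Fin 2) ℂ) :
    sumNorm Y ^ 2 ≤ 4 * ∑ i, ∑ j, ‖Y i j‖ ^ 2 := by
  simp only [sumNorm, Fin.sum_univ_two]
  nlinarith [sq_nonneg (‖Y 0 0‖ - ‖Y 0 1‖), sq_nonneg (‖Y 1 0‖ - ‖Y 1 1‖),
    sq_nonneg (‖Y 0 0‖ + ‖Y 0 1‖ - (‖Y 1 0‖ + ‖Y 1 1‖))]

theorem pow_four_sumNorm_le (Y : Matrix (Fin 2) (Fin 2) ℂ) :
    sumNorm Y ^ 4 ≤ 64 * ∑ i, ∑ j, ‖Y i j‖ ^ 4 := by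
  have h1 : sumNorm Y ^ 4 ≤ (4 * ∑ i, ∑ j, ‖Y i j‖ ^ 2) ^ 2 := by
    rw [show sumNorm Y ^ 4 = (sumNorm Y ^ 2) ^ 2 by ring]
    exact pow_le_pow_left₀ (sq_nonneg _) (sq_sumNorm_le Y) 2
  refine h1.trans ?_
  simp only [Fin.sum_univ_two]
  nlinarith [sq_nonneg (‖Y 0 0‖ ^ 2 - ‖Y 0 1‖ ^ 2), sq_nonneg (‖Y 1 0‖ ^ 2 - ‖Y 1 1‖ ^ 2),
    sq_nonneg (‖Y 0 0‖ ^ 2 + ‖Y 0 1‖ ^ 2 - (‖Y 1 0‖ ^ 2 + ‖Y 1 1‖ ^ 2))]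

variable {α β γ κ L : ℝ} {T : Matrix (Fin 2) (Fin 2) ℂ}

theorem continuous_coeff (i j : Fin 2) : Continuous fun w : Fin 2 → ℂ =>
    starRingEnd ℂ (covec α β γ (T.mulVec w) i) * w j := by
  have h : Continuous fun w : Fin 2 → ℂ => covec α β γ (T.mulVec w) i := by
    fin_cases i <;> simp [covec, Matrix.mulVec, dotProduct, Fin.sum_univ_two] <;> fun_prop
  exact (Complex.continuous_conj.comp h).mul (continuous_apply j)

theorem measurable_mulVec {X : Ω → Matrix (Fin 2) (Fin 2) ℂ} {w : Ω → Fin 2 → ℂ}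
    (hX : ∀ i j, Measurable fun ω => X ω i j) (hw : Measurable w) :
    Measurable fun ω => (X ω).mulVec (w ω) := by
  refine measurable_pi_iff.2 fun i => ?_
  show Measurable fun ω => ∑ j, X ω i j * w ω j
  exact Finset.measurable_sum _ fun j _ => (hX i j).mul ((measurable_pi_apply j).comp hw)

/-- Multiplication by an independent, well-balanced small perturbation of `T` increases the second
moment of the invariant form only by a small factor: the first order term is evaluated with the mean
of the perturbation. -/
theorem IsInvariantForm.integral_step_le [IsProbabilityMeasure P]
    (h : IsInvariantForm κ L T α β γ) {w : Ω → Fin 2 → ℂ} {Y : Ω → Matrix (Fin 2) (Fin 2) ℂ}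
    (hw : Measurable w) (hY : ∀ i j, Measurable fun ω => Y ω i j)
    (hind : IndepFun w (fun ω (i j : Fin 2) => Y ω i j) P)
    (hint : Integrable (fun ω => rform α β γ (w ω) (w ω) ^ 2) P) {e₁ e₂ e₄ : ℝ} (he₂ : 0 ≤ e₂)
    (he₄ : 0 ≤ e₄) (h1 : ∀ i j, ‖∫ ω, Y ω i j ∂P‖ ≤ e₁)
    (h2 : ∀ i j, ∫⁻ ω, ‖Y ω i j‖ₑ ^ 2 ∂P ≤ ENNReal.ofReal e₂)
    (h4 : ∀ i j, ∫⁻ ω, ‖Y ω i j‖ₑ ^ 4 ∂P ≤ ENNReal.ofReal e₄) :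
    Integrable (fun ω => rform α β γ ((T + Y ω).mulVec (w ω)) ((T + Y ω).mulVec (w ω)) ^ 2) P ∧
      ∫ ω, rform α β γ ((T + Y ω).mulVec (w ω)) ((T + Y ω).mulVec (w ω)) ^ 2 ∂P ≤
        (1 + (16 * (2 * L / κ) * e₁ + 8 * (4 * L / κ) * (16 * e₂) +
          3 * (4 * L / κ) ^ 2 * (256 * e₄))) * ∫ ω, rform α β γ (w ω) (w ω) ^ 2 ∂P := by
  have hρ : 0 ≤ 4 * L / κ := div_nonneg (by linarith [h.L_nonneg]) h.κ_pos.le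
  have hL : 0 ≤ 2 * L / κ := div_nonneg (by linarith [h.L_nonneg]) h.κ_pos.le
  obtain ⟨q, hq⟩ : ∃ q : Ω → ℝ, q = fun ω => rform α β γ (w ω) (w ω) := ⟨_, rfl⟩
  have hqm : Measurable q := hq ▸ continuous_rform.measurable.comp hw
  have hqint : Integrable (fun ω => q ω ^ 2) P := by rw [hq]; exact hint
  have hq0 : ∀ ω, 0 ≤ q ω := fun ω => hq ▸ h.nonneg _
  -- the coefficient of `Yᵢⱼ` in the first order term
  let g : Fin 2 → Fin 2 → (Fin 2 → ℂ) → ℂ := fun i j x =>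
    rform α β γ x x * (starRingEnd ℂ (covec α β γ (T.mulVec x) i) * x j)
  have hgm : ∀ i j, Measurable (g i j) := fun i j =>
    ((Complex.continuous_ofReal.comp continuous_rform).mul (continuous_coeff i j)).measurable
  have hgb : ∀ i j ω, ‖g i j (w ω)‖ ≤ 2 * L / κ * q ω ^ 2 := by
    intro i j ω
    have e := h.norm_coeff_le (w ω) i j
    have e0 := h.nonneg (w ω)
    show ‖(rform α β γ (w ω) (w ω) : ℂ) * _‖ ≤ _
    rw [norm_mul, Complex.norm_real, Real.norm_eq_abs, abs_of_nonneg e0, hq]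
    calc _ ≤ rform α β γ (w ω) (w ω) * (2 * L / κ * rform α β γ (w ω) (w ω)) :=
          mul_le_mul_of_nonneg_left e e0
      _ = _ := by ring
  have hgint : ∀ i j, Integrable (fun ω => g i j (w ω)) P := fun i j =>
    (hqint.const_mul _).mono' ((hgm i j).comp hw).aestronglyMeasurable
      (Eventually.of_forall (hgb i j))
  have hY2 := fun i j => integrable_norm_pow (hY i j) he₂ (h2 i j)
  have hY4 := fun i j => integrable_norm_pow (hY i j) he₄ (h4 i j)
  have hY1 : ∀ i j, Integrable (fun ω => Y ω i j) P := fun i j =>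
    integrable_of_norm_sq (hY i j) (hY2 i j).1
  have hYij : ∀ i j, Measurable fun M : Fin 2 → Fin 2 → ℂ => M i j := fun i j =>
    (measurable_pi_apply j).comp (measurable_pi_apply i)
  have hind1 : ∀ i j, IndepFun (fun ω => Y ω i j) (fun ω => g i j (w ω)) P := fun i j =>
    (hind.comp (hgm i j) (hYij i j)).symm
  have hindk : ∀ i j (k : ℕ), IndepFun (fun ω => ‖Y ω i j‖ ^ k) (fun ω => q ω ^ 2) P := by
    intro i j k
    have e1 : Measurable fun x : Fin 2 → ℂ => rform α β γ x x ^ 2 :=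
      continuous_rform.measurable.pow_const 2
    have := (hind.comp e1 ((hYij i j).norm.pow_const k)).symm
    rw [hq]
    exact this
  have hYg : ∀ i j, Integrable (fun ω => Y ω i j * g i j (w ω)) P := fun i j =>
    (hind1 i j).integrable_mul (hY1 i j) (hgint i j)
  have hI1 : ∀ i j, ∫ ω, (Y ω i j * g i j (w ω)).re ∂P ≤
      e₁ * (2 * L / κ * ∫ ω, q ω ^ 2 ∂P) := by
    intro i j
    have e1 : ∫ ω, (Y ω i j * g i j (w ω)).re ∂P = (∫ ω, Y ω i j * g i j (w ω) ∂P).re :=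
      integral_re (hYg i j)
    have e2 : ∫ ω, Y ω i j * g i j (w ω) ∂P = (∫ ω, Y ω i j ∂P) * ∫ ω, g i j (w ω) ∂P :=
      (hind1 i j).integral_mul_eq_mul_integral (hY i j).aestronglyMeasurable
        ((hgm i j).comp hw).aestronglyMeasurable
    rw [e1, e2]
    refine (Complex.re_le_norm _).trans ?_
    rw [norm_mul]
    refine mul_le_mul (h1 i j) ?_ (norm_nonneg _) ((norm_nonneg _).trans (h1 i j))
    refine (norm_integral_le_integral_norm _).trans ?_
    rw [← integral_const_mul]
    exact integral_mono (hgint i j).norm (hqint.const_mul _) (hgb i j)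
  have hYk : ∀ i j (k : ℕ), Integrable (fun ω => ‖Y ω i j‖ ^ k) P →
      Integrable (fun ω => ‖Y ω i j‖ ^ k * q ω ^ 2) P := fun i j k hk =>
    (hindk i j k).integrable_mul hk hqint
  have hIk : ∀ i j (k : ℕ) {e : ℝ}, ∫ ω, ‖Y ω i j‖ ^ k ∂P ≤ e →
      ∫ ω, ‖Y ω i j‖ ^ k * q ω ^ 2 ∂P ≤ e * ∫ ω, q ω ^ 2 ∂P := by
    intro i j k e hk
    have e2 : ∫ ω, ‖Y ω i j‖ ^ k * q ω ^ 2 ∂P = (∫ ω, ‖Y ω i j‖ ^ k ∂P) * ∫ ω, q ω ^ 2 ∂P :=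
      (hindk i j k).integral_mul_eq_mul_integral ((hY i j).norm.pow_const k).aestronglyMeasurable
        (hqm.pow_const 2).aestronglyMeasurable
    rw [e2]
    exact mul_le_mul_of_nonneg_right hk (integral_nonneg fun ω => sq_nonneg _)
  -- the integrable upper bound for the new value of the form
  let A : Ω → ℝ := fun ω => ∑ i, ∑ j, (Y ω i j * g i j (w ω)).re
  let B : ℕ → Ω → ℝ := fun k ω => ∑ i, ∑ j, ‖Y ω i j‖ ^ k * q ω ^ 2
  have hYre : ∀ i j, Integrable (fun ω => (Y ω i j * g i j (w ω)).re) P := fun i j => (hYg i j).re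
  have hA : Integrable A P := integrable_finsetSum _ fun i _ => integrable_finsetSum _ fun j _ =>
    hYre i j
  have hB2 : Integrable (B 2) P := integrable_finsetSum _ fun i _ =>
    integrable_finsetSum _ fun j _ => hYk i j 2 (hY2 i j).1
  have hB4 : Integrable (B 4) P := integrable_finsetSum _ fun i _ =>
    integrable_finsetSum _ fun j _ => hYk i j 4 (hY4 i j).1
  have hIA : ∫ ω, A ω ∂P ≤ 4 * (e₁ * (2 * L / κ * ∫ ω, q ω ^ 2 ∂P)) := by
    show ∫ ω, ∑ i, ∑ j, (Y ω i j * g i j (w ω)).re ∂P ≤ _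
    rw [integral_finsetSum _ fun i _ => integrable_finsetSum _ fun j _ => hYre i j]
    simp_rw [fun i => integral_finsetSum (μ := P) Finset.univ
      (f := fun j ω => (Y ω i j * g i j (w ω)).re) fun j _ => hYre i j]
    simp only [Fin.sum_univ_two]
    linarith [hI1 0 0, hI1 0 1, hI1 1 0, hI1 1 1]
  have hIB : ∀ (k : ℕ) {e : ℝ}, (∀ i j, Integrable (fun ω => ‖Y ω i j‖ ^ k) P ∧
      ∫ ω, ‖Y ω i j‖ ^ k ∂P ≤ e) → ∫ ω, B k ω ∂P ≤ 4 * (e * ∫ ω, q ω ^ 2 ∂P) := by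
    intro k e hk
    show ∫ ω, ∑ i, ∑ j, ‖Y ω i j‖ ^ k * q ω ^ 2 ∂P ≤ _
    rw [integral_finsetSum _ fun i _ => integrable_finsetSum _ fun j _ => hYk i j k (hk i j).1]
    simp_rw [fun i => integral_finsetSum (μ := P) Finset.univ
      (f := fun j ω => ‖Y ω i j‖ ^ k * q ω ^ 2) fun j _ => hYk i j k (hk i j).1]
    simp only [Fin.sum_univ_two]
    linarith [hIk 0 0 k (hk 0 0).2, hIk 0 1 k (hk 0 1).2, hIk 1 0 k (hk 1 0).2,
      hIk 1 1 k (hk 1 1).2]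
  have hbound : ∀ ω, rform α β γ ((T + Y ω).mulVec (w ω)) ((T + Y ω).mulVec (w ω)) ^ 2 ≤
      q ω ^ 2 + 4 * A ω + 8 * (4 * L / κ) * (4 * B 2 ω) +
        3 * (4 * L / κ) ^ 2 * (64 * B 4 ω) := by
    intro ω
    have e1 := h.sq_rform_step_le (Y ω) (w ω)
    have e2 : 4 * rform α β γ (w ω) (w ω) * rform α β γ (T.mulVec (w ω)) ((Y ω).mulVec (w ω)) =
        4 * A ω := by
      rw [IsInvariantForm.rform_mulVec, mul_assoc, Finset.mul_sum]
      congr 1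
      refine Finset.sum_congr rfl fun i _ => ?_
      rw [Finset.mul_sum]
      refine Finset.sum_congr rfl fun j _ => ?_
      rw [← Complex.re_ofReal_mul]
      congr 1
      simp only [g]
      ring
    have e3 := mul_le_mul_of_nonneg_right (sq_sumNorm_le (Y ω)) (sq_nonneg (q ω))
    have e4 := mul_le_mul_of_nonneg_right (pow_four_sumNorm_le (Y ω)) (sq_nonneg (q ω))
    have e5 : ∀ k, (∑ i, ∑ j, ‖Y ω i j‖ ^ k) * q ω ^ 2 = B k ω := by
      intro k
      simp only [B, Finset.sum_mul]
    rw [mul_assoc, e5] at e3 e4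
    rw [e2] at e1
    have hqω : rform α β γ (w ω) (w ω) = q ω := by rw [hq]
    rw [hqω] at e1
    have e6 := mul_le_mul_of_nonneg_left e3 (by positivity : 0 ≤ 8 * (4 * L / κ))
    have e7 := mul_le_mul_of_nonneg_left e4 (by positivity : 0 ≤ 3 * (4 * L / κ) ^ 2)
    linarith
  have i1 : Integrable (fun ω => q ω ^ 2 + 4 * A ω) P := hqint.add (hA.const_mul 4)
  have i2 : Integrable (fun ω => q ω ^ 2 + 4 * A ω + 8 * (4 * L / κ) * (4 * B 2 ω)) P :=
    i1.add ((hB2.const_mul 4).const_mul _)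
  have hBint : Integrable (fun ω => q ω ^ 2 + 4 * A ω + 8 * (4 * L / κ) * (4 * B 2 ω) +
        3 * (4 * L / κ) ^ 2 * (64 * B 4 ω)) P :=
    i2.add ((hB4.const_mul 64).const_mul _)
  have hTY : ∀ i j, Measurable fun ω => (T + Y ω) i j := fun i j =>
    measurable_const.add (hY i j)
  have hnew : Integrable
      (fun ω => rform α β γ ((T + Y ω).mulVec (w ω)) ((T + Y ω).mulVec (w ω)) ^ 2) P :=
    hBint.mono' ((continuous_rform.measurable.comp
      (measurable_mulVec hTY hw)).pow_const 2).aestronglyMeasurable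
      (Eventually.of_forall fun ω => by
        rw [Real.norm_eq_abs, abs_of_nonneg (sq_nonneg _)]; exact hbound ω)
  refine ⟨hnew, (integral_mono hnew hBint hbound).trans ?_⟩
  rw [integral_add i2 ((hB4.const_mul 64).const_mul _),
    integral_add i1 ((hB2.const_mul 4).const_mul _),
    integral_add hqint (hA.const_mul 4), integral_const_mul, integral_const_mul,
    integral_const_mul, integral_const_mul, integral_const_mul]
  have f2 := mul_le_mul_of_nonneg_left (hIB 2 hY2) (by positivity : 0 ≤ 8 * (4 * L / κ) * 4)
  have f4 := mul_le_mul_of_nonneg_left (hIB 4 hY4) (by positivity : 0 ≤ 3 * (4 * L / κ) ^ 2 * 64)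
  have hqq : ∫ ω, rform α β γ (w ω) (w ω) ^ 2 ∂P = ∫ ω, q ω ^ 2 ∂P := by rw [hq]
  rw [hqq]
  generalize ∫ ω, q ω ^ 2 ∂P = Q at *
  generalize 4 * L / κ = ρ at *
  generalize 2 * L / κ = ρ' at *
  linarith

/-- The product `X_{m-1} ⋯ X_0`. -/
def seqProd (X : ℕ → Matrix (Fin 2) (Fin 2) ℂ) : ℕ → Matrix (Fin 2) (Fin 2) ℂ
  | 0 => 1
  | m + 1 => X m * seqProd X m

theorem seqProd_congr {X X' : ℕ → Matrix (Fin 2) (Fin 2) ℂ} {m : ℕ} (h : ∀ k < m, X k = X' k) :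
    seqProd X m = seqProd X' m := by
  induction m with
  | zero => rfl
  | succ m ih =>
    rw [seqProd, seqProd, h m (Nat.lt_succ_self m),
      ih fun k hk => h k (hk.trans (Nat.lt_succ_self m))]

theorem measurable_seqProd {Ω : Type*} [MeasurableSpace Ω] {X : ℕ → Ω → Matrix (Fin 2) (Fin 2) ℂ}
    (hX : ∀ k i j, Measurable fun ω => X k ω i j) (m : ℕ) (i j : Fin 2) :
    Measurable fun ω => seqProd (fun k => X k ω) m i j := by
  induction m generalizing i with
  | zero => exact measurable_const
  | succ m ih =>
    simp only [seqProd, Matrix.mul_apply]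
    exact Finset.measurable_sum _ fun k _ => (hX m i k).mul (ih k)

theorem indepFun_seqProd {X : ℕ → Ω → Matrix (Fin 2) (Fin 2) ℂ}
    (hX : ∀ k i j, Measurable fun ω => X k ω i j)
    (hind : iIndepFun (fun (k : ℕ) ω (i j : Fin 2) => X k ω i j) P) (v : Fin 2 → ℂ) (m : ℕ) :
    IndepFun (fun ω => (seqProd (fun k => X k ω) m).mulVec v)
      (fun ω (i j : Fin 2) => X m ω i j) P := by
  have h1 := hind.indepFun_finset (Finset.range m) {m} (by simp) fun k =>
    measurable_pi_iff.2 fun i => measurable_pi_iff.2 fun j => hX k i j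
  -- the product as a function of the first `m` matrices
  let ext : (Finset.range m → Fin 2 → Fin 2 → ℂ) → ℕ → Matrix (Fin 2) (Fin 2) ℂ := fun Z k =>
    if hk : k ∈ Finset.range m then Matrix.of (Z ⟨k, hk⟩) else 0
  have hext : ∀ k i j, Measurable fun Z => ext Z k i j := by
    intro k i j
    by_cases hk : k ∈ Finset.range m
    · simp only [ext, dif_pos hk]
      exact (measurable_pi_apply j).comp ((measurable_pi_apply i).comp (measurable_pi_apply _))
    · simp only [ext, dif_neg hk]
      exact measurable_const
  have hφ : Measurable fun Z : Finset.range m → Fin 2 → Fin 2 → ℂ =>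
      (seqProd (ext Z) m).mulVec v :=
    measurable_mulVec (fun i j => measurable_seqProd (X := fun k Z => ext Z k) hext m i j)
      measurable_const
  have hχ : Measurable fun Z : ({m} : Finset ℕ) → Fin 2 → Fin 2 → ℂ =>
      Z ⟨m, Finset.mem_singleton_self m⟩ := measurable_pi_apply _
  have h2 := h1.comp hφ hχ
  refine h2.congr (Eventually.of_forall fun ω => ?_) (Eventually.of_forall fun ω => rfl)
  show (seqProd (ext fun i => X i ω) m).mulVec v = _
  rw [seqProd_congr (X' := fun k => X k ω)]
  intro k hk
  simp only [ext, dif_pos (Finset.mem_range.2 hk)]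
  rfl

/-- The second moment of the invariant form stays bounded along the products if the sum of the
second order errors is bounded. -/
theorem IsInvariantForm.integral_seqProd_le [IsProbabilityMeasure P]
    (h : IsInvariantForm κ L T α β γ) {X : ℕ → Ω → Matrix (Fin 2) (Fin 2) ℂ}
    (hX : ∀ k i j, Measurable fun ω => X k ω i j)
    (hind : iIndepFun (fun (k : ℕ) ω (i j : Fin 2) => X k ω i j) P) {e₁ e₂ e₄ s : ℕ → ℝ}
    (he₂ : ∀ k, 0 ≤ e₂ k) (he₄ : ∀ k, 0 ≤ e₄ k)
    (h1 : ∀ k i j, ‖∫ ω, X k ω i j ∂P - T i j‖ ≤ e₁ k)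
    (h2 : ∀ k i j, ∫⁻ ω, ‖X k ω i j - T i j‖ₑ ^ 2 ∂P ≤ ENNReal.ofReal (e₂ k))
    (h4 : ∀ k i j, ∫⁻ ω, ‖X k ω i j - T i j‖ₑ ^ 4 ∂P ≤ ENNReal.ofReal (e₄ k))
    (hs : ∀ k, 16 * (2 * L / κ) * e₁ k + 8 * (4 * L / κ) * (16 * e₂ k) +
      3 * (4 * L / κ) ^ 2 * (256 * e₄ k) ≤ s k) (v : Fin 2 → ℂ) (m : ℕ) :
    Integrable (fun ω => rform α β γ ((seqProd (fun k => X k ω) m).mulVec v)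
        ((seqProd (fun k => X k ω) m).mulVec v) ^ 2) P ∧
      ∫ ω, rform α β γ ((seqProd (fun k => X k ω) m).mulVec v)
        ((seqProd (fun k => X k ω) m).mulVec v) ^ 2 ∂P ≤
          Real.exp (∑ k ∈ Finset.range m, s k) * rform α β γ v v ^ 2 := by
  induction m with
  | zero => simp [seqProd]
  | succ m ih =>
    have hm : ∀ i j, Measurable fun ω => X m ω i j - T i j := fun i j =>
      (hX m i j).sub measurable_const
    have hm2 : ∀ i j, Integrable (fun ω => X m ω i j) P := fun i j => by
      have e1 := integrable_of_norm_sq (hm i j) (integrable_norm_pow (hm i j) (he₂ m) (h2 m i j)).1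
      have e2 := e1.add (integrable_const (T i j))
      refine e2.congr (Eventually.of_forall fun ω => ?_)
      simp
    have hsub : Measurable fun (M : Fin 2 → Fin 2 → ℂ) (i j : Fin 2) => M i j - T i j :=
      measurable_pi_iff.2 fun i => measurable_pi_iff.2 fun j =>
        Measurable.sub_const (f := fun M : Fin 2 → Fin 2 → ℂ => M i j)
          ((measurable_pi_apply j).comp (measurable_pi_apply i)) (T i j)
    have hind' : IndepFun (fun ω => (seqProd (fun k => X k ω) m).mulVec v)
        (fun ω (i j : Fin 2) => (X m ω - T) i j) P :=
      (indepFun_seqProd hX hind v m).comp measurable_id hsub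
    have hstep := h.integral_step_le (P := P) (Y := fun ω => X m ω - T)
      (measurable_mulVec (measurable_seqProd hX m) measurable_const) hm hind' ih.1 (he₂ m) (he₄ m)
      (e₁ := e₁ m) (fun i j => by
        simp only [Matrix.sub_apply]
        rw [integral_sub (hm2 i j) (integrable_const _), integral_const, probReal_univ, one_smul]
        exact h1 m i j) (h2 m) (h4 m)
    have hmul : ∀ ω, (T + (X m ω - T)).mulVec ((seqProd (fun k => X k ω) m).mulVec v) =
        (seqProd (fun k => X k ω) (m + 1)).mulVec v := by
      intro ω
      rw [add_sub_cancel, Matrix.mulVec_mulVec, seqProd]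
    simp only [hmul] at hstep
    refine ⟨hstep.1, hstep.2.trans ?_⟩
    have hI0 : 0 ≤ ∫ ω, rform α β γ ((seqProd (fun k => X k ω) m).mulVec v)
        ((seqProd (fun k => X k ω) m).mulVec v) ^ 2 ∂P := integral_nonneg fun ω => sq_nonneg _
    rw [Finset.sum_range_succ, Real.exp_add]
    calc
      _ ≤ Real.exp (s m) * ∫ ω, rform α β γ ((seqProd (fun k => X k ω) m).mulVec v)
            ((seqProd (fun k => X k ω) m).mulVec v) ^ 2 ∂P := by
          refine mul_le_mul_of_nonneg_right ?_ hI0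
          have := Real.add_one_le_exp (s m)
          linarith [hs m]
      _ ≤ Real.exp (s m) * (Real.exp (∑ k ∈ Finset.range m, s k) * rform α β γ v v ^ 2) :=
          mul_le_mul_of_nonneg_left ih.2 (Real.exp_pos _).le
      _ = _ := by ring

theorem pow_four_sumNorm_le_mulVec (M : Matrix (Fin 2) (Fin 2) ℂ) :
    sumNorm M ^ 4 ≤ 128 * (‖M.mulVec ![1, 0]‖ ^ 4 + ‖M.mulVec ![0, 1]‖ ^ 4) := by
  have e0 : ∀ i, ‖M i 0‖ ≤ ‖M.mulVec ![1, 0]‖ := fun i => by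
    have := norm_le_pi_norm (M.mulVec ![1, 0]) i
    simpa [Matrix.mulVec, dotProduct, Fin.sum_univ_two] using this
  have e1 : ∀ i, ‖M i 1‖ ≤ ‖M.mulVec ![0, 1]‖ := fun i => by
    have := norm_le_pi_norm (M.mulVec ![0, 1]) i
    simpa [Matrix.mulVec, dotProduct, Fin.sum_univ_two] using this
  have h1 : sumNorm M ≤ 2 * (‖M.mulVec ![1, 0]‖ + ‖M.mulVec ![0, 1]‖) := by
    simp only [sumNorm, Fin.sum_univ_two]
    linarith [e0 0, e0 1, e1 0, e1 1]
  have h2 := pow_le_pow_left₀ (sumNorm_nonneg M) h1 4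
  refine h2.trans ?_
  generalize ‖M.mulVec ![1, 0]‖ = x
  generalize ‖M.mulVec ![0, 1]‖ = y
  have h3 : (x + y) ^ 2 ≤ 2 * (x ^ 2 + y ^ 2) := by nlinarith [sq_nonneg (x - y)]
  have h4 := pow_le_pow_left₀ (sq_nonneg (x + y)) h3 2
  nlinarith [sq_nonneg (x ^ 2 - y ^ 2)]

/-- The invariant form is comparable to the squared norm, so its second moments bound the fourth
moments of the columns of the product. -/
theorem IsInvariantForm.lintegral_seqProd_le [IsProbabilityMeasure P]
    (h : IsInvariantForm κ L T α β γ) {X : ℕ → Ω → Matrix (Fin 2) (Fin 2) ℂ}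
    (hX : ∀ k i j, Measurable fun ω => X k ω i j)
    (hind : iIndepFun (fun (k : ℕ) ω (i j : Fin 2) => X k ω i j) P) {e₁ e₂ e₄ s : ℕ → ℝ} {σ : ℝ}
    (he₂ : ∀ k, 0 ≤ e₂ k) (he₄ : ∀ k, 0 ≤ e₄ k)
    (h1 : ∀ k i j, ‖∫ ω, X k ω i j ∂P - T i j‖ ≤ e₁ k)
    (h2 : ∀ k i j, ∫⁻ ω, ‖X k ω i j - T i j‖ₑ ^ 2 ∂P ≤ ENNReal.ofReal (e₂ k))
    (h4 : ∀ k i j, ∫⁻ ω, ‖X k ω i j - T i j‖ₑ ^ 4 ∂P ≤ ENNReal.ofReal (e₄ k))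
    (hs : ∀ k, 16 * (2 * L / κ) * e₁ k + 8 * (4 * L / κ) * (16 * e₂ k) +
      3 * (4 * L / κ) ^ 2 * (256 * e₄ k) ≤ s k) (hσ : ∀ m, ∑ k ∈ Finset.range m, s k ≤ σ) (m : ℕ) :
    ∫⁻ ω, ENNReal.ofReal (sumNorm (seqProd (fun k => X k ω) m) ^ 4) ∂P ≤
      ENNReal.ofReal (256 / κ ^ 2 * (Real.exp σ * (4 * L) ^ 2)) := by
  have key := fun v => h.integral_seqProd_le hX hind he₂ he₄ h1 h2 h4 hs v m
  let f (v : Fin 2 → ℂ) (ω : Ω) : ℝ := rform α β γ ((seqProd (fun k => X k ω) m).mulVec v)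
    ((seqProd (fun k => X k ω) m).mulVec v) ^ 2
  have hb : ∀ v : Fin 2 → ℂ, ‖v‖ = 1 → (∫ ω, f v ω ∂P) ≤ Real.exp σ * (4 * L) ^ 2 := by
    intro v hv
    have e1 := h.le_norm_sq v
    rw [hv, one_pow, mul_one] at e1
    refine (key v).2.trans (mul_le_mul (Real.exp_le_exp.2 (hσ m))
      (pow_le_pow_left₀ (h.nonneg v) e1 2) (sq_nonneg _) (Real.exp_pos _).le)
  have hn0 : ‖(![1, 0] : Fin 2 → ℂ)‖ = 1 := by simp [Pi.norm_def, Fin.univ_succ]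
  have hn1 : ‖(![0, 1] : Fin 2 → ℂ)‖ = 1 := by simp [Pi.norm_def, Fin.univ_succ]
  have hpt : ∀ ω, sumNorm (seqProd (fun k => X k ω) m) ^ 4 ≤
      128 / κ ^ 2 * (f ![1, 0] ω + f ![0, 1] ω) := by
    intro ω
    have e : ∀ v, ‖(seqProd (fun k => X k ω) m).mulVec v‖ ^ 4 ≤ f v ω / κ ^ 2 := by
      intro v
      rw [le_div_iff₀ (pow_pos h.κ_pos 2)]
      have := pow_le_pow_left₀ (mul_nonneg h.κ_pos.le (sq_nonneg _))
        (h.le ((seqProd (fun k => X k ω) m).mulVec v)) 2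
      refine le_trans (le_of_eq ?_) this
      ring
    refine (pow_four_sumNorm_le_mulVec _).trans ?_
    have := add_le_add (e ![1, 0]) (e ![0, 1])
    rw [← add_div] at this
    rw [div_mul_eq_mul_div, mul_div_assoc]
    linarith
  have hfint : Integrable (fun ω => 128 / κ ^ 2 * (f ![1, 0] ω + f ![0, 1] ω)) P :=
    ((key ![1, 0]).1.add (key ![0, 1]).1).const_mul _
  calc _ ≤ ∫⁻ ω, ENNReal.ofReal (128 / κ ^ 2 * (f ![1, 0] ω + f ![0, 1] ω)) ∂P :=
        lintegral_mono fun ω => ENNReal.ofReal_le_ofReal (hpt ω)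
    _ = ENNReal.ofReal (∫ ω, 128 / κ ^ 2 * (f ![1, 0] ω + f ![0, 1] ω) ∂P) := by
        rw [ofReal_integral_eq_lintegral_ofReal hfint]
        exact Eventually.of_forall fun ω => mul_nonneg (by positivity)
          (add_nonneg (sq_nonneg _) (sq_nonneg _))
    _ ≤ _ := by
        refine ENNReal.ofReal_le_ofReal ?_
        rw [integral_const_mul, integral_add (key ![1, 0]).1 (key ![0, 1]).1]
        have e1 := mul_le_mul_of_nonneg_left (add_le_add (hb _ hn0) (hb _ hn1))
          (by positivity : 0 ≤ 128 / κ ^ 2)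
        refine e1.trans (le_of_eq ?_)
        ring

end Moments


/-! ### Uniform moment bounds for products of transfer matrices -/

section Uniform

variable {Ω : Type*} [MeasurableSpace Ω] {P : Measure Ω}

/-- On a compact interval of energies the invariant forms of the limits `T l` satisfy common bounds,
so the fourth moments of all products of the random matrices `X l n` are bounded. -/
theorem exists_lintegral_sumNorm_le [IsProbabilityMeasure P]
    {X : ℝ → ℕ → Ω → Matrix (Fin 2) (Fin 2) ℂ} {T : ℝ → Matrix (Fin 2) (Fin 2) ℂ} {t : ℕ → ℝ}
    {a b : ℝ} (hT : ContinuousOn T (Set.Icc a b)) (hTSL : ∀ l ∈ Set.Icc a b, T l ∈ expSL2)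
    (hTell : ∀ l ∈ Set.Icc a b, ‖(T l).trace‖ < 2) (ht : Summable fun n => t n ^ 2)
    (hclose : ∀ i j : Fin 2, UniformlyWellBalanced P t 4 (fun l n ω => X l n ω i j)
      (fun l => T l i j) (Set.Icc a b))
    (hind : ∀ l ∈ Set.Icc a b, iIndepFun (fun (n : ℕ) ω (i j : Fin 2) => X l (n + 1) ω i j) P) :
    ∃ C : ℝ, ∀ l ∈ Set.Icc a b, ∀ K m : ℕ,
      ∫⁻ ω, ENNReal.ofReal (sumNorm (seqProd (fun k => X l (K + k + 1) ω) m) ^ 4) ∂P ≤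
        ENNReal.ofReal C := by
  rcases (Set.Icc a b).eq_empty_or_nonempty with hemp | hne
  · exact ⟨0, by simp [hemp]⟩
  have hTij : ∀ i j, ContinuousOn (fun l => T l i j) (Set.Icc a b) := fun i j =>
    ((continuous_id.matrix_elem i j).comp_continuousOn hT)
  -- uniform bounds for the trace and the entries of `T`
  obtain ⟨l₀, hl₀, hmax⟩ := isCompact_Icc.exists_isMaxOn hne
    ((continuous_id.matrix_trace.norm).comp_continuousOn hT)
  have htr : ∀ l ∈ Set.Icc a b, ‖(T l).trace‖ ≤ ‖(T l₀).trace‖ := fun l hl => hmax hl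
  choose Kb hKb using fun i j => isCompact_Icc.exists_bound_of_continuousOn (hTij i j)
  obtain ⟨L, hL⟩ : ∃ L, L = ∑ i, ∑ j, |Kb i j| := ⟨_, rfl⟩
  have hent : ∀ l ∈ Set.Icc a b, ∀ i j, ‖T l i j‖ ≤ L := by
    intro l hl i j
    refine (hKb i j l hl).trans ((le_abs_self _).trans ?_)
    rw [hL]
    exact (Finset.single_le_sum (f := fun j => |Kb i j|) (fun _ _ => abs_nonneg _)
      (Finset.mem_univ j)).trans (Finset.single_le_sum (f := fun i => ∑ j, |Kb i j|)
        (fun _ _ => Finset.sum_nonneg fun _ _ => abs_nonneg _) (Finset.mem_univ i))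
  -- the lower bound for the forms in `exists_isInvariantForm`
  obtain ⟨κ, hκ⟩ : ∃ κ, κ = (1 - ‖(T l₀).trace‖ ^ 2 / 4) / (2 * L) := ⟨_, rfl⟩
  -- a common constant for all entries and moments
  choose C hC using fun i j => (hclose i j).2.2
  obtain ⟨c, hc⟩ : ∃ c, c = ∑ i, ∑ j, (|C i j 0| + |C i j 2| + |C i j 4|) := ⟨_, rfl⟩
  have hCc : ∀ i j, |C i j 0| + |C i j 2| + |C i j 4| ≤ c := by
    intro i j
    rw [hc]
    exact (Finset.single_le_sum (f := fun j => |C i j 0| + |C i j 2| + |C i j 4|)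
      (fun _ _ => by positivity) (Finset.mem_univ j)).trans
        (Finset.single_le_sum (f := fun i => ∑ j, (|C i j 0| + |C i j 2| + |C i j 4|))
        (fun _ _ => Finset.sum_nonneg fun _ _ => by positivity) (Finset.mem_univ i))
  have hc0 : ∀ i j, C i j 0 ≤ c := fun i j => by
    linarith [hCc i j, le_abs_self (C i j 0), abs_nonneg (C i j 2), abs_nonneg (C i j 4)]
  have hc2 : ∀ i j, C i j 2 ≤ c := fun i j => by
    linarith [hCc i j, le_abs_self (C i j 2), abs_nonneg (C i j 0), abs_nonneg (C i j 4)]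
  have hc4 : ∀ i j, C i j 4 ≤ c := fun i j => by
    linarith [hCc i j, le_abs_self (C i j 4), abs_nonneg (C i j 0), abs_nonneg (C i j 2)]
  have hcpos : 0 ≤ c :=
    (by positivity : (0 : ℝ) ≤ |C 0 0 0| + |C 0 0 2| + |C 0 0 4|).trans (hCc 0 0)
  obtain ⟨Θ, hΘ⟩ : ∃ Θ, Θ = ∑' n, t n ^ 2 := ⟨_, rfl⟩
  have htΘ : ∀ n, t n ^ 2 ≤ Θ := fun n => hΘ ▸ ht.le_tsum n fun _ _ => sq_nonneg _
  obtain ⟨s₀, hs₀⟩ : ∃ s₀, s₀ = 16 * (2 * L / κ) * c + 8 * (4 * L / κ) * (16 * c) +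
    3 * (4 * L / κ) ^ 2 * (256 * (c * Θ)) := ⟨_, rfl⟩
  refine ⟨256 / κ ^ 2 * (Real.exp (s₀ * Θ) * (4 * L) ^ 2), fun l hl K m => ?_⟩
  obtain ⟨hκ0, α, β, γ, hform⟩ := exists_isInvariantForm (hTSL l hl) (hTell l₀ hl₀) (htr l hl)
    (hent l hl)
  rw [← hκ] at hform hκ0
  have hL0 := hform.L_nonneg
  have hae : ∀ k i j, AEMeasurable (fun ω => X l (K + k + 1) ω i j) P := fun k i j =>
    (hC i j l hl (K + k + 1) (by omega)).1
  -- measurable versions of the shifted random matrices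
  let X' : ℕ → Ω → Matrix (Fin 2) (Fin 2) ℂ := fun k ω i j => (hae k i j).mk _ ω
  have hX' : ∀ k i j, Measurable fun ω => X' k ω i j := fun k i j => (hae k i j).measurable_mk
  have heq : ∀ k, ∀ᵐ ω ∂P, X l (K + k + 1) ω = X' k ω := by
    intro k
    filter_upwards [ae_all_iff.2 fun i => ae_all_iff.2 fun j => (hae k i j).ae_eq_mk] with ω hω
    ext i j
    exact hω i j
  have hind' : iIndepFun (fun (k : ℕ) ω (i j : Fin 2) => X' k ω i j) P := by
    have e1 := (hind l hl).precomp (g := fun k => K + k) (add_right_injective K)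
    refine e1.congr fun k => ?_
    filter_upwards [heq k] with ω hω
    funext i j
    rw [hω]
  have hmom : ∀ k i j (p : ℕ), 1 ≤ p → p ≤ 4 → C i j p ≤ c →
      ∫⁻ ω, ‖X' k ω i j - T l i j‖ₑ ^ p ∂P ≤ ENNReal.ofReal (c * t (K + k + 1) ^ p) := by
    intro k i j p hp hp4 hpc
    have ht0 := (hclose i j).1 (K + k + 1) (by omega)
    refine le_trans (le_of_eq (lintegral_congr_ae ?_))
      (((hC i j l hl (K + k + 1) (by omega)).2.1 p hp hp4).trans
        (ENNReal.ofReal_le_ofReal (mul_le_mul_of_nonneg_right hpc (pow_pos ht0 p).le)))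
    filter_upwards [heq k] with ω hω
    rw [hω]
  have hfin := hform.lintegral_seqProd_le (X := X') hX' hind'
    (e₁ := fun k => c * t (K + k + 1) ^ 2) (e₂ := fun k => c * t (K + k + 1) ^ 2)
    (e₄ := fun k => c * t (K + k + 1) ^ 4) (s := fun k => s₀ * t (K + k + 1) ^ 2) (σ := s₀ * Θ)
    (fun k => by positivity) (fun k => by positivity)
    (fun k i j => by
      have e1 : ∫ ω, X' k ω i j ∂P = ∫ ω, X l (K + k + 1) ω i j ∂P := by
        refine integral_congr_ae ?_
        filter_upwards [heq k] with ω hω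
        rw [hω]
      rw [e1]
      exact (hC i j l hl (K + k + 1) (by omega)).2.2.le.trans
        (mul_le_mul_of_nonneg_right (hc0 i j) (sq_nonneg _)))
    (fun k i j => hmom k i j 2 (by norm_num) (by norm_num) (hc2 i j))
    (fun k i j => hmom k i j 4 (by norm_num) (by norm_num) (hc4 i j))
    (fun k => by
      have e1 : c * t (K + k + 1) ^ 4 ≤ c * Θ * t (K + k + 1) ^ 2 := by
        have := mul_le_mul_of_nonneg_right (htΘ (K + k + 1)) (sq_nonneg (t (K + k + 1)))
        have := mul_le_mul_of_nonneg_left this hcpos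
        linarith
      have e2 := mul_le_mul_of_nonneg_left e1 (by positivity : 0 ≤ 3 * (4 * L / κ) ^ 2 * 256)
      rw [hs₀]
      linarith)
    (fun m => by
      rw [← Finset.mul_sum]
      refine mul_le_mul_of_nonneg_left ?_ (hs₀ ▸ ?_)
      · have e1 := ht.sum_le_tsum ((Finset.range m).map
          ⟨fun k => K + k + 1, fun x y h => by simpa using h⟩) fun _ _ => sq_nonneg _
        rw [Finset.sum_map, ← hΘ] at e1
        exact e1
      · have : 0 ≤ Θ := (sq_nonneg _).trans (htΘ 0)
        positivity) m
  refine le_trans (le_of_eq (lintegral_congr_ae ?_)) hfin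
  filter_upwards [ae_all_iff.2 heq] with ω hω
  rw [seqProd_congr fun k _ => hω k]

end Uniform


/-! ### Random one-channel operators are regular -/

section Random

variable {S : ℤ → Type*} [∀ n, Fintype (S n)] [∀ n, DecidableEq (S n)] {Ω : Type*}
  [MeasurableSpace Ω] {P : Measure Ω} {D : Ω → Data S}

theorem transferProd_eq_seqProd (D : Data S) (K : ℕ) (z : ℂ) (m : ℕ) :
    D.transferProd K z m = seqProd (fun k => D.transfer (K + k + 1) z) m := by
  induction m with
  | zero => rfl
  | succ m ih => rw [Data.transferProd, seqProd, ih]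

theorem measurable_det {α ι : Type*} [MeasurableSpace α] [Fintype ι] [DecidableEq ι]
    {A : α → Matrix ι ι ℂ} (h : ∀ i j, Measurable fun p => A p i j) :
    Measurable fun p => (A p).det := by
  simp only [Matrix.det_apply']
  exact Finset.measurable_sum _ fun σ _ =>
    (Finset.measurable_prod _ fun i _ => h (σ i) i).const_mul _

theorem measurable_adjugate {α ι : Type*} [MeasurableSpace α] [Fintype ι] [DecidableEq ι]
    {A : α → Matrix ι ι ℂ} (h : ∀ i j, Measurable fun p => A p i j) (i j : ι) :
    Measurable fun p => (A p).adjugate i j := by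
  simp only [Matrix.adjugate_apply]
  refine measurable_det fun k l => ?_
  simp only [Matrix.updateRow_apply]
  split
  · exact measurable_const
  · exact h k l

theorem IsRandom.measurable_green (hD : IsRandom D) {n : ℤ} (x y : Ω → EuclideanSpace ℂ (S n))
    (hx : ∀ i, Measurable fun ω => x ω i) (hy : ∀ i, Measurable fun ω => y ω i) :
    Measurable fun p : ℝ × Ω => (D p.2).green n (p.1 : ℂ) (x p.2) (y p.2) := by
  have hM : ∀ i j, Measurable fun p : ℝ × Ω =>
      ((D p.2).V n - (p.1 : ℂ) • (1 : Matrix (S n) (S n) ℂ)) i j := fun i j =>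
    ((hD.1 n i j).comp measurable_snd).sub
      ((Complex.measurable_ofReal.comp measurable_fst).mul_const _)
  have hdet := measurable_det hM
  have hadj := measurable_adjugate hM
  simp only [Data.green, Data.inner_toEuclideanLin, Matrix.inv_def, Ring.inverse_eq_inv',
    Matrix.smul_apply, smul_eq_mul]
  refine Finset.measurable_sum _ fun i _ => Finset.measurable_sum _ fun j _ => ?_
  exact ((Complex.continuous_conj.measurable.comp ((hx i).comp measurable_snd)).mul
    (hdet.inv.mul (hadj i j))).mul ((hy j).comp measurable_snd)

theorem IsRandom.measurable_beta (hD : IsRandom D) (n : ℤ) :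
    Measurable fun p : ℝ × Ω => (D p.2).beta n (p.1 : ℂ) :=
  hD.measurable_green (fun ω => (D ω).Υ n) (fun ω => (D ω).Φ n) (hD.2.2.2 n) (hD.2.2.1 n)

theorem IsRandom.measurable_rawTransfer (hD : IsRandom D) (n : ℤ) (i j : Fin 2) :
    Measurable fun p : ℝ × Ω => (D p.2).rawTransfer n (p.1 : ℂ) i j := by
  have ha : Measurable fun p : ℝ × Ω => ((D p.2).a n : ℂ) :=
    Complex.measurable_ofReal.comp ((hD.2.1 n).comp measurable_snd)
  have hα : Measurable fun p : ℝ × Ω => (D p.2).alpha n (p.1 : ℂ) :=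
    hD.measurable_green (fun ω => (D ω).Υ n) (fun ω => (D ω).Υ n) (hD.2.2.2 n) (hD.2.2.2 n)
  have hβ := hD.measurable_beta n
  have hγ : Measurable fun p : ℝ × Ω => (D p.2).gamma n (p.1 : ℂ) :=
    hD.measurable_green (fun ω => (D ω).Φ n) (fun ω => (D ω).Υ n) (hD.2.2.1 n) (hD.2.2.2 n)
  have hδ : Measurable fun p : ℝ × Ω => (D p.2).delta n (p.1 : ℂ) :=
    hD.measurable_green (fun ω => (D ω).Φ n) (fun ω => (D ω).Φ n) (hD.2.2.1 n) (hD.2.2.1 n)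
  fin_cases i <;> fin_cases j
  · exact ha.inv.mul hβ.inv
  · exact (ha.neg.mul hβ.inv).mul hα
  · exact (ha.inv.mul hδ).mul hβ.inv
  · exact ha.mul (hγ.sub ((hδ.mul hβ.inv).mul hα))

/-- The fourth power of the size of a product of transfer matrices, computed from the formula for
the transfer matrices that is valid outside a finite set of energies. Unlike the holomorphic
extension, it is jointly measurable in the energy and the randomness by inspection. -/
def rawPow (D : Data S) (K m : ℕ) (x : ℝ) : ℝ≥0∞ :=
  ENNReal.ofReal (sumNorm (seqProd (fun k => D.rawTransfer (K + k + 1) (x : ℂ)) m) ^ 4)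

theorem IsRandom.measurable_rawPow (hD : IsRandom D) (K m : ℕ) :
    Measurable fun p : ℝ × Ω => rawPow (D p.2) K m p.1 := by
  have h := measurable_seqProd
    (X := fun k (p : ℝ × Ω) => (D p.2).rawTransfer (K + k + 1) (p.1 : ℂ))
    (fun k i j => hD.measurable_rawTransfer _ i j) m
  refine ENNReal.measurable_ofReal.comp (Measurable.pow_const ?_ 4)
  exact Finset.measurable_sum _ fun i _ => Finset.measurable_sum _ fun j _ => (h i j).norm

theorem rawPow_eq {D : Data S} {x : ℝ} (h : ∀ n : ℤ, 1 ≤ n → D.beta n (x : ℂ) ≠ 0) (K m : ℕ) :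
    rawPow D K m x = ENNReal.ofReal (sumNorm (D.transferProd K x m) ^ 4) := by
  rw [rawPow, transferProd_eq_seqProd]
  congr 3
  exact seqProd_congr fun k _ => (Data.transfer_eq (h _ (by omega))).symm

theorem ae_beta_ne_zero {D : Data S} (h : ∀ n : ℤ, 1 ≤ n → ∃ z, D.beta n z ≠ 0) :
    ∀ᵐ x : ℝ, ∀ n : ℤ, 1 ≤ n → D.beta n (x : ℂ) ≠ 0 := by
  refine ae_all_iff.2 fun n => ?_
  by_cases hn : 1 ≤ n
  · have hfin := (D.finite_green_eq_zero n (h n hn)).preimage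
      (f := fun x : ℝ => (x : ℂ)) Complex.ofReal_injective.injOn
    filter_upwards [hfin.measure_zero volume |> compl_mem_ae_iff.2] with x hx _
    exact hx
  · exact Eventually.of_forall fun x h1 => absurd h1 hn

/-- By Tonelli's theorem, the bound `C` for the fourth moments bounds the
expectation of the integrals over an interval; by Fatou's lemma these integrals almost surely do not
tend to infinity. -/
theorem IsRandom.ae_frequently_le [SFinite P] (hD : IsRandom D) {a b : ℝ} {C : ℝ} {K : ℕ}
    (hC : ∀ m, ∀ᵐ x ∂(volume.restrict (Set.Icc a b)), ∫⁻ ω, rawPow (D ω) K m x ∂P ≤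
      ENNReal.ofReal C) :
    ∀ᵐ ω ∂P, (∃ M : ℝ≥0∞, M ≠ ∞ ∧
      ∃ᶠ m in atTop, ∫⁻ x in Set.Icc a b, rawPow (D ω) K m x ≤ M) ∧
      ∀ m, ∫⁻ x in Set.Icc a b, rawPow (D ω) K m x < ∞ := by
  obtain ⟨M, hM⟩ : ∃ M, M = ENNReal.ofReal C * volume (Set.Icc a b) := ⟨_, rfl⟩
  have hMtop : M < ∞ := by
    rw [hM, Real.volume_Icc]
    exact ENNReal.mul_lt_top ENNReal.ofReal_lt_top ENNReal.ofReal_lt_top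
  have hmeas : ∀ m, Measurable fun ω => ∫⁻ x in Set.Icc a b, rawPow (D ω) K m x := fun m =>
    (hD.measurable_rawPow K m).lintegral_prod_left'
  have hle : ∀ m, ∫⁻ ω, (∫⁻ x in Set.Icc a b, rawPow (D ω) K m x) ∂P ≤ M := by
    intro m
    rw [← lintegral_lintegral_swap (hD.measurable_rawPow K m).aemeasurable, hM,
      ← setLIntegral_const]
    exact lintegral_mono_ae (hC m)
  have hfatou := (lintegral_liminf_le hmeas (u := atTop)).trans
    (liminf_le_of_frequently_le' (Frequently.of_forall hle))
  filter_upwards [ae_lt_top (.liminf hmeas) (hfatou.trans_lt hMtop).ne,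
    ae_all_iff.2 fun m => ae_lt_top (hmeas m) ((hle m).trans_lt hMtop).ne] with ω h1 h2
  refine ⟨?_, h2⟩
  obtain ⟨M', h3, h4⟩ := exists_between h1
  exact ⟨M', h4.ne, (frequently_lt_of_liminf_lt (by isBoundedDefault) h3).mono fun _ h => h.le⟩

/-- A pole of a transfer matrix would not be integrable. -/
theorem transferDefined_of_rawPow {D : Data S} {K : ℕ} {l a b : ℝ}
    (hβ : ∃ z, D.beta (K + 1) z ≠ 0) (hab : a < b) (hl : l ∈ Set.Icc a b)
    (hm : ∀ i j, Measurable fun x : ℝ => D.rawTransfer (K + 1) (x : ℂ) i j)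
    (h : ∫⁻ x in Set.Icc a b, rawPow D K 1 x < ∞) : D.TransferDefined (K + 1) (l : ℂ) := by
  refine Data.transferDefined_of_integrableOn hβ hab hl fun i j => ?_
  refine ⟨(hm i j).aestronglyMeasurable, ?_⟩
  have hfin : ∫⁻ x in Set.Icc a b, (1 + rawPow D K 1 x) < ∞ := by
    rw [lintegral_add_left measurable_const, setLIntegral_const, one_mul, Real.volume_Icc]
    exact ENNReal.add_lt_top.2 ⟨ENNReal.ofReal_lt_top, h⟩
  refine lt_of_le_of_lt (lintegral_mono fun x => ?_) hfin
  rw [← ofReal_norm, rawPow, ← ENNReal.ofReal_one,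
    ← ENNReal.ofReal_add zero_le_one (by positivity)]
  refine ENNReal.ofReal_le_ofReal ?_
  have e1 : seqProd (fun k => D.rawTransfer (K + k + 1) (x : ℂ)) 1 =
      D.rawTransfer (K + 1) (x : ℂ) := by
    simp [seqProd]
  have e2 : ‖D.rawTransfer (K + 1) (x : ℂ) i j‖ ≤ sumNorm (D.rawTransfer (K + 1) (x : ℂ)) :=
    (Finset.single_le_sum (f := fun j => ‖D.rawTransfer (K + 1) (x : ℂ) i j‖)
      (fun _ _ => norm_nonneg _) (Finset.mem_univ j)).trans
        (Finset.single_le_sum (f := fun i => ∑ j, ‖D.rawTransfer (K + 1) (x : ℂ) i j‖)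
        (fun _ _ => Finset.sum_nonneg fun _ _ => norm_nonneg _) (Finset.mem_univ i))
  rw [e1]
  generalize sumNorm (D.rawTransfer (K + 1) (x : ℂ)) = s at *
  nlinarith [sq_nonneg (s ^ 2 - 1), sq_nonneg (s - 1), sq_nonneg s]

/-- Bounds for the fourth moments, locally uniform in the energy, imply regularity: the energies
where the formula for the transfer matrices fails are negligible by Fubini's theorem. -/
theorem IsRandom.ae_regular [IsProbabilityMeasure P] (hD : IsRandom D) {I : Set ℝ} (hI : IsOpen I)
    (hdef : ∀ l ∈ I, ∀ n : ℤ, 1 ≤ n → ∀ᵐ ω ∂P, (D ω).TransferDefined n (l : ℂ))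
    (hbound : ∀ a b : ℝ, a ≤ b → Set.Icc a b ⊆ I → ∃ C : ℝ, ∀ l ∈ Set.Icc a b, ∀ K m : ℕ,
      ∫⁻ ω, ENNReal.ofReal (sumNorm ((D ω).transferProd K (l : ℂ) m) ^ 4) ∂P ≤ ENNReal.ofReal C) :
    ∀ᵐ ω ∂P, (D ω).Regular I := by
  rcases I.eq_empty_or_nonempty with rfl | ⟨l₀, hl₀⟩
  · refine Eventually.of_forall fun ω => ⟨fun l hl => hl.elim, fun K a b hab =>
      ⟨0, by simp, Frequently.of_forall fun m => ?_⟩⟩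
    rw [Set.subset_empty_iff.1 hab]
    simp
  have hβ : ∀ᵐ ω ∂P, ∀ n : ℤ, 1 ≤ n → ∃ z, (D ω).beta n z ≠ 0 := by
    refine ae_all_iff.2 fun n => ?_
    by_cases hn : 1 ≤ n
    · filter_upwards [hdef l₀ hl₀ n hn] with ω hω _
      exact hω.exists_beta
    · exact Eventually.of_forall fun ω h => absurd h hn
  -- the formula for the transfer matrices is valid for almost every energy, almost surely
  have hβae : ∀ᵐ x : ℝ, ∀ᵐ ω ∂P, ∀ n : ℤ, 1 ≤ n → (D ω).beta n (x : ℂ) ≠ 0 := by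
    rw [Measure.ae_ae_comm]
    · filter_upwards [hβ] with ω hω
      exact ae_beta_ne_zero hω
    · have h : {p : ℝ × Ω | ∀ n : ℤ, 1 ≤ n → (D p.2).beta n (p.1 : ℂ) ≠ 0} =
          ⋂ n : ℤ, ⋂ _ : 1 ≤ n, {p : ℝ × Ω | (D p.2).beta n (p.1 : ℂ) = 0}ᶜ := by
        ext p
        simp
      rw [h]
      exact MeasurableSet.iInter fun n => MeasurableSet.iInter fun _ =>
        (measurableSet_eq_fun (hD.measurable_beta n) measurable_const).compl
  have hkey : ∀ᵐ ω ∂P, ∀ (K : ℕ) (q : ℚ × ℚ), Set.Icc (q.1 : ℝ) q.2 ⊆ I →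
      (∃ M : ℝ≥0∞, M ≠ ∞ ∧
        ∃ᶠ m in atTop, ∫⁻ x in Set.Icc (q.1 : ℝ) q.2, rawPow (D ω) K m x ≤ M) ∧
      ∀ m, ∫⁻ x in Set.Icc (q.1 : ℝ) q.2, rawPow (D ω) K m x < ∞ := by
    refine ae_all_iff.2 fun K => ae_all_iff.2 fun q => ?_
    by_cases hq : Set.Icc (q.1 : ℝ) q.2 ⊆ I
    · rcases lt_or_ge (q.2 : ℝ) q.1 with hlt | hle
      · refine Eventually.of_forall fun ω _ => ?_
        rw [Set.Icc_eq_empty hlt.not_ge]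
        exact ⟨⟨0, by simp, Frequently.of_forall fun m => by simp⟩, by simp⟩
      obtain ⟨C, hC⟩ := hbound _ _ hle hq
      have := hD.ae_frequently_le (P := P) (a := q.1) (b := q.2) (C := C) (K := K) fun m => by
        filter_upwards [ae_restrict_mem measurableSet_Icc, ae_restrict_of_ae hβae] with x hx hβx
        refine le_trans (le_of_eq (lintegral_congr_ae ?_)) (hC x hx K m)
        filter_upwards [hβx] with ω hω
        exact rawPow_eq hω K m
      filter_upwards [this] with ω hω _ using hω
    · exact Eventually.of_forall fun ω h => absurd h hq
  filter_upwards [hβ, hkey] with ω hβω hω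
  refine ⟨fun l hl n hn => ?_, fun K a b hab => ?_⟩
  · obtain ⟨ε, hε, hball⟩ := Metric.isOpen_iff.1 hI l hl
    obtain ⟨a, ha1, ha2⟩ := exists_rat_btwn (sub_lt_self l hε)
    obtain ⟨b, hb1, hb2⟩ := exists_rat_btwn (lt_add_of_pos_right l hε)
    have hsub : Set.Icc (a : ℝ) b ⊆ I := fun x hx => hball (by
      rw [Metric.mem_ball, Real.dist_eq, abs_lt]
      constructor <;> linarith [hx.1, hx.2])
    obtain ⟨K, rfl⟩ : ∃ K : ℕ, n = K + 1 := ⟨(n - 1).toNat, by omega⟩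
    refine transferDefined_of_rawPow (hβω _ hn) (ha2.trans hb1) ⟨ha2.le, hb1.le⟩ (fun i j => ?_)
      ((hω K (a, b) hsub).2 1)
    exact (hD.measurable_rawTransfer (K + 1) i j).comp
      (g := fun p : ℝ × Ω => (D p.2).rawTransfer (K + 1) (p.1 : ℂ) i j)
      (f := fun x : ℝ => (x, ω)) measurable_prodMk_right
  · obtain ⟨M, hM, hfreq⟩ := (hω K (a, b) hab).1
    refine ⟨M, hM, hfreq.mono fun m hm => le_trans (le_of_eq (lintegral_congr_ae ?_)) hm⟩
    filter_upwards [ae_restrict_of_ae (ae_beta_ne_zero hβω)] with x hx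
    exact (rawPow_eq hx K m).symm

end Random

end OneChannel

theorem mainTheorem2 {S : ℤ → Type*} [∀ n, Fintype (S n)] [∀ n, DecidableEq (S n)]
    {Ω : Type*} [MeasurableSpace Ω] (P : Measure Ω) [IsProbabilityMeasure P]
    (D : Ω → OneChannel.Data S) (hD : OneChannel.IsRandom D)
    (hsa : ∀ᵐ ω ∂P, (D ω).UniquelySelfAdjoint Set.univ)
    (I : Set ℝ) (hI : IsOpen I)
    (hdef : ∀ l ∈ I, ∀ n : ℤ, 1 ≤ n → ∀ᵐ ω ∂P, (D ω).TransferDefined n (l : ℂ))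
    (hindep : ∀ l ∈ I, iIndepFun
      (fun (n : Set.Ici (1 : ℤ)) ω (i j : Fin 2) => (D ω).transfer n (l : ℂ) i j) P)
    (T : ℝ → Matrix (Fin 2) (Fin 2) ℂ) (hT : ContinuousOn T I)
    (hTSL : ∀ l ∈ I, T l ∈ OneChannel.expSL2)
    (hTell : ∀ l ∈ I, ‖(T l).trace‖ < 2)
    (t : ℕ → ℝ) (ht : Summable fun n => t n ^ 2)
    (hclose : ∀ a b : ℝ, a ≤ b → Set.Icc a b ⊆ I → ∀ i j : Fin 2,
      OneChannel.UniformlyWellBalanced P t 4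
        (fun l n ω => (D ω).transfer n (l : ℂ) i j) (fun l => T l i j) (Set.Icc a b)) :
    ∀ᵐ ω ∂P,
      OneChannel.PurelyACOn
        (OneChannel.part ((D ω).H Set.univ) (D ω).fullSpace)
        {l ∈ I | (l : ℂ) ∉ (D ω).B Set.univ} ∧
      OneChannel.PurelyACOn
        (OneChannel.part ((D ω).H (Set.Ici 1)) (D ω).halfSpace)
        {l ∈ I | (l : ℂ) ∉ (D ω).B (Set.Ici 1)} := by
  have hreg : ∀ᵐ ω ∂P, (D ω).Regular I := by
    refine hD.ae_regular hI hdef fun a b hab hsub => ?_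
    let g : ℕ → Set.Ici (1 : ℤ) := fun n => ⟨((n + 1 : ℕ) : ℤ), Set.mem_Ici.2 (by omega)⟩
    have hg : Function.Injective g := fun x y h => by simpa [g] using h
    have hind : ∀ l ∈ Set.Icc a b, iIndepFun (fun (n : ℕ) ω (i j : Fin 2) =>
        (D ω).transfer (g n) (l : ℂ) i j) P := fun l hl => (hindep l (hsub hl)).precomp hg
    obtain ⟨C, hC⟩ := OneChannel.exists_lintegral_sumNorm_le (P := P)
      (X := fun l n ω => (D ω).transfer (n : ℤ) (l : ℂ)) (T := T) (t := t) (hT.mono hsub)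
      (fun l hl => hTSL l (hsub hl)) (fun l hl => hTell l (hsub hl)) ht (hclose a b hab hsub) hind
    refine ⟨C, fun l hl K m => ?_⟩
    have h := hC l hl K m
    simp only [Nat.cast_add, Nat.cast_one] at h
    simp only [OneChannel.transferProd_eq_seqProd]
    exact h
  filter_upwards [hreg, hsa] with ω h1 h2
  exact ⟨OneChannel.Data.purelyACOn_full _ h2 hI h1, OneChannel.Data.purelyACOn_half _ h2 hI h1⟩

end
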